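/- \textbf{Setting.} Let $A,B,C$ be real square matrices of sizes $m,n,\ell\ge 0$, and consider the non-autonomous system for $u=(x,y,z)\in\mathbb R^{m}\times\mathbb R^{n}\times\mathbb R^{\ell}$ $$\dot x=Ax+f(t,x,y,z),\qquad \dot y=By+g(t,x,y,z),\qquad \dot z=Cz+h(t,x,y,z),\qquad t\in\mathbb R. \tag{1}$$ Let $\mathfrak p\ge 2$ be an integer, $\alpha\ge 0$, $\beta>0$ with $\beta>(2\mathfrak p-1)\alpha$, such that the eigenvalues of $A$ have $|\Re\lambda|\le\alpha$, those of $B$ have $\Re\lambda\le-\beta$, and those of $C$ have $\Re\lambda\ge\beta$. Fix a threshold $\tilde\mu$ with $\mathfrak p\alpha\le\tilde\mu<\beta-(\mathfrak p-1)\alpha$. Write $O_p$ for $O(|X|^p+|Y|^p+|Z|^p)$ as $(X,Y,Z)\to0$. For each $t$ the function $N(t,\cdot)=(f,g,h)(t,\cdot)$ is $C^{\mathfrak p}$ on an open set $d\ni 0$ (independent of $t$) and is $O_2$. Let $2\le p\le\mathfrak p$. For $2\le k<p$, every degree-$k$ Taylor coefficient of $N(t,\cdot)$ at $0$ is written as $c_{\kappa,s}+b_{\kappa,s}(t)$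 ($\kappa$ a component, $s$ a multi-index, $|s|=k$), where $c_{\kappa,s}\in\mathbb R$ is constant (the autonomous part) and $b_{\kappa,s}$ is bounded and continuous on $\mathbb R$ (the non-autonomous terms). For $|\Re\nu|>\tilde\mu$ the fast-time convolution of a bounded continuous $a$ is $$(\mathcal Z_\nu a)(t)=\int_{-\infty}^t e^{\nu(t-\tau)}a(\tau)\,d\tau\ \ (\Re\nu<0),\qquad (\mathcal Z_\nu a)(t)=\int_t^{\infty} e^{\nu(t-\tau)}a(\tau)\,d\tau\ \ (\Re\nu>0).$$ \textbf{Theorem.} For every $2\le p\le\mathfrak p$ and all constants $c$ there are a transform $$x=x(t,X,Y,Z),\qquad y=y(t,X,Y,Z),\qquad z=z(t,X,Y,Z) \tag{2}$$ and a normal form $$\dot X=AX+F_c(t,X)+\mathcal F(t,X,Y,Z)YZ,\qquad \dot Y=[B+G(t,X,Y,Z)]Y,\qquad \dot Z=[C+H(t,X,Y,Z)]Z, \tag{3}$$ with $\mathcal F$ a rank-three tensor, given by multinomials in the state variables whose time-dependent coefficients are formal expressions in the non-autonomous terms $b$, the same for all systems (1) with these $A,B,C,c$, such that: (i) the transform is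 near identity, i.e. the identity plus terms of degree at least $2$; its coefficients are built from constants and the $b_{\kappa,s}$ by sums, products and convolutions $\mathcal Z_\nu$ with $|\Re\nu|>\tilde\mu$, and are $C^1$ in $t$; (ii) $F_c$, $GY$ and $HZ$ have only terms of degree at least $2$ in the state variables (hence so has $F=F_c+\mathcal FYZ$); (iii) memory and anticipation integrals occur in $F_c,\mathcal F,G,H$ only in terms at least quadratic in the non-autonomous terms: each coefficient is a constant, plus a finite constant-coefficient linear combination of the instantaneous values $b_{\kappa,s}(t)$, plus an expression (built as in (i)) all of whose terms have degree at least $2$ in $b$. (iv) for every system (1) as above with these $A,B,C,c$, there are balls about $0$ of radii $r,\rho>0$, independent of $t$, such that for each $t$ the transform $(X,Y,Z)\mapsto u(t,X,Y,Z)$ is a $C^\infty$ diffeomorphism of the $r$-ball onto an open set containing the $\rho$-ball, and the system (2)+(3) differs from (1) by $O_p$. That is, the vector field in $u$ obtained from (3) through (2) differs from the right-hand side of (1) by $O(|x|^p+|y|^p+|z|^p)$ as $u\to0$, and the residual of (1) upon substituting (2) and (3) is $O_p$. Both hold for each $t$, and uniformly in $t\in S$ for every set $S$ of times for which the order-$p$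 derivatives of $N(t,\cdot)$ are bounded near $0$ uniformly in $t\in S$. -/

import Mathlib

open Filter Topology Asymptotics
open scoped ContDiff BoundedContinuousFunction

namespace NonautNF

/-- Index set of the state variables: `m` centre, `n` stable and `l` unstable components. -/
abbrev Idx (m n l : ℕ) : Type := Fin m ⊕ Fin n ⊕ Fin l

/-- The state space `ℝ^(m+n+l)`. All norms on it are equivalent, and only order symbols, open
sets and boundedness are used below, so the sup norm serves. -/
abbrev State (m n l : ℕ) : Type := Idx m n l → ℝ

/-- The centre, stable and unstable blocks of a state. -/
def xPart {m n l : ℕ} (u : State m n l) : Fin m → ℝ := fun i => u (Sum.inl i)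
def yPart {m n l : ℕ} (u : State m n l) : Fin n → ℝ := fun j => u (Sum.inr (Sum.inl j))
def zPart {m n l : ℕ} (u : State m n l) : Fin l → ℝ := fun k => u (Sum.inr (Sum.inr k))

/-- The state with given blocks. -/
def glue {m n l : ℕ} (x : Fin m → ℝ) (y : Fin n → ℝ) (z : Fin l → ℝ) : State m n l :=
  Sum.elim x (Sum.elim y z)

/-- The gauge `|X|^p + |Y|^p + |Z|^p` of the order symbol. -/
noncomputable def orderGauge {m n l : ℕ} (p : ℕ) (u : State m n l) : ℝ :=
  ‖xPart u‖ ^ p + ‖yPart u‖ ^ p + ‖zPart u‖ ^ p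

/-- The linear part `(A x, B y, C z)`. -/
def linearPart {m n l : ℕ} (A : Matrix (Fin m) (Fin m) ℝ) (B : Matrix (Fin n) (Fin n) ℝ)
    (C : Matrix (Fin l) (Fin l) ℝ) (u : State m n l) : State m n l :=
  glue (A.mulVec (xPart u)) (B.mulVec (yPart u)) (C.mulVec (zPart u))

/-- Spectral hypotheses on the linear part up to order `P`, with a chosen threshold rate `μ`
in the spectral gap. -/
structure SpectralGap {m n l : ℕ} (A : Matrix (Fin m) (Fin m) ℝ) (B : Matrix (Fin n) (Fin n) ℝ)
    (C : Matrix (Fin l) (Fin l) ℝ) (α β μ : ℝ) (P : ℕ) : Prop where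
  alpha_nonneg : 0 ≤ α
  beta_pos : 0 < β
  center : ∀ z ∈ spectrum ℂ (A.map (algebraMap ℝ ℂ)), |z.re| ≤ α
  stable : ∀ z ∈ spectrum ℂ (B.map (algebraMap ℝ ℂ)), z.re ≤ -β
  unstable : ∀ z ∈ spectrum ℂ (C.map (algebraMap ℝ ℂ)), β ≤ z.re
  two_le : 2 ≤ P
  gap : (2 * (P : ℝ) - 1) * α < β
  threshold_lower : (P : ℝ) * α ≤ μ
  threshold_upper : μ < β - ((P : ℝ) - 1) * α

/-! ### The given system and its non-autonomous terms -/

/-- Labels of the Taylor coefficients of the nonlinearity: a component of the vector field and a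
multi-index in the state variables. -/
abbrev Label (m n l : ℕ) : Type := Idx m n l × (Idx m n l →₀ ℕ)

/-- The non-autonomous terms: a bounded continuous function of time for every label. -/
abbrev Forcing (m n l : ℕ) : Type := Label m n l → (ℝ →ᵇ ℝ)

/-- The nonlinearity `N = (f, g, h)` of `u' = L u + N(t, u)`: it is `C^P` in the state on a domain
`d` around the origin, it is strictly nonlinear, and for `2 ≤ k < p` its Taylor coefficients of
degree `k` at the origin are `c (κ, s) + b (κ, s) t`: an autonomous constant plus a non-autonomous
term, bounded and continuous in time. -/
structure IsNonlinearity {m n l : ℕ} (P p : ℕ) (c : Label m n l → ℝ) (b : Forcing m n l)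
    (d : Set (State m n l)) (N : ℝ → State m n l → State m n l) : Prop where
  isOpen : IsOpen d
  zero_mem : (0 : State m n l) ∈ d
  smooth : ∀ t, ContDiffOn ℝ (P : ℕ∞ω) (N t) d
  strictly_nonlinear : ∀ t, N t =O[𝓝 0] (orderGauge 2 : State m n l → ℝ)
  taylor : ∀ (t : ℝ) (κ : Idx m n l) (k : ℕ), 2 ≤ k → k < p → ∀ u : State m n l,
    ((k.factorial : ℝ))⁻¹ * iteratedFDeriv ℝ k (fun v => N t v κ) 0 (fun _ => u) =
      ∑ s ∈ (Finset.univ : Finset (Idx m n l)).finsuppAntidiag k,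
        (c (κ, s) + b (κ, s) t) * ∏ i, u i ^ s i

/-! ### Time-dependent coefficients built by fast-time convolutions -/

/-- The convolution over the past (`Re ν < 0`) or over the future (`Re ν > 0`) with `e^(ν t)`. It is
only used for fast rates, `|Re ν| > μ`. -/
noncomputable def fastConv (ν : ℂ) (a : ℝ → ℂ) (t : ℝ) : ℂ :=
  if ν.re < 0 then ∫ τ in Set.Iic t, Complex.exp (ν * ((t : ℂ) - (τ : ℂ))) * a τ
  else ∫ τ in Set.Ioi t, Complex.exp (ν * ((t : ℂ) - (τ : ℂ))) * a τ

/-- `FastExpr μ k a`: the time-dependent quantity `a b t` is built from constants and the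
non-autonomous terms `b` by sums, products and convolutions with fast rates, and all its terms are
of degree at least `k` in the non-autonomous terms. -/
inductive FastExpr {m n l : ℕ} (μ : ℝ) : ℕ → (Forcing m n l → ℝ → ℂ) → Prop
  | const (c : ℂ) : FastExpr μ 0 (fun _ _ => c)
  | forcing (i : Label m n l) : FastExpr μ 1 (fun b t => ((b i t : ℝ) : ℂ))
  | add {k : ℕ} {a a' : Forcing m n l → ℝ → ℂ} (h : FastExpr μ k a) (h' : FastExpr μ k a') :
      FastExpr μ k (fun b t => a b t + a' b t)
  | mul {j k : ℕ} {a a' : Forcing m n l → ℝ → ℂ} (h : FastExpr μ j a) (h' : FastExpr μ k a') :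
      FastExpr μ (j + k) (fun b t => a b t * a' b t)
  | conv {k : ℕ} {a : Forcing m n l → ℝ → ℂ} (ν : ℂ) (hν : μ < |ν.re|) (h : FastExpr μ k a) :
      FastExpr μ k (fun b => fastConv ν (a b))
  | weaken {k : ℕ} {a : Forcing m n l → ℝ → ℂ} (h : FastExpr μ (k + 1) a) : FastExpr μ k a

/-- Real time-dependent coefficients, as functionals of the non-autonomous terms. -/
abbrev Coeff (m n l : ℕ) : Type := Forcing m n l → ℝ → ℝ

/-- A coefficient built by fast-time convolutions. -/
def IsFast {m n l : ℕ} (μ : ℝ) (a : Coeff m n l) : Prop :=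
  FastExpr μ 0 (fun b t => ((a b t : ℝ) : ℂ))

/-- A coefficient whose memory and anticipation integrals occur only in terms that are at least
quadratic in the non-autonomous terms: it is a constant, plus a constant-coefficient linear
combination of the instantaneous values of the non-autonomous terms, plus terms of degree at least
two. -/
def MemoryOnlyQuadratic {m n l : ℕ} (μ : ℝ) (a : Coeff m n l) : Prop :=
  ∃ (c₀ : ℝ) (c₁ : Label m n l →₀ ℝ) (e : Coeff m n l),
    FastExpr μ 2 (fun b t => ((e b t : ℝ) : ℂ)) ∧
    ∀ b t, a b t = c₀ + c₁.sum (fun i w => w * b i t) + e b t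

/-- The value of a multinomial with time-dependent coefficients. -/
noncomputable def evalAt {m n l : ℕ} {σ : Type} (b : Forcing m n l) (t : ℝ) (u : σ → ℝ)
    (q : MvPolynomial σ (Coeff m n l)) : ℝ :=
  MvPolynomial.eval₂ ((Pi.evalRingHom (fun _ : ℝ => ℝ) t).comp
    (Pi.evalRingHom (fun _ : Forcing m n l => ℝ → ℝ) b)) u q

/-! ### Coordinate transforms and normal forms -/

/-- A multinomial time-dependent coordinate transform `u = u(t, U)`. -/
abbrev Transform (m n l : ℕ) : Type := Idx m n l → MvPolynomial (Idx m n l) (Coeff m n l)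

noncomputable def Transform.map {m n l : ℕ} (T : Transform m n l) (b : Forcing m n l) (t : ℝ)
    (U : State m n l) : State m n l :=
  fun κ => evalAt b t U (T κ)

/-- Near identity: only terms of degree at least two are added to the identity. -/
def Transform.NearIdentity {m n l : ℕ} (T : Transform m n l) : Prop :=
  ∀ κ s, Finsupp.degree s < 2 → MvPolynomial.coeff s (T κ - MvPolynomial.X κ) = 0

/-- The coefficients are built by fast-time convolutions and are `C^1` in time. -/
def Transform.Regular {m n l : ℕ} (μ : ℝ) (T : Transform m n l) : Prop :=
  ∀ κ s, IsFast μ (MvPolynomial.coeff s (T κ)) ∧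
    ∀ b, ContDiff ℝ 1 (MvPolynomial.coeff s (T κ) b)

/-- The multinomial coefficients of the normal form
`X' = A X + F_c(t, X) + 𝓕(t, X, Y, Z) Y Z`, `Y' = [B + G(t, X, Y, Z)] Y`,
`Z' = [C + H(t, X, Y, Z)] Z`. -/
structure NormalForm (m n l : ℕ) where
  Fc : Fin m → MvPolynomial (Fin m) (Coeff m n l)
  F : Fin m → Fin n → Fin l → MvPolynomial (Idx m n l) (Coeff m n l)
  G : Matrix (Fin n) (Fin n) (MvPolynomial (Idx m n l) (Coeff m n l))
  H : Matrix (Fin l) (Fin l) (MvPolynomial (Idx m n l) (Coeff m n l))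

/-- The nonlinear terms of the normal form are of order two. -/
def NormalForm.StrictlyNonlinear {m n l : ℕ} (Q : NormalForm m n l) : Prop :=
  (∀ i s, Finsupp.degree s < 2 → MvPolynomial.coeff s (Q.Fc i) = 0) ∧
  (∀ i j, MvPolynomial.constantCoeff (Q.G i j) = 0) ∧
  (∀ i j, MvPolynomial.constantCoeff (Q.H i j) = 0)

/-- Memory and anticipation integrals are present only in terms at least quadratic in the
non-autonomous terms. -/
def NormalForm.MemoryOnlyQuadratic {m n l : ℕ} (μ : ℝ) (Q : NormalForm m n l) : Prop :=
  (∀ i s, NonautNF.MemoryOnlyQuadratic μ (MvPolynomial.coeff s (Q.Fc i))) ∧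
  (∀ i j k s, NonautNF.MemoryOnlyQuadratic μ (MvPolynomial.coeff s (Q.F i j k))) ∧
  (∀ i j s, NonautNF.MemoryOnlyQuadratic μ (MvPolynomial.coeff s (Q.G i j))) ∧
  (∀ i j s, NonautNF.MemoryOnlyQuadratic μ (MvPolynomial.coeff s (Q.H i j)))

/-- The vector field of the normal form. -/
noncomputable def NormalForm.field {m n l : ℕ} (Q : NormalForm m n l)
    (A : Matrix (Fin m) (Fin m) ℝ) (B : Matrix (Fin n) (Fin n) ℝ) (C : Matrix (Fin l) (Fin l) ℝ)
    (b : Forcing m n l) (t : ℝ) (U : State m n l) : State m n l :=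
  glue
    (fun i => A.mulVec (xPart U) i + evalAt b t (xPart U) (Q.Fc i) +
      ∑ j, ∑ k, evalAt b t U (Q.F i j k) * yPart U j * zPart U k)
    ((B + Q.G.map (evalAt b t U)).mulVec (yPart U))
    ((C + Q.H.map (evalAt b t U)).mulVec (zPart U))

/-- The velocity `du/dt` of `u = u(t, U(t))`, as a function of `t` and `U`, when `U` evolves by the
vector field `W`: that is, `∂u/∂t + (∂u/∂U) W`. -/
noncomputable def velocity {m n l : ℕ} (φ W : ℝ → State m n l → State m n l) (t : ℝ)
    (U : State m n l) : State m n l :=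
  deriv (fun τ => φ τ U) t + fderiv ℝ (φ t) U (W t U)

/-- `W`, mapped by the coordinate transforms `Ψ t`, differs from `V` by order `p` uniformly for times
in `S`, both as vector fields in the original coordinates `u` and as the residual of `u' = V(t, u)`
in the new coordinates `U`. -/
def CloseOn {m n l : ℕ} (S : Set ℝ) (p : ℕ)
    (Ψ : ℝ → OpenPartialHomeomorph (State m n l) (State m n l))
    (W V : ℝ → State m n l → State m n l) : Prop :=
  ((fun q : ℝ × State m n l =>
      velocity (fun t => Ψ t) W q.1 ((Ψ q.1).symm q.2) - V q.1 q.2)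
    =O[𝓟 S ×ˢ 𝓝 0] fun q => orderGauge p q.2) ∧
  ((fun q : ℝ × State m n l =>
      velocity (fun t => Ψ t) W q.1 q.2 - V q.1 (Ψ q.1 q.2))
    =O[𝓟 S ×ˢ 𝓝 0] fun q => orderGauge p q.2)

end NonautNF

/-! The transform is built degree by degree in the state variables. Suppose a transform `T` and a
normal form `U' = L U + q` leave a residual of order `k`. Adding homogeneous fields `ξ` to `T` and
`r` to `q`, both of degree `k`, changes the degree-`k` part of the residual by `∂ξ/∂t + (Dξ · L U -
L ξ) + r`. Each step is therefore a linear homological equation for `(ξ, r)`, with `homOp L` as its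
operator.

After complexification every monomial field is a sum of generalized eigenvectors of `homOp L`, with
eigenvalues `z` that are sums of eigenvalues of `L` minus an eigenvalue of the block of the
component. Up to a nilpotent part, the equation becomes the scalar one `α' + z α = a`. If `|Re z| >
μ`, a fast convolution solves it with bounded `α`, and nothing goes into the normal form
(`HomologicallySolvable.of_fast_eigenvalue`). By the spectral gap this covers every term whose shape
the normal form forbids (`spectralGap_fast`). If `|Re z| ≤ μ`, the term is of a permitted shape. The
coefficient `a` is then split into a constant, a part linear in `b` and a part at least quadratic in
`b`. Constant and quadratic parts go into the normal form as they are. In the linear part,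
integration by parts strips one convolution of rate `ν` at a time, `ν + z` being nonzero because
`|Re ν| > μ ≥ |Re z|`, until only instantaneous values remain (`HomologicallySolvable.of_linFast`).

Coefficients are functionals of `b` and form the commutative ring `Coeff`, so the construction is
polynomial algebra over this ring and is the same for all systems. Orders are powers of the ideal
`idealOfVars`. Analysis enters through the bound `K / |Re ν|` on convolutions: for each `b` all
coefficients are bounded uniformly in time. Hence `T` is close to the identity on a ball independent
of `t`, and a residual in the `p`-th power of the ideal, together with the Taylor remainder of `N`,
gives an error of order `p` with constants uniform in time. -/

namespace NonautNF

/-! ### Fast-time convolutions: differential equation, bound, linearity -/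

section FastConvolution

open MeasureTheory Set

/-- Bounded continuous complex functions of time. -/
def BddCts (a : ℝ → ℂ) : Prop := Continuous a ∧ ∃ K, ∀ t, ‖a t‖ ≤ K

/-- The sign of the inhomogeneity in `(fastConv ν a)' = ν * fastConv ν a ± a`. -/
noncomputable def convSign (ν : ℂ) : ℂ := if ν.re < 0 then 1 else -1

theorem convSign_mul_self (ν : ℂ) : convSign ν * convSign ν = 1 := by
  unfold convSign; split_ifs <;> norm_num

theorem integrableOn_exp_mul_Iic_of_bddCts {ν : ℂ} (hν : ν.re < 0) {a : ℝ → ℂ} (ha : BddCts a)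
    (t : ℝ) : IntegrableOn (fun τ : ℝ => Complex.exp (-ν * τ) * a τ) (Iic t) := by
  obtain ⟨hc, K, hK⟩ := ha
  exact (integrableOn_exp_mul_complex_Iic (a := -ν) (by simpa using hν) t).mul_bdd
    hc.aestronglyMeasurable (ae_of_all _ hK)

theorem integrableOn_exp_mul_Ioi_of_bddCts {ν : ℂ} (hν : 0 < ν.re) {a : ℝ → ℂ} (ha : BddCts a)
    (t : ℝ) : IntegrableOn (fun τ : ℝ => Complex.exp (-ν * τ) * a τ) (Ioi t) := by
  obtain ⟨hc, K, hK⟩ := ha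
  exact (integrableOn_exp_mul_complex_Ioi (a := -ν) (by simpa using hν) t).mul_bdd
    hc.aestronglyMeasurable (ae_of_all _ hK)

theorem fastConv_of_neg {ν : ℂ} (hν : ν.re < 0) (a : ℝ → ℂ) (t : ℝ) :
    fastConv ν a t =
      Complex.exp (ν * t) * ∫ τ in Iic t, Complex.exp (-ν * τ) * a τ := by
  rw [fastConv, if_pos hν, ← integral_const_mul]
  congr 1; ext τ
  rw [← mul_assoc, ← Complex.exp_add]; ring_nf

theorem fastConv_of_pos {ν : ℂ} (hν : 0 < ν.re) (a : ℝ → ℂ) (t : ℝ) :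
    fastConv ν a t =
      Complex.exp (ν * t) * ∫ τ in Ioi t, Complex.exp (-ν * τ) * a τ := by
  rw [fastConv, if_neg hν.not_gt, ← integral_const_mul]
  congr 1; ext τ
  rw [← mul_assoc, ← Complex.exp_add]; ring_nf

theorem hasDerivAt_exp_mul_ofReal (ν : ℂ) (t : ℝ) :
    HasDerivAt (fun t : ℝ => Complex.exp (ν * t)) (ν * Complex.exp (ν * t)) t := by
  have h : HasDerivAt (fun t : ℝ => ν * (t : ℂ)) ν t := by
    simpa using (Complex.ofRealCLM.hasDerivAt (x := t)).const_mul ν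
  simpa [mul_comm] using h.cexp

/-- With `e^(ν t)` factored out, the convolution is an exponential times an integral whose only
dependence on time is its endpoint, so the product rule and the fundamental theorem of calculus
apply. -/
theorem hasDerivAt_fastConv {ν : ℂ} (hν : ν.re ≠ 0) {a : ℝ → ℂ} (ha : BddCts a) (t : ℝ) :
    HasDerivAt (fastConv ν a) (ν * fastConv ν a t + convSign ν * a t) t := by
  have hcont : Continuous fun τ : ℝ => Complex.exp (-ν * τ) * a τ := by
    have := ha.1; fun_prop
  have hone : Complex.exp (ν * t) * Complex.exp (-ν * t) = 1 := by
    rw [← Complex.exp_add]; simp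
  have hftc : HasDerivAt (fun s => ∫ τ in t..s, Complex.exp (-ν * τ) * a τ)
      (Complex.exp (-ν * t) * a t) t :=
    intervalIntegral.integral_hasDerivAt_right (hcont.intervalIntegrable _ _)
      (hcont.stronglyMeasurableAtFilter _ _) hcont.continuousAt
  rcases lt_or_gt_of_ne hν with h | h
  · have hI := integrableOn_exp_mul_Iic_of_bddCts h ha
    -- The improper integral is frozen at the base time `t`, so that `s` enters through a proper
    -- integral only.
    have e : fastConv ν a = fun s : ℝ => Complex.exp (ν * s) *
        ((∫ τ in Iic t, Complex.exp (-ν * τ) * a τ) +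
          ∫ τ in t..s, Complex.exp (-ν * τ) * a τ) := by
      ext s
      rw [fastConv_of_neg h, ← intervalIntegral.integral_Iic_sub_Iic (hI t) (hI s)]
      ring
    rw [e]
    refine ((hasDerivAt_exp_mul_ofReal ν t).mul (hftc.const_add _)).congr_deriv ?_
    beta_reduce
    rw [intervalIntegral.integral_same, convSign, if_pos h]
    linear_combination (a t) * hone
  · have hI := integrableOn_exp_mul_Ioi_of_bddCts h ha
    have e : fastConv ν a = fun s : ℝ => Complex.exp (ν * s) *
        ((∫ τ in Ioi t, Complex.exp (-ν * τ) * a τ) -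
          ∫ τ in t..s, Complex.exp (-ν * τ) * a τ) := by
      ext s
      rw [fastConv_of_pos h, ← intervalIntegral.integral_Ioi_sub_Ioi' (hI t) (hI s)]
      ring
    rw [e]
    refine ((hasDerivAt_exp_mul_ofReal ν t).mul (hftc.const_sub _)).congr_deriv ?_
    beta_reduce
    rw [intervalIntegral.integral_same, convSign, if_neg h.not_gt]
    linear_combination (-a t) * hone

/-- The kernel has integral `1 / |Re ν|`. That the bound does not depend on `t` is what makes all
later radii and constants uniform in time. -/
theorem norm_fastConv_le {ν : ℂ} (hν : ν.re ≠ 0) {a : ℝ → ℂ} {K : ℝ} (hK : ∀ t, ‖a t‖ ≤ K)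
    (t : ℝ) : ‖fastConv ν a t‖ ≤ K / |ν.re| := by
  have hone : Real.exp (ν.re * t) * Real.exp (-(ν.re * t)) = 1 := by
    rw [← Real.exp_add]; simp
  have hpt : ∀ τ : ℝ, ‖Complex.exp (-ν * τ) * a τ‖ ≤ Real.exp (-ν.re * τ) * K := by
    intro τ
    rw [norm_mul, Complex.norm_exp]
    gcongr
    · simp
    · exact hK τ
  have hexp : ‖Complex.exp (ν * t)‖ = Real.exp (ν.re * t) := by simp [Complex.norm_exp]
  rcases lt_or_gt_of_ne hν with h | h
  · rw [fastConv_of_neg h, norm_mul, hexp]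
    calc _ ≤ Real.exp (ν.re * t) * ∫ τ in Iic t, Real.exp (-ν.re * τ) * K := by
          gcongr
          exact norm_integral_le_of_norm_le
            ((integrableOn_exp_mul_Iic (a := -ν.re) (by linarith) t).mul_const K) (ae_of_all _ hpt)
      _ = K / |ν.re| := by
          rw [integral_mul_const, integral_exp_mul_Iic (by linarith), abs_of_neg h]
          have : -ν.re ≠ 0 := by simpa using hν
          field_simp
          linear_combination (-K) * hone
  · rw [fastConv_of_pos h, norm_mul, hexp]
    calc _ ≤ Real.exp (ν.re * t) * ∫ τ in Ioi t, Real.exp (-ν.re * τ) * K := by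
          gcongr
          exact norm_integral_le_of_norm_le
            ((integrableOn_exp_mul_Ioi (a := -ν.re) (by linarith) t).mul_const K) (ae_of_all _ hpt)
      _ = K / |ν.re| := by
          rw [integral_mul_const, integral_exp_mul_Ioi (by linarith), abs_of_pos h]
          field_simp
          linear_combination K * hone

theorem BddCts.fastConv {ν : ℂ} (hν : ν.re ≠ 0) {a : ℝ → ℂ} (ha : BddCts a) :
    BddCts (fastConv ν a) := by
  obtain ⟨K, hK⟩ := ha.2
  exact ⟨continuous_iff_continuousAt.2 fun t => (hasDerivAt_fastConv hν ha t).continuousAt,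
    _, norm_fastConv_le hν hK⟩

theorem BddCts.const (c : ℂ) : BddCts fun _ => c := ⟨continuous_const, ‖c‖, fun _ => le_rfl⟩

theorem BddCts.add {a a' : ℝ → ℂ} (h : BddCts a) (h' : BddCts a') :
    BddCts fun t => a t + a' t := by
  obtain ⟨hc, K, hK⟩ := h
  obtain ⟨hc', K', hK'⟩ := h'
  exact ⟨hc.add hc', K + K', fun t => (norm_add_le _ _).trans (add_le_add (hK t) (hK' t))⟩

theorem BddCts.mul {a a' : ℝ → ℂ} (h : BddCts a) (h' : BddCts a') :
    BddCts fun t => a t * a' t := by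
  obtain ⟨hc, K, hK⟩ := h
  obtain ⟨hc', K', hK'⟩ := h'
  refine ⟨hc.mul hc', K * K', fun t => ?_⟩
  rw [norm_mul]
  exact mul_le_mul (hK t) (hK' t) (norm_nonneg _) ((norm_nonneg _).trans (hK t))

theorem fastConv_add {ν : ℂ} (hν : ν.re ≠ 0) {a a' : ℝ → ℂ} (h : BddCts a) (h' : BddCts a') :
    fastConv ν (fun t => a t + a' t) = fun t => fastConv ν a t + fastConv ν a' t := by
  ext t
  rcases lt_or_gt_of_ne hν with hn | hn
  · simp only [fastConv_of_neg hn, mul_add]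
    rw [integral_add (integrableOn_exp_mul_Iic_of_bddCts hn h t)
      (integrableOn_exp_mul_Iic_of_bddCts hn h' t), mul_add]
  · simp only [fastConv_of_pos hn, mul_add]
    rw [integral_add (integrableOn_exp_mul_Ioi_of_bddCts hn h t)
      (integrableOn_exp_mul_Ioi_of_bddCts hn h' t), mul_add]

/-- Convolution creates no memory out of constants; this keeps the constant part of a fast
expression constant. -/
theorem fastConv_const {ν : ℂ} (hν : ν.re ≠ 0) (c : ℂ) :
    fastConv ν (fun _ => c) = fun _ => -(convSign ν * c / ν) := by
  ext t
  have h0 : ν ≠ 0 := by rintro rfl; simp at hν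
  have hone : Complex.exp (ν * t) * Complex.exp (-ν * t) = 1 := by
    rw [← Complex.exp_add]; simp
  rcases lt_or_gt_of_ne hν with hn | hn
  · rw [fastConv_of_neg hn, integral_mul_const, integral_exp_mul_complex_Iic (by simpa using hn),
      convSign, if_pos hn]
    field_simp
    rw [neg_mul] at hone
    linear_combination (-c) * hone
  · rw [fastConv_of_pos hn, integral_mul_const, integral_exp_mul_complex_Ioi (by simpa using hn),
      convSign, if_neg hn.not_gt]
    field_simp
    rw [neg_mul] at hone
    linear_combination c * hone

theorem conj_fastConv (ν : ℂ) (a : ℝ → ℂ) (t : ℝ) :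
    (starRingEnd ℂ) (fastConv ν a t) =
      fastConv ((starRingEnd ℂ) ν) (fun τ => (starRingEnd ℂ) (a τ)) t := by
  simp only [fastConv, Complex.conj_re]
  split_ifs <;> rw [← integral_conj] <;> congr 1 <;> ext τ <;> simp [← Complex.exp_conj]

end FastConvolution

/-! ### Expressions in the forcing, graded by degree in it -/

section FastExpressions

variable {m n l : ℕ} {μ : ℝ}

theorem re_ne_zero_of_lt (hμ : 0 ≤ μ) {ν : ℂ} (hν : μ < |ν.re|) : ν.re ≠ 0 :=
  abs_pos.1 (hμ.trans_lt hν)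

namespace FastExpr

variable {k : ℕ} {a a' : Forcing m n l → ℝ → ℂ}

theorem bddCts (hμ : 0 ≤ μ) (h : FastExpr μ k a) (b : Forcing m n l) : BddCts (a b) := by
  induction h with
  | const c => exact BddCts.const c
  | forcing i =>
    refine ⟨Complex.continuous_ofReal.comp (b i).continuous, ‖b i‖, fun t => ?_⟩
    simpa using (b i).norm_coe_le_norm t
  | add _ _ ih ih' => exact ih.add ih'
  | mul _ _ ih ih' => exact ih.mul ih'
  | conv ν hν _ ih => exact ih.fastConv (re_ne_zero_of_lt hμ hν)
  | weaken _ ih => exact ih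

theorem of_le {j : ℕ} (h : FastExpr μ k a) (hj : j ≤ k) : FastExpr μ j a := by
  induction hj with
  | refl => exact h
  | step _ ih => exact ih h.weaken

theorem const_mul (c : ℂ) (h : FastExpr μ k a) : FastExpr μ k (fun b t => c * a b t) := by
  simpa using (FastExpr.const (μ := μ) c).mul h

/-- Positive degree can only come from a forcing term, so zero obtains degree `k` as a multiple of
`k` forcing terms. This needs a label to exist. -/
theorem zero [Nonempty (Idx m n l)] (k : ℕ) :
    FastExpr μ k (fun _ _ => 0 : Forcing m n l → ℝ → ℂ) := by
  induction k with
  | zero => exact .const 0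
  | succ k ih => simpa using ih.mul (.forcing (Classical.arbitrary (Label m n l)))

/-- Conjugation replaces `ν` by its conjugate and keeps `|Re ν|`, so real parts of fast expressions
are again fast. This is the way back from complex eigenvectors to real coefficients. -/
theorem star (h : FastExpr μ k a) : FastExpr μ k (fun b t => (starRingEnd ℂ) (a b t)) := by
  induction h with
  | const c => exact .const _
  | forcing i => simpa using .forcing i
  | add _ _ ih ih' => simpa using ih.add ih'
  | mul _ _ ih ih' => simpa using ih.mul ih'
  | conv ν hν _ ih =>
    simp only [conj_fastConv]
    exact ih.conv _ (by simpa using hν)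
  | weaken _ ih => exact ih.weaken

theorem re (h : FastExpr μ k a) : FastExpr μ k (fun b t => (((a b t).re : ℝ) : ℂ)) := by
  have := (h.add h.star).const_mul (1 / 2)
  convert this using 3
  rw [Complex.add_conj]; push_cast; ring

end FastExpr

/-- Expressions that are linear in the non-autonomous terms, with nested fast convolutions. -/
inductive LinFast (μ : ℝ) : (Forcing m n l → ℝ → ℂ) → Prop
  | zero : LinFast μ (fun _ _ => 0)
  | forcing (i : Label m n l) : LinFast μ (fun b t => ((b i t : ℝ) : ℂ))
  | const_mul {a : Forcing m n l → ℝ → ℂ} (c : ℂ) (h : LinFast μ a) :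
      LinFast μ (fun b t => c * a b t)
  | add {a a' : Forcing m n l → ℝ → ℂ} (h : LinFast μ a) (h' : LinFast μ a') :
      LinFast μ (fun b t => a b t + a' b t)
  | conv {a : Forcing m n l → ℝ → ℂ} (ν : ℂ) (hν : μ < |ν.re|) (h : LinFast μ a) :
      LinFast μ (fun b => fastConv ν (a b))

theorem LinFast.fastExpr [Nonempty (Idx m n l)] {a : Forcing m n l → ℝ → ℂ} (h : LinFast μ a) :
    FastExpr μ 1 a := by
  induction h with
  | zero => exact .zero 1
  | forcing i => exact .forcing i
  | const_mul c _ ih => exact ih.const_mul c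
  | add _ _ ih ih' => exact ih.add ih'
  | conv ν hν _ ih => exact ih.conv ν hν

/-- Every fast expression is a constant, plus a part linear in the non-autonomous terms, plus a part
of degree at least two in them. -/
theorem FastExpr.exists_decomposition [Nonempty (Idx m n l)] (hμ : 0 ≤ μ) {k : ℕ}
    {a : Forcing m n l → ℝ → ℂ} (h : FastExpr μ k a) :
    ∃ (c : ℂ) (f e : Forcing m n l → ℝ → ℂ), LinFast μ f ∧ FastExpr μ 2 e ∧
      a = fun b t => c + f b t + e b t := by
  induction h with
  | const c => exact ⟨c, _, _, .zero, .zero 2, by simp⟩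
  | forcing i => exact ⟨0, _, _, .forcing i, .zero 2, by simp⟩
  | add _ _ ih ih' =>
    obtain ⟨c, f, e, hf, he, rfl⟩ := ih
    obtain ⟨c', f', e', hf', he', rfl⟩ := ih'
    exact ⟨c + c', _, _, hf.add hf', he.add he', by ext b t; ring⟩
  | mul _ _ ih ih' =>
    obtain ⟨c, f, e, hf, he, rfl⟩ := ih
    obtain ⟨c', f', e', hf', he', rfl⟩ := ih'
    -- Products of two linear parts, and all products with a quadratic part, have degree at least
    -- two; only a constant times a linear part stays linear.
    have h₁ : FastExpr μ 2 fun b t => f b t * f' b t := hf.fastExpr.mul hf'.fastExpr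
    have h₂ : FastExpr μ 2 fun b t => f b t * e' b t :=
      (hf.fastExpr.mul he').of_le (by norm_num)
    have h₃ : FastExpr μ 2 fun b t => e b t * f' b t :=
      (he.mul hf'.fastExpr).of_le (by norm_num)
    have h₄ : FastExpr μ 2 fun b t => e b t * e' b t := (he.mul he').of_le (by norm_num)
    refine ⟨c * c', _, _, (hf'.const_mul c).add (hf.const_mul c'),
      ((((he'.const_mul c).add (he.const_mul c')).add h₁).add h₂).add (h₃.add h₄), ?_⟩
    ext b t; ring
  | conv ν hν _ ih =>
    obtain ⟨c, f, e, hf, he, rfl⟩ := ih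
    have h0 := re_ne_zero_of_lt hμ hν
    refine ⟨-(convSign ν * c / ν), _, _, hf.conv ν hν, he.conv ν hν, ?_⟩
    ext b : 1
    rw [fastConv_add h0 ((BddCts.const c).add (hf.fastExpr.bddCts hμ b)) (he.bddCts hμ b),
      fastConv_add h0 (BddCts.const c) (hf.fastExpr.bddCts hμ b), fastConv_const h0]
  | weaken _ ih => exact ih

/-- The complex version of `MemoryOnlyQuadratic`. -/
def MemoryOnlyQuadraticC (μ : ℝ) (a : Forcing m n l → ℝ → ℂ) : Prop :=
  ∃ (c₀ : ℂ) (c₁ : Label m n l →₀ ℂ) (e : Forcing m n l → ℝ → ℂ),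
    FastExpr μ 2 e ∧ ∀ b t, a b t = c₀ + c₁.sum (fun i w => w * (b i t : ℝ)) + e b t

namespace MemoryOnlyQuadraticC

theorem const [Nonempty (Idx m n l)] (c : ℂ) :
    MemoryOnlyQuadraticC μ (fun _ _ => c : Forcing m n l → ℝ → ℂ) :=
  ⟨c, 0, _, .zero 2, by simp⟩

theorem forcing [Nonempty (Idx m n l)] (i : Label m n l) :
    MemoryOnlyQuadraticC μ (fun b t => ((b i t : ℝ) : ℂ)) :=
  ⟨0, Finsupp.single i 1, _, .zero 2, by simp⟩

theorem of_fastExpr {a : Forcing m n l → ℝ → ℂ} (h : FastExpr μ 2 a) :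
    MemoryOnlyQuadraticC μ a :=
  ⟨0, 0, a, h, by simp⟩

theorem add {a a' : Forcing m n l → ℝ → ℂ} (h : MemoryOnlyQuadraticC μ a)
    (h' : MemoryOnlyQuadraticC μ a') : MemoryOnlyQuadraticC μ (fun b t => a b t + a' b t) := by
  obtain ⟨c, f, e, he, ha⟩ := h
  obtain ⟨c', f', e', he', ha'⟩ := h'
  refine ⟨c + c', f + f', _, he.add he', fun b t => ?_⟩
  beta_reduce
  rw [ha, ha', Finsupp.sum_add_index' (by simp) (by intros; ring)]
  ring

theorem const_mul {a : Forcing m n l → ℝ → ℂ} (c : ℂ) (h : MemoryOnlyQuadraticC μ a) :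
    MemoryOnlyQuadraticC μ (fun b t => c * a b t) := by
  obtain ⟨c₀, f, e, he, ha⟩ := h
  refine ⟨c * c₀, c • f, _, he.const_mul c, fun b t => ?_⟩
  beta_reduce
  rw [ha, Finsupp.sum_smul_index' (by simp), mul_add, mul_add, Finsupp.mul_sum]
  simp [mul_assoc]

theorem re {a : Forcing m n l → ℝ → ℂ} (h : MemoryOnlyQuadraticC μ a) :
    MemoryOnlyQuadratic μ (fun b t => (a b t).re) := by
  obtain ⟨c, f, e, he, ha⟩ := h
  refine ⟨c.re, f.mapRange Complex.re Complex.zero_re, _, he.re, fun b t => ?_⟩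
  beta_reduce
  rw [ha, Finsupp.sum_mapRange_index (by simp)]
  simp [Finsupp.sum]

end MemoryOnlyQuadraticC

namespace MemoryOnlyQuadratic

theorem zero [Nonempty (Idx m n l)] : MemoryOnlyQuadratic μ (0 : Coeff m n l) :=
  ⟨0, 0, 0, by simpa using FastExpr.zero 2, by simp⟩

theorem add {a a' : Coeff m n l} (h : MemoryOnlyQuadratic μ a)
    (h' : MemoryOnlyQuadratic μ a') : MemoryOnlyQuadratic μ (a + a') := by
  obtain ⟨c, f, e, he, ha⟩ := h
  obtain ⟨c', f', e', he', ha'⟩ := h'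
  refine ⟨c + c', f + f', e + e', by simpa using he.add he', fun b t => ?_⟩
  rw [Pi.add_apply, Pi.add_apply, ha, ha', Finsupp.sum_add_index' (by simp) (by intros; ring)]
  simp only [Pi.add_apply]
  ring

/-- Normal form coefficients enter the residual at the next degree, which must again have fast
coefficients. -/
theorem isFast {a : Coeff m n l} (h : MemoryOnlyQuadratic μ a) : IsFast μ a := by
  obtain ⟨c, f, e, he, ha⟩ := h
  have hf : FastExpr μ 0 fun (b : Forcing m n l) t =>
      ((f.sum (fun i w => w * b i t) : ℝ) : ℂ) := by
    induction f using Finsupp.induction_linear generalizing a with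
    | zero => simpa using .const 0
    | add f g hf hg =>
      have := (hf (a := fun b t => c + f.sum (fun i w => w * b i t) + e b t) (by simp)).add
        (hg (a := fun b t => c + g.sum (fun i w => w * b i t) + e b t) (by simp))
      convert this using 3
      rw [Finsupp.sum_add_index' (by simp) (by intros; ring)]
      push_cast; rfl
    | single i w => simpa using ((FastExpr.forcing i).const_mul (w : ℂ)).of_le zero_le_one
  unfold IsFast
  simp only [ha]
  simpa using ((FastExpr.const (c : ℂ)).add hf).add (he.of_le zero_le_two)

end MemoryOnlyQuadratic

end FastExpressions
-- Generalized eigenvectors under bilinear and linear maps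
section GeneralizedEigenvectors

variable {E E₁ E₂ : Type*} [AddCommGroup E] [Module ℂ E] [AddCommGroup E₁] [Module ℂ E₁]
  [AddCommGroup E₂] [Module ℂ E₂]

/-- The span of the generalized eigenvectors of `M` in `K` with eigenvalues in `Λ`. -/
def genEigSpan (M : Module.End ℂ E) (Λ : Set ℂ) (K : Submodule ℂ E) : Submodule ℂ E :=
  Submodule.span ℂ {v | v ∈ K ∧ ∃ z ∈ Λ, v ∈ M.maxGenEigenspace z}

theorem mem_maxGenEigenspace_of_sub_apply_mem {M : Module.End ℂ E} {z : ℂ} {v : E}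
    (h : (M - z • 1) v ∈ M.maxGenEigenspace z) : v ∈ M.maxGenEigenspace z := by
  rw [Module.End.mem_maxGenEigenspace] at h ⊢
  obtain ⟨k, hk⟩ := h
  exact ⟨k + 1, by rwa [pow_succ, Module.End.mul_apply]⟩

/-- If `B` intertwines `M₁ ⊗ 1 + 1 ⊗ M₂` with `M`, then it maps pairs of generalized eigenvectors
to generalized eigenvectors for the sum of the eigenvalues. -/
theorem bilinear_mem_maxGenEigenspace {M₁ : Module.End ℂ E₁} {M₂ : Module.End ℂ E₂}
    {M : Module.End ℂ E} (B : E₁ →ₗ[ℂ] E₂ →ₗ[ℂ] E)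
    (hB : ∀ f w, M (B f w) = B (M₁ f) w + B f (M₂ w)) {z₁ z₂ : ℂ} {f : E₁} {w : E₂}
    (hf : f ∈ M₁.maxGenEigenspace z₁) (hw : w ∈ M₂.maxGenEigenspace z₂) :
    B f w ∈ M.maxGenEigenspace (z₁ + z₂) := by
  rw [Module.End.mem_maxGenEigenspace] at hf hw
  obtain ⟨j, hj⟩ := hf
  obtain ⟨k, hk⟩ := hw
  -- Applying `M - (z₁ + z₂)` to `B f w` gives two terms, each with one of the nilpotency indices
  -- lowered; the induction is on their sum.
  obtain ⟨N, hN⟩ : ∃ N, N = j + k := ⟨_, rfl⟩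
  induction N generalizing j k f w with
  | zero =>
    obtain rfl : j = 0 := by omega
    simp only [pow_zero, Module.End.one_apply] at hj
    simp [hj]
  | succ N ih =>
    apply mem_maxGenEigenspace_of_sub_apply_mem
    have e : (M - (z₁ + z₂) • (1 : Module.End ℂ E)) (B f w) =
        B ((M₁ - z₁ • (1 : Module.End ℂ E₁)) f) w + B f ((M₂ - z₂ • (1 : Module.End ℂ E₂)) w) := by
      simp [hB, add_smul]; abel
    rw [e]
    apply Submodule.add_mem
    · rcases j with - | j
      · simp only [pow_zero, Module.End.one_apply] at hj
        simp [hj]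
      · exact ih j (by rwa [pow_succ, Module.End.mul_apply] at hj) k hk (by omega)
    · rcases k with - | k
      · simp only [pow_zero, Module.End.one_apply] at hk
        simp [hk]
      · exact ih j hj k (by rwa [pow_succ, Module.End.mul_apply] at hk) (by omega)

/-- The eigenvalue sets `Λ` record bounds on real parts and the subspaces `K` record weights, so
both kinds of information pass through products together. -/
theorem bilinear_mem_genEigSpan {M₁ : Module.End ℂ E₁} {M₂ : Module.End ℂ E₂}
    {M : Module.End ℂ E} (B : E₁ →ₗ[ℂ] E₂ →ₗ[ℂ] E)
    (hB : ∀ f w, M (B f w) = B (M₁ f) w + B f (M₂ w)) {Λ₁ Λ₂ Λ : Set ℂ}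
    {K₁ : Submodule ℂ E₁} {K₂ : Submodule ℂ E₂} {K : Submodule ℂ E}
    (hΛ : ∀ z₁ ∈ Λ₁, ∀ z₂ ∈ Λ₂, z₁ + z₂ ∈ Λ) (hK : ∀ f ∈ K₁, ∀ w ∈ K₂, B f w ∈ K)
    {f : E₁} {w : E₂} (hf : f ∈ genEigSpan M₁ Λ₁ K₁) (hw : w ∈ genEigSpan M₂ Λ₂ K₂) :
    B f w ∈ genEigSpan M Λ K := by
  have h := Submodule.apply_mem_map₂ B hf hw
  rw [genEigSpan, genEigSpan, Submodule.map₂_span_span] at h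
  refine Submodule.span_mono ?_ h
  rintro _ ⟨f, ⟨hf, z₁, hz₁, hf'⟩, w, ⟨hw, z₂, hz₂, hw'⟩, rfl⟩
  exact ⟨hK f hf w hw, z₁ + z₂, hΛ _ hz₁ _ hz₂, bilinear_mem_maxGenEigenspace B hB hf' hw'⟩

theorem map_mem_genEigSpan {M₁ : Module.End ℂ E₁} {M : Module.End ℂ E} (φ : E₁ →ₗ[ℂ] E)
    (hφ : ∀ f, M (φ f) = φ (M₁ f)) {Λ₁ Λ : Set ℂ} {K₁ : Submodule ℂ E₁} {K : Submodule ℂ E}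
    (hΛ : Λ₁ ⊆ Λ) (hK : ∀ f ∈ K₁, φ f ∈ K) {f : E₁} (hf : f ∈ genEigSpan M₁ Λ₁ K₁) :
    φ f ∈ genEigSpan M Λ K := by
  have h : (φ f) ∈ Submodule.map φ (genEigSpan M₁ Λ₁ K₁) := Submodule.mem_map_of_mem hf
  rw [genEigSpan, Submodule.map_span] at h
  refine Submodule.span_mono ?_ h
  rintro _ ⟨f, ⟨hf, z, hz, hf'⟩, rfl⟩
  refine ⟨hK f hf, z, hΛ hz, ?_⟩
  rw [Module.End.mem_maxGenEigenspace] at hf' ⊢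
  obtain ⟨k, hk⟩ := hf'
  refine ⟨k, ?_⟩
  have : ∀ k (f : E₁), ((M - z • (1 : Module.End ℂ E)) ^ k) (φ f) =
      φ (((M₁ - z • (1 : Module.End ℂ E₁)) ^ k) f) := by
    intro k
    induction k with
    | zero => simp
    | succ k ih =>
      intro f
      rw [pow_succ, pow_succ, Module.End.mul_apply, Module.End.mul_apply, ← ih]
      simp [hφ]
  rw [this, hk, map_zero]

/-- Over `ℂ` the generalized eigenspaces span the whole space, and those of numbers outside the
spectrum are trivial. -/
theorem mem_genEigSpan_spectrum {ι : Type*} [Fintype ι] [DecidableEq ι] (A : Matrix ι ι ℂ)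
    (v : ι → ℂ) : v ∈ genEigSpan A.toLin' (spectrum ℂ A) ⊤ := by
  have h : v ∈ (⊤ : Submodule ℂ (ι → ℂ)) := trivial
  rw [← Module.End.iSup_maxGenEigenspace_eq_top A.toLin'] at h
  refine (iSup_le fun z => ?_ :
    (⨆ z, Module.End.maxGenEigenspace A.toLin' z) ≤ genEigSpan A.toLin' (spectrum ℂ A) ⊤) h
  by_cases hz : Module.End.HasEigenvalue A.toLin' z
  · intro v hv
    refine Submodule.subset_span ⟨trivial, z, ?_, hv⟩
    rw [← Matrix.spectrum_toLin']
    exact hz.mem_spectrum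
  · have : Module.End.maxGenEigenspace A.toLin' z = ⊥ := by
      rw [← Module.End.iSup_genEigenspace_eq, iSup_eq_bot]
      intro k
      by_contra hk
      exact hz (Module.End.hasEigenvalue_of_hasGenEigenvalue (k := k) hk)
    rw [this]
    exact bot_le

end GeneralizedEigenvectors

/-! ### The homological equation on generalized eigenvectors -/

section HomologicalEquation

variable {m n l : ℕ} {μ : ℝ} {E : Type*} [AddCommGroup E] [Module ℂ E]

/-- A vector-valued fast expression `ξ` in `K`, with time derivative `ξ'`. -/
structure FastField (μ : ℝ) (K : Submodule ℂ E) (ξ ξ' : Forcing m n l → ℝ → E) : Prop where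
  mem : ∀ b t, ξ b t ∈ K
  mem' : ∀ b t, ξ' b t ∈ K
  fast : ∀ f : E →ₗ[ℂ] ℂ, FastExpr μ 0 fun b t => f (ξ b t)
  fast' : ∀ f : E →ₗ[ℂ] ℂ, FastExpr μ 0 fun b t => f (ξ' b t)
  hasDeriv : ∀ (f : E →ₗ[ℂ] ℂ) b t, HasDerivAt (fun t => f (ξ b t)) (f (ξ' b t)) t

/-- A vector-valued expression in `R` with memory only in quadratic terms. -/
structure MemoryField (μ : ℝ) (R : Submodule ℂ E) (q : Forcing m n l → ℝ → E) : Prop where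
  mem : ∀ b t, q b t ∈ R
  memory : ∀ f : E →ₗ[ℂ] ℂ, MemoryOnlyQuadraticC μ fun b t => f (q b t)

theorem FastField.mono {K K' : Submodule ℂ E} {ξ ξ' : Forcing m n l → ℝ → E}
    (h : FastField μ K ξ ξ') (hK : K ≤ K') : FastField μ K' ξ ξ' :=
  { h with mem := fun b t => hK (h.mem b t), mem' := fun b t => hK (h.mem' b t) }

theorem MemoryField.mono {R R' : Submodule ℂ E} {q : Forcing m n l → ℝ → E}
    (h : MemoryField μ R q) (hR : R ≤ R') : MemoryField μ R' q :=
  { h with mem := fun b t => hR (h.mem b t) }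

/-- Solvability of the homological equation `ξ' + M ξ + q = a v` for `ξ` and `q`. -/
def HomologicallySolvable (μ : ℝ) (M : Module.End ℂ E) (K R : Submodule ℂ E)
    (a : Forcing m n l → ℝ → ℂ) (v : E) : Prop :=
  ∃ ξ ξ' q : Forcing m n l → ℝ → E, FastField μ K ξ ξ' ∧ MemoryField μ R q ∧
    ∀ b t, ξ' b t + M (ξ b t) + q b t = a b t • v

variable {M : Module.End ℂ E} {K R : Submodule ℂ E} {a a' : Forcing m n l → ℝ → ℂ} {v v' : E}

theorem FastField.zero : FastField μ K (0 : Forcing m n l → ℝ → E) 0 where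
  mem _ _ := K.zero_mem
  mem' _ _ := K.zero_mem
  fast f := by simpa using .const 0
  fast' f := by simpa using .const 0
  hasDeriv f b t := by simpa using hasDerivAt_const t (0 : ℂ)

theorem FastField.add {ξ ξ' η η' : Forcing m n l → ℝ → E} (h : FastField μ K ξ ξ')
    (h' : FastField μ K η η') : FastField μ K (ξ + η) (ξ' + η') where
  mem b t := K.add_mem (h.mem b t) (h'.mem b t)
  mem' b t := K.add_mem (h.mem' b t) (h'.mem' b t)
  fast f := by simpa using (h.fast f).add (h'.fast f)
  fast' f := by simpa using (h.fast' f).add (h'.fast' f)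
  hasDeriv f b t := by
    simp only [Pi.add_apply, map_add]
    exact (h.hasDeriv f b t).add (h'.hasDeriv f b t)

theorem FastField.smul_const (hv : v ∈ K) (h : FastExpr μ 0 a) (h' : FastExpr μ 0 a')
    (hd : ∀ b t, HasDerivAt (a b) (a' b t) t) :
    FastField μ K (fun b t => a b t • v) (fun b t => a' b t • v) where
  mem b t := K.smul_mem _ hv
  mem' b t := K.smul_mem _ hv
  fast f := by simpa [mul_comm] using h.const_mul (f v)
  fast' f := by simpa [mul_comm] using h'.const_mul (f v)
  hasDeriv f b t := by simpa using (hd b t).mul_const (f v)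

theorem MemoryField.zero [Nonempty (Idx m n l)] :
    MemoryField μ R (0 : Forcing m n l → ℝ → E) where
  mem _ _ := R.zero_mem
  memory f := by simpa using MemoryOnlyQuadraticC.const 0

theorem MemoryField.add {q q' : Forcing m n l → ℝ → E} (h : MemoryField μ R q)
    (h' : MemoryField μ R q') : MemoryField μ R (q + q') where
  mem b t := R.add_mem (h.mem b t) (h'.mem b t)
  memory f := by simpa using (h.memory f).add (h'.memory f)

theorem MemoryField.smul_const (hv : v ∈ R) (h : MemoryOnlyQuadraticC μ a) :
    MemoryField μ R (fun b t => a b t • v) where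
  mem b t := R.smul_mem _ hv
  memory f := by simpa [mul_comm] using h.const_mul (f v)

namespace HomologicallySolvable

theorem zero [Nonempty (Idx m n l)] : HomologicallySolvable μ M K R a 0 :=
  ⟨0, 0, 0, .zero, .zero, by simp⟩

theorem add (h : HomologicallySolvable μ M K R a v) (h' : HomologicallySolvable μ M K R a v') :
    HomologicallySolvable μ M K R a (v + v') := by
  obtain ⟨ξ, ξ', q, hξ, hq, e⟩ := h
  obtain ⟨η, η', r, hη, hr, e'⟩ := h'
  refine ⟨_, _, _, hξ.add hη, hq.add hr, fun b t => ?_⟩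
  rw [smul_add, ← e, ← e']
  simp only [Pi.add_apply, map_add]
  abel

theorem add_coeff (h : HomologicallySolvable μ M K R a v)
    (h' : HomologicallySolvable μ M K R a' v) :
    HomologicallySolvable μ M K R (fun b t => a b t + a' b t) v := by
  obtain ⟨ξ, ξ', q, hξ, hq, e⟩ := h
  obtain ⟨η, η', r, hη, hr, e'⟩ := h'
  refine ⟨_, _, _, hξ.add hη, hq.add hr, fun b t => ?_⟩
  rw [add_smul, ← e, ← e']
  simp only [Pi.add_apply, map_add]
  abel

theorem congr (h : HomologicallySolvable μ M K R a v)
    (e : ∀ b t, a b t • v = a' b t • v') : HomologicallySolvable μ M K R a' v' := by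
  obtain ⟨ξ, ξ', q, hξ, hq, h⟩ := h
  exact ⟨ξ, ξ', q, hξ, hq, fun b t => by rw [h, e]⟩

theorem smul (c : ℂ) (h : HomologicallySolvable μ M K R a v) :
    HomologicallySolvable μ M K R a (c • v) := by
  obtain ⟨ξ, ξ', q, hξ, hq, e⟩ := h
  refine ⟨c • ξ, c • ξ', c • q, ⟨fun b t => K.smul_mem c (hξ.mem b t),
    fun b t => K.smul_mem c (hξ.mem' b t), fun f => ?_, fun f => ?_,
    fun f b t => ?_⟩, ⟨fun b t => R.smul_mem c (hq.mem b t), fun f => ?_⟩, fun b t => ?_⟩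
  · simpa using (hξ.fast f).const_mul c
  · simpa using (hξ.fast' f).const_mul c
  · simpa using (hξ.hasDeriv f b t).const_mul c
  · simpa using (hq.memory f).const_mul c
  · rw [smul_comm, ← e]
    simp

/-- Here `ξ = 0`: the whole term is put into the normal form. -/
theorem of_memoryOnlyQuadratic (hv : v ∈ R) (h : MemoryOnlyQuadraticC μ a) :
    HomologicallySolvable μ M K R a v :=
  ⟨0, 0, _, .zero, .smul_const hv h, by simp⟩

/-- The coefficients may differ from summand to summand, so the conclusion is a solution for the sum
and not an instance of `HomologicallySolvable`. -/
theorem exists_sum [Nonempty (Idx m n l)] {ι : Type*} (S : Finset ι)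
    {a : ι → Forcing m n l → ℝ → ℂ} {v : ι → E}
    (h : ∀ i ∈ S, HomologicallySolvable μ M K R (a i) (v i)) :
    ∃ ξ ξ' q : Forcing m n l → ℝ → E, FastField μ K ξ ξ' ∧ MemoryField μ R q ∧
      ∀ b t, ξ' b t + M (ξ b t) + q b t = ∑ i ∈ S, a i b t • v i := by
  classical
  induction S using Finset.induction_on with
  | empty => exact ⟨0, 0, 0, .zero, .zero, by simp⟩
  | insert i S hi ih =>
    obtain ⟨ξ, ξ', q, hξ, hq, e⟩ := h i (Finset.mem_insert_self i S)
    obtain ⟨η, η', r, hη, hr, e'⟩ := ih fun j hj => h j (Finset.mem_insert_of_mem hj)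
    refine ⟨_, _, _, hξ.add hη, hq.add hr, fun b t => ?_⟩
    rw [Finset.sum_insert hi, ← e, ← e']
    simp only [Pi.add_apply, map_add]
    abel

theorem mono {K' R' : Submodule ℂ E} (h : HomologicallySolvable μ M K R a v) (hK : K ≤ K')
    (hR : R ≤ R') : HomologicallySolvable μ M K' R' a v := by
  obtain ⟨ξ, ξ', q, hξ, hq, e⟩ := h
  exact ⟨ξ, ξ', q, hξ.mono hK, hq.mono hR, e⟩

/-- Adding an explicit fast field to a solution for the remainder. -/
theorem of_remainder {α α' : Forcing m n l → ℝ → ℂ} {w : E} (hw : w ∈ K) (h : FastExpr μ 0 α)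
    (h' : FastExpr μ 0 α') (hd : ∀ b t, HasDerivAt (α b) (α' b t) t) {ξ ξ' q : Forcing m n l → ℝ → E}
    (hξ : FastField μ K ξ ξ') (hq : MemoryField μ R q)
    (e : ∀ b t, α' b t • w + α b t • M w + (ξ' b t + M (ξ b t) + q b t) = a b t • v) :
    HomologicallySolvable μ M K R a v := by
  refine ⟨_, _, q, (FastField.smul_const hw h h' hd).add hξ, hq, fun b t => ?_⟩
  rw [← e]
  simp only [Pi.add_apply, map_add, map_smul]
  abel

/-- The multiple `α = ± fastConv (-z) a` satisfies `α' = -z α + a`, so `α v` solves the equation up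
to the error `α (M - z) v`. The vector `(M - z) v` is killed by one power less of `M - z`, so the
procedure ends. -/
theorem of_fast_eigenvalue [Nonempty (Idx m n l)] (hμ : 0 ≤ μ) (hK : ∀ v ∈ K, M v ∈ K) {z : ℂ}
    (hz : μ < |z.re|) (j : ℕ) (hv : v ∈ K) (hj : ((M - z • (1 : Module.End ℂ E)) ^ j) v = 0)
    (ha : FastExpr μ 0 a) : HomologicallySolvable μ M K R a v := by
  induction j generalizing v a with
  | zero =>
    simp only [pow_zero, Module.End.one_apply] at hj
    exact hj ▸ zero
  | succ j ih =>
    have hν : μ < |(-z).re| := by simpa using hz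
    -- The factor `convSign (-z)` turns the inhomogeneity `± a` of the convolution into `a`.
    have hα := (ha.conv (-z) hν).const_mul (convSign (-z))
    rw [pow_succ, Module.End.mul_apply] at hj
    have hv' : (M - z • (1 : Module.End ℂ E)) v ∈ K := by
      simpa using K.sub_mem (hK v hv) (K.smul_mem z hv)
    obtain ⟨ξ, ξ', q, hξ, hq, e⟩ := ih hv' hj (hα.const_mul (-1))
    refine of_remainder hv hα ((hα.const_mul (-z)).add ha) (fun b t => ?_) hξ hq (fun b t => ?_)
    · refine ((hasDerivAt_fastConv (re_ne_zero_of_lt hμ hν) (ha.bddCts hμ b) t).const_mul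
        (convSign (-z))).congr_deriv ?_
      linear_combination (a b t) * convSign_mul_self (-z)
    · rw [e]
      simp only [LinearMap.sub_apply, LinearMap.smul_apply, Module.End.one_apply]
      module

/-- Integration by parts. For `α = (ν + z)⁻¹ fastConv ν a₀` the expression `α' + z α` equals
`fastConv ν a₀` plus a multiple of `a₀`, which carries one convolution less. The division is
legitimate because `|Re z| ≤ μ < |Re ν|`. The outer induction is on the nesting of convolutions, the
inner one on the nilpotency index of `v`. -/
theorem of_linFast [Nonempty (Idx m n l)] (hμ : 0 ≤ μ) (hK : ∀ v ∈ K, M v ∈ K) (hR : K ≤ R) {z : ℂ}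
    (hz : |z.re| ≤ μ) (ha : LinFast μ a) (j : ℕ) (hv : v ∈ K)
    (hj : ((M - z • (1 : Module.End ℂ E)) ^ j) v = 0) : HomologicallySolvable μ M K R a v := by
  induction ha generalizing v j with
  | zero => exact zero.congr (a := 0) (by simp)
  | forcing i => exact of_memoryOnlyQuadratic (hR hv) (.forcing i)
  | const_mul c _ ih =>
    refine (ih j (v := c • v) (K.smul_mem c hv) (by rw [map_smul, hj, smul_zero])).congr ?_
    intro b t
    rw [smul_smul, mul_comm]
  | add _ _ ih ih' => exact (ih j hv hj).add_coeff (ih' j hv hj)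
  | @conv a₀ ν hν ha₀ ih =>
    induction j generalizing v with
    | zero =>
      simp only [pow_zero, Module.End.one_apply] at hj
      exact hj ▸ zero
    | succ j ihj =>
      have hne : ν + z ≠ 0 := by
        intro h
        have : ν = -z := eq_neg_of_add_eq_zero_left h
        rw [this, Complex.neg_re, abs_neg] at hν
        exact hν.not_ge hz
      have hα := ((ha₀.conv ν hν).fastExpr.of_le zero_le_one).const_mul (ν + z)⁻¹
      have hα' := ((ha₀.fastExpr.of_le zero_le_one).const_mul ((ν + z)⁻¹ * convSign ν))
      have hv' : (M - z • (1 : Module.End ℂ E)) v ∈ K := by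
        simpa using K.sub_mem (hK v hv) (K.smul_mem z hv)
      -- The two errors of the explicit field: `h₁` removes the multiple of `a₀` in direction `v`,
      -- `h₂` removes the nilpotent part in direction `(M - z) v`.
      have h₁ := (ih (j + 1) hv hj).smul (-((ν + z)⁻¹ * convSign ν))
      rw [pow_succ, Module.End.mul_apply] at hj
      have h₂ := (ihj hv' hj).smul (-(ν + z)⁻¹)
      obtain ⟨ξ, ξ', q, hξ, hq, e⟩ := h₁
      obtain ⟨η, η', r, hη, hr, e'⟩ := h₂
      refine of_remainder hv hα ((hα.const_mul ν).add hα') (fun b t => ?_) (hξ.add hη) (hq.add hr)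
        (fun b t => ?_)
      · refine ((hasDerivAt_fastConv (re_ne_zero_of_lt hμ hν) (ha₀.fastExpr.bddCts hμ b) t).const_mul
          (ν + z)⁻¹).congr_deriv ?_
        ring
      · have e₃ : ξ' b t + η' b t + M (ξ b t + η b t) + (q b t + r b t) =
            (ξ' b t + M (ξ b t) + q b t) + (η' b t + M (η b t) + r b t) := by
          rw [map_add]; abel
        simp only [Pi.add_apply]
        rw [e₃, e, e']
        simp only [LinearMap.sub_apply, LinearMap.smul_apply, Module.End.one_apply]
        have hinv : (ν + z)⁻¹ * (ν + z) = 1 := inv_mul_cancel₀ hne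
        match_scalars
        · linear_combination (fastConv ν (a₀ b) t) * hinv
        · ring

theorem of_mem_genEigSpan [Nonempty (Idx m n l)] (hμ : 0 ≤ μ) (hK : ∀ v ∈ K, M v ∈ K) {Λ : Set ℂ}
    (hΛ : ∀ z ∈ Λ, μ < |z.re| ∨ K ≤ R) (hv : v ∈ genEigSpan M Λ K) (ha : FastExpr μ 0 a) :
    HomologicallySolvable μ M K R a v := by
  refine Submodule.span_induction ?_ zero (fun _ _ _ _ h h' => h.add h') (fun c _ _ h => h.smul c) hv
  rintro v ⟨hv, z, hz, hvz⟩
  rw [Module.End.mem_maxGenEigenspace] at hvz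
  obtain ⟨j, hj⟩ := hvz
  rcases lt_or_ge μ |z.re| with h | h
  · exact of_fast_eigenvalue hμ hK h j hv hj ha
  · have hR : K ≤ R := (hΛ z hz).resolve_left h.not_gt
    obtain ⟨c, f, e, hf, he, rfl⟩ := ha.exists_decomposition hμ
    exact ((of_memoryOnlyQuadratic (hR hv) (.const c)).add_coeff
      (of_linFast hμ hK hR h hf j hv hj)).add_coeff
      (of_memoryOnlyQuadratic (hR hv) (.of_fastExpr he))

end HomologicallySolvable

end HomologicalEquation

open MvPolynomial

/-! ### Linear vector fields acting on polynomials and polynomial fields -/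

section LinearVectorField

variable {σ R : Type*} [Fintype σ] [CommRing R]

/-- The components of the linear vector field with matrix `L`. -/
noncomputable def linForm (L : Matrix σ σ R) (i : σ) : MvPolynomial σ R := ∑ j, C (L i j) * X j

/-- The derivative of polynomials along the linear vector field with matrix `L`. -/
noncomputable def linDerivation (L : Matrix σ σ R) :
    Derivation R (MvPolynomial σ R) (MvPolynomial σ R) := ∑ i, linForm L i • pderiv i

theorem linDerivation_apply (L : Matrix σ σ R) (p : MvPolynomial σ R) :
    linDerivation L p = ∑ i, linForm L i * pderiv i p := by
  have h := congrFun (map_sum (Derivation.coeFnAddMonoidHom (R := R) (A := MvPolynomial σ R)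
    (M := MvPolynomial σ R)) (fun i => linForm L i • pderiv i) Finset.univ) p
  rw [Finset.sum_apply] at h
  exact h

/-- The homological operator `ξ ↦ Dξ · L u - L ξ` on polynomial vector fields. -/
noncomputable def homOp (L : Matrix σ σ R) : Module.End R (σ → MvPolynomial σ R) where
  toFun ξ κ := linDerivation L (ξ κ) - ∑ κ', C (L κ κ') * ξ κ'
  map_add' ξ η := by
    ext1 κ
    simp only [Pi.add_apply, map_add, mul_add, Finset.sum_add_distrib]
    ring
  map_smul' c ξ := by
    ext1 κ
    simp only [Pi.smul_apply, Derivation.map_smul, mul_smul_comm, RingHom.id_apply, smul_sub,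
      Finset.smul_sum]

theorem homOp_apply (L : Matrix σ σ R) (ξ : σ → MvPolynomial σ R) (κ : σ) :
    homOp L ξ κ = linDerivation L (ξ κ) - ∑ κ', C (L κ κ') * ξ κ' := rfl

/-- Coefficientwise the operator is a finite linear expression in the entries of `L`; this lets it
be compared over two coefficient rings. -/
theorem coeff_homOp [DecidableEq σ] (L : Matrix σ σ R) (ξ : σ → MvPolynomial σ R) (κ : σ) (s : σ →₀ ℕ) :
    coeff s (homOp L ξ κ) = ∑ i, ∑ j, L i j * (if j ∈ s.support then
      coeff (s - Finsupp.single j 1 + Finsupp.single i 1) (ξ κ) *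
        (((s - Finsupp.single j 1 : σ →₀ ℕ) i : R) + 1) else 0) -
      ∑ κ', L κ κ' * coeff s (ξ κ') := by
  simp only [homOp_apply, linDerivation_apply, linForm, coeff_sub, coeff_sum, coeff_C_mul,
    Finset.sum_mul, mul_assoc, coeff_X_mul', coeff_pderiv]

/-- The linear form with given coefficients. -/
noncomputable def formMap : (σ → R) →ₗ[R] MvPolynomial σ R where
  toFun w := ∑ i, C (w i) * X i
  map_add' v w := by simp [add_mul, Finset.sum_add_distrib]
  map_smul' c w := by simp [Finset.smul_sum, smul_eq_C_mul, mul_assoc]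

theorem formMap_apply (w : σ → R) : formMap w = ∑ i, C (w i) * X i := rfl

theorem formMap_single [DecidableEq σ] (i : σ) : formMap (Pi.single i (1 : R)) = X i := by
  rw [formMap_apply, Finset.sum_eq_single i]
  · simp
  · intro j _ hj; simp [hj]
  · simp

/-- On linear forms the derivation is the transpose of `L`, so its eigenvalues there are those of
`L`. -/
theorem linDerivation_formMap [DecidableEq σ] (L : Matrix σ σ R) (w : σ → R) :
    linDerivation L (formMap w) = formMap (Matrix.toLin' L.transpose w) := by
  have h : ∀ i, pderiv i (formMap w) = C (w i) := by
    intro i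
    rw [formMap_apply, map_sum, Finset.sum_eq_single i]
    · simp
    · intro j _ hj; simp [pderiv_X_of_ne hj]
    · simp
  simp only [linDerivation_apply, h]
  simp only [linForm, formMap_apply, Matrix.toLin'_apply, Matrix.mulVec,
    dotProduct, Matrix.transpose_apply, Finset.sum_mul, map_sum, map_mul]
  rw [Finset.sum_comm]
  refine Finset.sum_congr rfl fun j _ => Finset.sum_congr rfl fun i _ => by ring

/-- The vector field with direction `w` and size `f`. -/
noncomputable def directed : MvPolynomial σ R →ₗ[R] (σ → R) →ₗ[R] (σ → MvPolynomial σ R) :=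
  LinearMap.mk₂ R (fun f w κ => w κ • f)
    (fun f g w => by ext1 κ; simp) (fun c f w => by ext1 κ; simp [smul_comm c])
    (fun f v w => by ext1 κ; simp [add_smul]) (fun c f w => by ext1 κ; simp [mul_smul])

theorem directed_apply (f : MvPolynomial σ R) (w : σ → R) (κ : σ) :
    directed f w κ = w κ • f := rfl

/-- In terms of tensor products, `homOp L` is `linDerivation L ⊗ 1 + 1 ⊗ (-L)`. This is the
intertwining relation that `bilinear_mem_genEigSpan` requires. -/
theorem homOp_directed [DecidableEq σ] (L : Matrix σ σ R) (f : MvPolynomial σ R) (w : σ → R) :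
    homOp L (directed f w) = directed (linDerivation L f) w +
      directed f (Matrix.toLin' (-L) w) := by
  ext1 κ
  simp only [homOp_apply, directed_apply, Pi.add_apply, Derivation.map_smul, Matrix.toLin'_apply,
    Matrix.neg_mulVec, Pi.neg_apply, Matrix.mulVec, dotProduct, neg_smul, Finset.sum_smul]
  rw [sub_eq_add_neg]
  congr 2
  refine Finset.sum_congr rfl fun j _ => ?_
  rw [mul_smul, smul_eq_C_mul (w j • f)]

section Weights

variable {W : Type*} [AddCommGroup W] (w : σ → W)

theorem isWeightedHomogeneous_linForm {L : Matrix σ σ R} (hL : ∀ i j, w i ≠ w j → L i j = 0)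
    (i : σ) : (linForm L i).IsWeightedHomogeneous w (w i) := by
  refine Submodule.sum_mem (weightedHomogeneousSubmodule R w (w i)) fun j _ => ?_
  by_cases h : w i = w j
  · rw [h]
    simpa using (isWeightedHomogeneous_C w (L i j)).mul (isWeightedHomogeneous_X R w j)
  · rw [hL i j h]; simp

/-- A block diagonal `L` replaces a variable only by variables of the same block, hence of the same
weight. -/
theorem isWeightedHomogeneous_linDerivation {L : Matrix σ σ R}
    (hL : ∀ i j, w i ≠ w j → L i j = 0) {p : MvPolynomial σ R} {N : W}
    (hp : p.IsWeightedHomogeneous w N) : (linDerivation L p).IsWeightedHomogeneous w N := by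
  rw [linDerivation_apply]
  refine Submodule.sum_mem (weightedHomogeneousSubmodule R w N) fun i _ => ?_
  have := (isWeightedHomogeneous_linForm w hL i).mul
    (hp.pderiv (n' := N - w i) (i := i) (by simp))
  simpa using this

/-- The vector fields with components of weight `w₀` only, that are weighted homogeneous of
weight `w₁`. -/
def typeSubmodule (w₀ w₁ : W) : Submodule R (σ → MvPolynomial σ R) where
  carrier := {f | ∀ κ, (f κ).IsWeightedHomogeneous w w₁ ∧ (w κ ≠ w₀ → f κ = 0)}
  add_mem' {f g} hf hg κ :=
    ⟨(hf κ).1.add (hg κ).1, fun h => by simp [(hf κ).2 h, (hg κ).2 h]⟩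
  zero_mem' κ := ⟨isWeightedHomogeneous_zero R w w₁, fun _ => rfl⟩
  smul_mem' c f hf κ :=
    ⟨(weightedHomogeneousSubmodule R w w₁).smul_mem c (hf κ).1, fun h => by simp [(hf κ).2 h]⟩

theorem homOp_mem_typeSubmodule {L : Matrix σ σ R} (hL : ∀ i j, w i ≠ w j → L i j = 0) {w₀ w₁ : W}
    {f : σ → MvPolynomial σ R} (hf : f ∈ typeSubmodule w w₀ w₁) :
    homOp L f ∈ typeSubmodule w w₀ w₁ := by
  intro κ
  rw [homOp_apply]
  constructor
  · refine Submodule.sub_mem (weightedHomogeneousSubmodule R w w₁)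
      (isWeightedHomogeneous_linDerivation w hL (hf κ).1) (Submodule.sum_mem _ fun κ' _ => ?_)
    rw [← smul_eq_C_mul]
    exact Submodule.smul_mem _ _ (hf κ').1
  · intro h
    rw [(hf κ).2 h, map_zero, zero_sub, neg_eq_zero]
    refine Finset.sum_eq_zero fun κ' _ => ?_
    by_cases h' : w κ = w κ'
    · rw [(hf κ').2 (h' ▸ h), mul_zero]
    · rw [hL κ κ' h', C_0, zero_mul]

/-- The vectors whose components of weight other than `w₀` vanish. -/
def weightSubmodule (w₀ : W) : Submodule R (σ → R) where
  carrier := {v | ∀ κ, w κ ≠ w₀ → v κ = 0}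
  add_mem' {v v'} hv hv' κ h := by simp [hv κ h, hv' κ h]
  zero_mem' _ _ := rfl
  smul_mem' c v hv κ h := by simp [hv κ h]

theorem formMap_isWeightedHomogeneous {w₀ : W} {v : σ → R} (hv : v ∈ weightSubmodule w w₀) :
    (formMap v).IsWeightedHomogeneous w w₀ := by
  refine Submodule.sum_mem (weightedHomogeneousSubmodule R w w₀) fun j _ => ?_
  by_cases h : w j = w₀
  · rw [← h]
    simpa using (isWeightedHomogeneous_C w (v j)).mul (isWeightedHomogeneous_X R w j)
  · rw [hv j h]; simp

theorem directed_mem_typeSubmodule {w₀ w₁ : W} {f : MvPolynomial σ R}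
    (hf : f.IsWeightedHomogeneous w w₁) {v : σ → R} (hv : v ∈ weightSubmodule w w₀) :
    directed f v ∈ typeSubmodule w w₀ w₁ := fun κ =>
  ⟨Submodule.smul_mem (weightedHomogeneousSubmodule R w w₁) _ hf,
    fun h => by rw [directed_apply, hv κ h, zero_smul]⟩

end Weights

end LinearVectorField

/-! ### Spectra of the centre, stable and unstable blocks -/

section BlockSpectrum

variable {m n l : ℕ}

/-- The block diagonal matrix of the linear part. -/
def stateMatrix {R : Type*} [Zero R] (A : Matrix (Fin m) (Fin m) R) (B : Matrix (Fin n) (Fin n) R)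
    (C : Matrix (Fin l) (Fin l) R) : Matrix (Idx m n l) (Idx m n l) R :=
  Matrix.fromBlocks A 0 0 (Matrix.fromBlocks B 0 0 C)

/-- The block of a component, as a weight. -/
def blockWeight : Idx m n l → ℤ × ℤ × ℤ
  | Sum.inl _ => (1, 0, 0)
  | Sum.inr (Sum.inl _) => (0, 1, 0)
  | Sum.inr (Sum.inr _) => (0, 0, 1)

theorem stateMatrix_eq_zero {R : Type*} [Zero R] (A : Matrix (Fin m) (Fin m) R)
    (B : Matrix (Fin n) (Fin n) R) (C : Matrix (Fin l) (Fin l) R) (i j : Idx m n l)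
    (h : blockWeight i ≠ blockWeight j) : stateMatrix A B C i j = 0 := by
  rcases i with i | i | i <;> rcases j with j | j | j <;>
    first | rfl | exact absurd rfl h

theorem stateMatrix_transpose {R : Type*} [Zero R] (A : Matrix (Fin m) (Fin m) R)
    (B : Matrix (Fin n) (Fin n) R) (C : Matrix (Fin l) (Fin l) R) :
    (stateMatrix A B C).transpose = stateMatrix A.transpose B.transpose C.transpose := by
  simp [stateMatrix, Matrix.fromBlocks_transpose]

theorem stateMatrix_neg {R : Type*} [AddGroup R] (A : Matrix (Fin m) (Fin m) R)
    (B : Matrix (Fin n) (Fin n) R) (C : Matrix (Fin l) (Fin l) R) :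
    -stateMatrix A B C = stateMatrix (-A) (-B) (-C) := by
  simp [stateMatrix, Matrix.fromBlocks_neg]

theorem stateMatrix_map {R S : Type*} [Zero R] [Zero S] (f : R → S) (hf : f 0 = 0)
    (A : Matrix (Fin m) (Fin m) R)
    (B : Matrix (Fin n) (Fin n) R) (C : Matrix (Fin l) (Fin l) R) :
    (stateMatrix A B C).map f = stateMatrix (A.map f) (B.map f) (C.map f) := by
  simp [stateMatrix, Matrix.fromBlocks_map, hf]

/-- The spectrum of the block of a component. -/
def blockSpectrum (A : Matrix (Fin m) (Fin m) ℂ) (B : Matrix (Fin n) (Fin n) ℂ)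
    (C : Matrix (Fin l) (Fin l) ℂ) : Idx m n l → Set ℂ
  | Sum.inl _ => spectrum ℂ A
  | Sum.inr (Sum.inl _) => spectrum ℂ B
  | Sum.inr (Sum.inr _) => spectrum ℂ C

theorem spectrum_transpose {ι : Type*} [Fintype ι] [DecidableEq ι] (A : Matrix ι ι ℂ) :
    spectrum ℂ A.transpose = spectrum ℂ A := by
  ext z
  rw [spectrum.mem_iff, spectrum.mem_iff, ← Matrix.isUnit_transpose, Matrix.transpose_sub,
    Matrix.transpose_transpose, Matrix.algebraMap_eq_diagonal, Matrix.diagonal_transpose]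

theorem blockSpectrum_transpose (A : Matrix (Fin m) (Fin m) ℂ) (B : Matrix (Fin n) (Fin n) ℂ)
    (C : Matrix (Fin l) (Fin l) ℂ) :
    blockSpectrum A.transpose B.transpose C.transpose = blockSpectrum A B C := by
  ext1 κ
  rcases κ with i | i | i <;> simp [blockSpectrum, spectrum_transpose]

theorem blockSpectrum_neg (A : Matrix (Fin m) (Fin m) ℂ) (B : Matrix (Fin n) (Fin n) ℂ)
    (C : Matrix (Fin l) (Fin l) ℂ) (κ : Idx m n l) :
    blockSpectrum (-A) (-B) (-C) κ = -blockSpectrum A B C κ := by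
  rcases κ with i | i | i <;> exact (spectrum.neg_eq _).symm

/-- A coordinate vector need not be a generalized eigenvector, but it is a sum of such vectors from
its own block; they are transported by the inclusion of the block. -/
theorem single_mem_genEigSpan (A : Matrix (Fin m) (Fin m) ℂ) (B : Matrix (Fin n) (Fin n) ℂ)
    (C : Matrix (Fin l) (Fin l) ℂ) (κ : Idx m n l) :
    Pi.single κ (1 : ℂ) ∈ genEigSpan (Matrix.toLin' (stateMatrix A B C)) (blockSpectrum A B C κ)
      (weightSubmodule blockWeight (blockWeight κ)) := by
  rcases κ with i | i | i
  · have h := map_mem_genEigSpan (M := Matrix.toLin' (stateMatrix A B C)) (Λ := spectrum ℂ A)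
      (K := weightSubmodule blockWeight (1, 0, 0))
      ({ toFun := fun w => Sum.elim w 0
         map_add' := fun v w => by ext j; rcases j with j | j <;> simp
         map_smul' := fun c w => by ext j; rcases j with j | j <;> simp } :
        (Fin m → ℂ) →ₗ[ℂ] (Idx m n l → ℂ))
      (fun w => by
        ext j
        rcases j with j | j | j <;>
          simp [stateMatrix, Matrix.mulVec, dotProduct, Fintype.sum_sum_type])
      subset_rfl (fun w _ j hj => by rcases j with j | j | j <;> simp_all [blockWeight])
      (mem_genEigSpan_spectrum A (Pi.single i 1))
    have e : (Pi.single (Sum.inl i) 1 : Idx m n l → ℂ) = Sum.elim (Pi.single i 1) 0 := by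
      ext j
      rcases j with j | j <;> simp [Pi.single_apply]
    rw [e]
    exact h
  · have h := map_mem_genEigSpan (M := Matrix.toLin' (stateMatrix A B C)) (Λ := spectrum ℂ B)
      (K := weightSubmodule blockWeight (0, 1, 0))
      ({ toFun := fun w => Sum.elim 0 (Sum.elim w 0)
         map_add' := fun v w => by ext j; rcases j with j | j | j <;> simp
         map_smul' := fun c w => by ext j; rcases j with j | j | j <;> simp } :
        (Fin n → ℂ) →ₗ[ℂ] (Idx m n l → ℂ))
      (fun w => by
        ext j
        rcases j with j | j | j <;>
          simp [stateMatrix, Matrix.mulVec, dotProduct, Fintype.sum_sum_type])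
      subset_rfl (fun w _ j hj => by rcases j with j | j | j <;> simp_all [blockWeight])
      (mem_genEigSpan_spectrum B (Pi.single i 1))
    have e : (Pi.single (Sum.inr (Sum.inl i)) 1 : Idx m n l → ℂ) =
        Sum.elim (0 : Fin m → ℂ) (Sum.elim (Pi.single i 1) (0 : Fin l → ℂ)) := by
      ext j
      rcases j with j | j | j <;> simp [Pi.single_apply]
    rw [e]
    exact h
  · have h := map_mem_genEigSpan (M := Matrix.toLin' (stateMatrix A B C)) (Λ := spectrum ℂ C)
      (K := weightSubmodule blockWeight (0, 0, 1))
      ({ toFun := fun w => Sum.elim 0 (Sum.elim 0 w)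
         map_add' := fun v w => by ext j; rcases j with j | j | j <;> simp
         map_smul' := fun c w => by ext j; rcases j with j | j | j <;> simp } :
        (Fin l → ℂ) →ₗ[ℂ] (Idx m n l → ℂ))
      (fun w => by
        ext j
        rcases j with j | j | j <;>
          simp [stateMatrix, Matrix.mulVec, dotProduct, Fintype.sum_sum_type])
      subset_rfl (fun w _ j hj => by rcases j with j | j | j <;> simp_all [blockWeight])
      (mem_genEigSpan_spectrum C (Pi.single i 1))
    have e : (Pi.single (Sum.inr (Sum.inr i)) 1 : Idx m n l → ℂ) =
        Sum.elim (0 : Fin m → ℂ) (Sum.elim (0 : Fin n → ℂ) (Pi.single i 1)) := by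
      ext j
      rcases j with j | j | j <;> simp [Pi.single_apply]
    rw [e]
    exact h

end BlockSpectrum

/-! ### Eigenvalues of monomial fields and the spectral gap -/

section MonomialSpectrum

variable {m n l : ℕ}

/-- The numbers in the half planes that contain the eigenvalues belonging to monomials of weight
`w`: an upper bound for monomials in the centre and stable variables, and a lower bound for monomials
in the centre and unstable variables. -/
def weightSpectrum (α β : ℝ) (w : ℤ × ℤ × ℤ) : Set ℂ :=
  {z | (w.2.2 = 0 → z.re ≤ w.1 * α - w.2.1 * β) ∧ (w.2.1 = 0 → -w.1 * α + w.2.2 * β ≤ z.re)}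

theorem weight_blockWeight_nonneg (s : Idx m n l →₀ ℕ) :
    0 ≤ (Finsupp.weight blockWeight s).1 ∧ 0 ≤ (Finsupp.weight blockWeight s).2.1 ∧
      0 ≤ (Finsupp.weight blockWeight s).2.2 := by
  induction s using Finsupp.induction_linear with
  | zero => simp
  | add f g hf hg =>
    simp only [map_add, Prod.fst_add, Prod.snd_add]
    omega
  | single i k =>
    rw [Finsupp.weight_single]
    rcases i with i | i | i <;> simp [blockWeight]

theorem weight_blockWeight_sum (s : Idx m n l →₀ ℕ) :
    (Finsupp.weight blockWeight s).1 + (Finsupp.weight blockWeight s).2.1 +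
      (Finsupp.weight blockWeight s).2.2 = Finsupp.degree s := by
  induction s using Finsupp.induction_linear with
  | zero => simp
  | add f g hf hg =>
    simp only [map_add, Prod.fst_add, Prod.snd_add]
    push_cast
    omega
  | single i k =>
    rw [Finsupp.weight_single]
    rcases i with i | i | i <;> simp [blockWeight]

/-- The derivation is additive on products, so eigenvalues add up along the factors of a monomial,
starting from the variables, where they lie in the block spectra. -/
theorem monomial_mem_genEigSpan {A : Matrix (Fin m) (Fin m) ℂ} {B : Matrix (Fin n) (Fin n) ℂ}
    {C : Matrix (Fin l) (Fin l) ℂ} {α β : ℝ} (hA : ∀ z ∈ spectrum ℂ A, |z.re| ≤ α)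
    (hB : ∀ z ∈ spectrum ℂ B, z.re ≤ -β) (hC : ∀ z ∈ spectrum ℂ C, β ≤ z.re)
    (s : Idx m n l →₀ ℕ) :
    monomial s (1 : ℂ) ∈ genEigSpan (linDerivation (stateMatrix A B C) : MvPolynomial _ ℂ →ₗ[ℂ] _)
      (weightSpectrum α β (Finsupp.weight blockWeight s))
      (weightedHomogeneousSubmodule ℂ blockWeight (Finsupp.weight blockWeight s)) := by
  have hzero : monomial (0 : Idx m n l →₀ ℕ) (1 : ℂ) ∈
      genEigSpan (linDerivation (stateMatrix A B C) : MvPolynomial _ ℂ →ₗ[ℂ] _)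
      (weightSpectrum α β (Finsupp.weight blockWeight (0 : Idx m n l →₀ ℕ)))
      (weightedHomogeneousSubmodule ℂ blockWeight (Finsupp.weight blockWeight
        (0 : Idx m n l →₀ ℕ))) := by
    refine Submodule.subset_span ⟨?_, 0, by simp [weightSpectrum], ?_⟩
    · simpa using isWeightedHomogeneous_one ℂ blockWeight
    · rw [Module.End.mem_maxGenEigenspace]
      exact ⟨1, by simp⟩
  have hadd : ∀ s s' : Idx m n l →₀ ℕ,
      monomial s (1 : ℂ) ∈ genEigSpan (linDerivation (stateMatrix A B C) : MvPolynomial _ ℂ →ₗ[ℂ] _)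
        (weightSpectrum α β (Finsupp.weight blockWeight s))
        (weightedHomogeneousSubmodule ℂ blockWeight (Finsupp.weight blockWeight s)) →
      monomial s' (1 : ℂ) ∈ genEigSpan (linDerivation (stateMatrix A B C) : MvPolynomial _ ℂ →ₗ[ℂ] _)
        (weightSpectrum α β (Finsupp.weight blockWeight s'))
        (weightedHomogeneousSubmodule ℂ blockWeight (Finsupp.weight blockWeight s')) →
      monomial (s + s') (1 : ℂ) ∈
        genEigSpan (linDerivation (stateMatrix A B C) : MvPolynomial _ ℂ →ₗ[ℂ] _)
        (weightSpectrum α β (Finsupp.weight blockWeight (s + s')))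
        (weightedHomogeneousSubmodule ℂ blockWeight (Finsupp.weight blockWeight (s + s'))) := by
    intro s s' h h'
    have := bilinear_mem_genEigSpan
      (M := (linDerivation (stateMatrix A B C) : MvPolynomial _ ℂ →ₗ[ℂ] _))
      (Λ := weightSpectrum α β (Finsupp.weight blockWeight (s + s')))
      (K := weightedHomogeneousSubmodule ℂ blockWeight (Finsupp.weight blockWeight (s + s')))
      (LinearMap.mul ℂ (MvPolynomial (Idx m n l) ℂ))
      (fun f g => by simp [add_comm, mul_comm]) ?_ ?_ h h'
    · simpa [monomial_mul] using this
    · obtain ⟨h₁, h₂, h₃⟩ := weight_blockWeight_nonneg s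
      obtain ⟨h₁', h₂', h₃'⟩ := weight_blockWeight_nonneg s'
      rintro z ⟨hz, hz'⟩ w ⟨hw, hw'⟩
      rw [map_add]
      simp only [weightSpectrum, Set.mem_ofPred_eq, Prod.fst_add, Prod.snd_add, Complex.add_re]
      push_cast
      constructor
      · intro h0
        have := hz (by omega)
        have := hw (by omega)
        linarith
      · intro h0
        have := hz' (by omega)
        have := hw' (by omega)
        linarith
    · intro f hf g hg
      rw [map_add]
      exact IsWeightedHomogeneous.mul hf hg
  have hone : ∀ i : Idx m n l, monomial (Finsupp.single i 1) (1 : ℂ) ∈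
      genEigSpan (linDerivation (stateMatrix A B C) : MvPolynomial _ ℂ →ₗ[ℂ] _)
      (weightSpectrum α β (Finsupp.weight blockWeight (Finsupp.single i 1)))
      (weightedHomogeneousSubmodule ℂ blockWeight
        (Finsupp.weight blockWeight (Finsupp.single i 1))) := by
    intro i
    have h := single_mem_genEigSpan A.transpose B.transpose C.transpose i
    rw [blockSpectrum_transpose, ← stateMatrix_transpose] at h
    have h' := map_mem_genEigSpan
      (M := (linDerivation (stateMatrix A B C) : MvPolynomial _ ℂ →ₗ[ℂ] _))
      (Λ := weightSpectrum α β (blockWeight i))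
      (K := weightedHomogeneousSubmodule ℂ blockWeight (blockWeight i))
      formMap (fun f => linDerivation_formMap _ f) ?_
      (fun f hf => formMap_isWeightedHomogeneous _ hf) h
    · rw [formMap_single] at h'
      rw [Finsupp.weight_single, one_smul]
      exact h'
    · intro z hz
      rcases i with i | i | i
      · have := abs_le.1 (hA z hz)
        simpa [weightSpectrum, blockWeight, and_comm] using this
      · have := hB z hz
        simpa [weightSpectrum, blockWeight] using this
      · have := hC z hz
        simpa [weightSpectrum, blockWeight] using this
  induction s using Finsupp.induction_linear with
  | zero => exact hzero
  | add f g hf hg => exact hadd f g hf hg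
  | single i k =>
    induction k with
    | zero => simpa using hzero
    | succ k ih =>
      rw [Finsupp.single_add]
      exact hadd _ _ ih (hone i)

/-- The terms that may occur in the normal form: for a component of block weight `w₀` and a
monomial of weight `w`. -/
def Retained (w₀ w : ℤ × ℤ × ℤ) : Prop :=
  (w₀ = (1, 0, 0) → (w.2.1 = 0 ↔ w.2.2 = 0)) ∧ (w₀ = (0, 1, 0) → w.2.1 ≠ 0) ∧
    (w₀ = (0, 0, 1) → w.2.2 ≠ 0)

/-- A term that is not retained has real parts of one sign, at distance at least `β - (P - 1) α > μ`
from zero. In a centre component the monomial contains stable or unstable variables but not both,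
which contributes `β`. In a stable component it has no stable variable, and in an unstable one no
unstable variable; there the component itself contributes `β`. -/
theorem spectralGap_fast {A : Matrix (Fin m) (Fin m) ℝ} {B : Matrix (Fin n) (Fin n) ℝ}
    {C : Matrix (Fin l) (Fin l) ℝ} {α β μ : ℝ} {P : ℕ} (h : SpectralGap A B C α β μ P)
    (κ : Idx m n l) (s : Idx m n l →₀ ℕ) (hs : Finsupp.degree s < P)
    (hκ : ¬ Retained (blockWeight κ) (Finsupp.weight blockWeight s)) {z z' : ℂ}
    (hz : z ∈ weightSpectrum α β (Finsupp.weight blockWeight s))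
    (hz' : -z' ∈ blockSpectrum (A.map (algebraMap ℝ ℂ)) (B.map (algebraMap ℝ ℂ))
      (C.map (algebraMap ℝ ℂ)) κ) : μ < |(z + z').re| := by
  obtain ⟨h₁, h₂, h₃⟩ := weight_blockWeight_nonneg s
  have hsum := weight_blockWeight_sum s
  generalize hw : Finsupp.weight blockWeight s = w at *
  obtain ⟨i, j, k⟩ := w
  simp only [weightSpectrum, Set.mem_ofPred_eq] at hz h₁ h₂ h₃ hsum
  obtain ⟨hzu, hzl⟩ := hz
  have hα := h.alpha_nonneg
  have hβ := h.beta_pos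
  have hμ := h.threshold_upper
  have hiR : (0 : ℝ) ≤ i := by exact_mod_cast h₁
  have hjR : (0 : ℝ) ≤ j := by exact_mod_cast h₂
  have hkR : (0 : ℝ) ≤ k := by exact_mod_cast h₃
  have hiP : (i : ℝ) + j + k ≤ P - 1 := by
    have : i + j + k + 1 ≤ P := by rw [hsum]; exact_mod_cast hs
    have : (i : ℝ) + j + k + 1 ≤ P := by exact_mod_cast this
    linarith
  rw [Complex.add_re]
  rcases κ with κ | κ | κ
  · have hb := abs_le.1 (h.center _ hz')
    rw [Complex.neg_re] at hb
    have hκ' : ¬ (j = 0 ↔ k = 0) := fun h0 => hκ ⟨fun _ => h0, by simp [blockWeight],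
      by simp [blockWeight]⟩
    by_cases hk : k = 0
    · have hj : (1 : ℝ) ≤ j := by
        have : 1 ≤ j := by omega
        exact_mod_cast this
      have := hzu hk
      -- One of the at most `P - 1` factors is stable, which leaves at most `P - 2` centre factors;
      -- the centre component supplies one more `α`.
      have h4 : (i : ℝ) * α ≤ (P - 2) * α := by gcongr; linarith
      have h5 : β ≤ j * β := by nlinarith
      refine lt_abs.2 (Or.inr ?_)
      linarith
    · have hj : j = 0 := by tauto
      have hk1 : (1 : ℝ) ≤ k := by
        have : 1 ≤ k := by omega
        exact_mod_cast this
      have := hzl hj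
      have h4 : (i : ℝ) * α ≤ (P - 2) * α := by gcongr; linarith
      have h5 : β ≤ k * β := by nlinarith
      refine lt_abs.2 (Or.inl ?_)
      linarith
  · have hb := h.stable _ hz'
    rw [Complex.neg_re] at hb
    have hj : j = 0 := by
      by_contra hj
      exact hκ ⟨by simp [blockWeight], fun _ => hj, by simp [blockWeight]⟩
    have := hzl hj
    have h4 : (i : ℝ) * α ≤ (P - 1) * α := by gcongr; linarith
    have h5 : 0 ≤ k * β := by positivity
    refine lt_abs.2 (Or.inl ?_)
    linarith
  · have hb := h.unstable _ hz'
    rw [Complex.neg_re] at hb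
    have hk : k = 0 := by
      by_contra hk
      exact hκ ⟨by simp [blockWeight], by simp [blockWeight], fun _ => hk⟩
    have := hzu hk
    have h4 : (i : ℝ) * α ≤ (P - 1) * α := by gcongr; linarith
    have h5 : 0 ≤ j * β := by positivity
    refine lt_abs.2 (Or.inr ?_)
    linarith

theorem homologicallySolvable_monomial {A : Matrix (Fin m) (Fin m) ℝ}
    {B : Matrix (Fin n) (Fin n) ℝ} {C : Matrix (Fin l) (Fin l) ℝ} {α β μ : ℝ} {P : ℕ}
    (h : SpectralGap A B C α β μ P) (κ : Idx m n l) (s : Idx m n l →₀ ℕ)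
    (hs : Finsupp.degree s < P) (R : Submodule ℂ (Idx m n l → MvPolynomial (Idx m n l) ℂ))
    (hR : Retained (blockWeight κ) (Finsupp.weight blockWeight s) →
      typeSubmodule blockWeight (blockWeight κ) (Finsupp.weight blockWeight s) ≤ R)
    {a : Forcing m n l → ℝ → ℂ} (ha : FastExpr μ 0 a) :
    HomologicallySolvable μ (homOp (stateMatrix (A.map (algebraMap ℝ ℂ)) (B.map (algebraMap ℝ ℂ))
      (C.map (algebraMap ℝ ℂ)))) (typeSubmodule blockWeight (blockWeight κ)
        (Finsupp.weight blockWeight s)) R a (directed (monomial s 1) (Pi.single κ 1)) := by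
  have : Nonempty (Idx m n l) := ⟨κ⟩
  have hμ : 0 ≤ μ := le_trans (by have := h.alpha_nonneg; positivity) h.threshold_lower
  have h₁ := monomial_mem_genEigSpan h.center h.stable h.unstable s
  have h₂ := single_mem_genEigSpan (-A.map (algebraMap ℝ ℂ)) (-B.map (algebraMap ℝ ℂ))
    (-C.map (algebraMap ℝ ℂ)) κ
  rw [← stateMatrix_neg] at h₂
  -- The set `Λ` is exactly the condition under which `of_mem_genEigSpan` applies.
  have h₃ := bilinear_mem_genEigSpan directed (homOp_directed _)
    (Λ := {z | μ < |z.re| ∨ typeSubmodule blockWeight (blockWeight κ)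
      (Finsupp.weight blockWeight s) ≤ R})
    (K := typeSubmodule blockWeight (blockWeight κ) (Finsupp.weight blockWeight s)) ?_
    (fun f hf w hw => directed_mem_typeSubmodule _ hf hw) h₁ h₂
  · exact .of_mem_genEigSpan hμ
      (fun v hv => homOp_mem_typeSubmodule _ (stateMatrix_eq_zero _ _ _) hv) (fun z hz => hz) h₃ ha
  · intro z hz z' hz'
    by_cases hκ : Retained (blockWeight κ) (Finsupp.weight blockWeight s)
    · exact Or.inr (hR hκ)
    · rw [blockSpectrum_neg] at hz'
      exact Or.inl (spectralGap_fast h κ s hs hκ hz hz')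

end MonomialSpectrum

/-! ### Real solutions of the homological equation in one degree -/

section HomogeneousSolution

variable {m n l : ℕ} {μ : ℝ}

theorem mem_finsuppAntidiag_univ {σ : Type*} [Fintype σ] [DecidableEq σ] {s : σ →₀ ℕ} {k : ℕ} :
    s ∈ (Finset.univ : Finset σ).finsuppAntidiag k ↔ Finsupp.degree s = k := by
  simp [Finset.mem_finsuppAntidiag, Finsupp.degree_eq_sum]

/-- The real part of a polynomial vector field of degree `k` with functional coefficients. -/
noncomputable def realField (k : ℕ) (f : Forcing m n l → ℝ → Idx m n l → MvPolynomial (Idx m n l) ℂ)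
    (κ : Idx m n l) : MvPolynomial (Idx m n l) (Coeff m n l) :=
  ∑ s ∈ (Finset.univ : Finset (Idx m n l)).finsuppAntidiag k,
    monomial s fun b t => (coeff s (f b t κ)).re

theorem coeff_realField (k : ℕ)
    (f : Forcing m n l → ℝ → Idx m n l → MvPolynomial (Idx m n l) ℂ)
    (κ : Idx m n l) (s : Idx m n l →₀ ℕ) : coeff s (realField k f κ) =
      if Finsupp.degree s = k then fun b t => (coeff s (f b t κ)).re else 0 := by
  simp only [realField, coeff_sum, coeff_monomial, Finset.sum_ite_eq', mem_finsuppAntidiag_univ]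

theorem coeff_realField_of_homogeneous {k : ℕ}
    {f : Forcing m n l → ℝ → Idx m n l → MvPolynomial (Idx m n l) ℂ}
    (hf : ∀ b t κ, (f b t κ).IsHomogeneous k) (κ : Idx m n l) (s : Idx m n l →₀ ℕ) :
    coeff s (realField k f κ) = fun b t => (coeff s (f b t κ)).re := by
  rw [coeff_realField]
  split_ifs with h
  · rfl
  · ext b t
    rw [(hf b t κ).coeff_eq_zero h]
    rfl

theorem isHomogeneous_realField (k : ℕ)
    (f : Forcing m n l → ℝ → Idx m n l → MvPolynomial (Idx m n l) ℂ) (κ : Idx m n l) :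
    (realField k f κ).IsHomogeneous k := by
  refine IsHomogeneous.sum _ _ _ fun s hs => ?_
  exact isHomogeneous_monomial _ (mem_finsuppAntidiag_univ.1 hs)

/-- The vector fields of degree `k`. -/
noncomputable def degreeSubmodule (k : ℕ) :
    Submodule ℂ (Idx m n l → MvPolynomial (Idx m n l) ℂ) :=
  Submodule.pi Set.univ fun _ => homogeneousSubmodule (Idx m n l) ℂ k

theorem mem_degreeSubmodule {k : ℕ} {f : Idx m n l → MvPolynomial (Idx m n l) ℂ} :
    f ∈ degreeSubmodule k ↔ ∀ κ, (f κ).IsHomogeneous k := by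
  simp [degreeSubmodule, Submodule.mem_pi]

theorem typeSubmodule_le_degreeSubmodule (w₀ : ℤ × ℤ × ℤ) (s : Idx m n l →₀ ℕ) :
    typeSubmodule blockWeight w₀ (Finsupp.weight blockWeight s) ≤
      degreeSubmodule (m := m) (n := n) (l := l) (Finsupp.degree s) := by
  intro f hf
  rw [mem_degreeSubmodule]
  intro κ s' hs'
  have := (hf κ).1 hs'
  have h₁ := weight_blockWeight_sum s
  have h₂ := weight_blockWeight_sum s'
  rw [this, h₁] at h₂
  have h₃ : Finsupp.weight 1 s' = Finsupp.degree s' :=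
    (DFunLike.congr_fun Finsupp.degree_eq_weight_one s').symm
  rw [h₃]
  exact_mod_cast h₂.symm

/-- The vector fields of degree `k` with retained terms only. -/
noncomputable def retainedSubmodule (k : ℕ) :
    Submodule ℂ (Idx m n l → MvPolynomial (Idx m n l) ℂ) where
  carrier := {f | f ∈ degreeSubmodule k ∧ ∀ κ s, coeff s (f κ) ≠ 0 →
    Retained (blockWeight κ) (Finsupp.weight blockWeight s)}
  add_mem' {f g} hf hg := by
    refine ⟨Submodule.add_mem _ hf.1 hg.1, fun κ s hs => ?_⟩
    by_cases h : coeff s (f κ) = 0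
    · refine hg.2 κ s ?_
      simpa [h] using hs
    · exact hf.2 κ s h
  zero_mem' := ⟨Submodule.zero_mem _, by simp⟩
  smul_mem' c f hf := by
    refine ⟨Submodule.smul_mem _ c hf.1, fun κ s hs => hf.2 κ s ?_⟩
    intro h
    simp [h] at hs

/-- Being retained depends only on the block weights of component and monomial, and these are
constant on a type. -/
theorem typeSubmodule_le_retainedSubmodule {κ : Idx m n l} {s : Idx m n l →₀ ℕ}
    (h : Retained (blockWeight κ) (Finsupp.weight blockWeight s)) :
    typeSubmodule blockWeight (blockWeight κ) (Finsupp.weight blockWeight s) ≤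
      retainedSubmodule (m := m) (n := n) (l := l) (Finsupp.degree s) := by
  refine fun f hf => ⟨typeSubmodule_le_degreeSubmodule _ _ hf, fun κ' s' hs' => ?_⟩
  have h₀ : blockWeight κ' = blockWeight κ := by
    by_contra hne
    simp [(hf κ').2 hne] at hs'
  rwa [h₀, (hf κ').1 hs']

/-- The linear functional that reads a coefficient of a component. -/
noncomputable def coeffFunctional (κ : Idx m n l) (s : Idx m n l →₀ ℕ) :
    (Idx m n l → MvPolynomial (Idx m n l) ℂ) →ₗ[ℂ] ℂ :=
  (lcoeff ℂ s).comp (LinearMap.proj κ)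

theorem coeffFunctional_apply (κ : Idx m n l) (s : Idx m n l →₀ ℕ)
    (f : Idx m n l → MvPolynomial (Idx m n l) ℂ) : coeffFunctional κ s f = coeff s (f κ) := rfl

/-- The linear part with constant functional coefficients. -/
noncomputable def constMatrix (A : Matrix (Fin m) (Fin m) ℝ) (B : Matrix (Fin n) (Fin n) ℝ)
    (C : Matrix (Fin l) (Fin l) ℝ) : Matrix (Idx m n l) (Idx m n l) (Coeff m n l) :=
  (stateMatrix A B C).map (algebraMap ℝ (Coeff m n l))

/-- Taking real parts commutes with the operator because `A`, `B`, `C` are real. -/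
theorem coeff_homOp_realField (A : Matrix (Fin m) (Fin m) ℝ) (B : Matrix (Fin n) (Fin n) ℝ)
    (C : Matrix (Fin l) (Fin l) ℝ) {k : ℕ}
    {f : Forcing m n l → ℝ → Idx m n l → MvPolynomial (Idx m n l) ℂ}
    (hf : ∀ b t κ, (f b t κ).IsHomogeneous k) (κ : Idx m n l) (s : Idx m n l →₀ ℕ)
    (b : Forcing m n l) (t : ℝ) :
    coeff s (homOp (constMatrix A B C) (realField k f) κ) b t =
      (coeff s (homOp (stateMatrix (A.map (algebraMap ℝ ℂ)) (B.map (algebraMap ℝ ℂ))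
        (C.map (algebraMap ℝ ℂ))) (f b t) κ)).re := by
  rw [← stateMatrix_map (algebraMap ℝ ℂ) (map_zero _), coeff_homOp, coeff_homOp]
  simp only [coeff_realField_of_homogeneous hf, Pi.sub_apply, Finset.sum_apply, Complex.sub_re,
    Complex.re_sum, Pi.mul_apply, constMatrix, Matrix.map_apply, Pi.algebraMap_apply,
    Algebra.algebraMap_self_apply, Complex.coe_algebraMap, Complex.re_ofReal_mul]
  congr 1
  refine Finset.sum_congr rfl fun i _ => Finset.sum_congr rfl fun j _ => ?_
  congr 1
  split_ifs
  · have : ∀ (z : ℂ) (N : ℕ), (z * ((N : ℂ) + 1)).re = z.re * ((N : ℝ) + 1) := by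
      intro z N
      rw [mul_comm, mul_comm z.re]
      exact_mod_cast Complex.re_ofReal_mul ((N : ℝ) + 1) z
    rw [this]
    rfl
  · rfl

/-- `ξ'` is the time derivative of the polynomial vector field `ξ`, and the coefficients of both
are fast expressions. -/
def FastDerivative (μ : ℝ) (ξ ξ' : Idx m n l → MvPolynomial (Idx m n l) (Coeff m n l)) : Prop :=
  ∀ κ s, IsFast μ (coeff s (ξ κ)) ∧ IsFast μ (coeff s (ξ' κ)) ∧
    ∀ b t, HasDerivAt (coeff s (ξ κ) b) (coeff s (ξ' κ) b t) t

/-- The right-hand side is a sum of monomial fields, each solvable over `ℂ`. Since it is real, the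
real part of the summed solution solves the same equation. -/
theorem exists_homogeneous_solution {A : Matrix (Fin m) (Fin m) ℝ}
    {B : Matrix (Fin n) (Fin n) ℝ} {C : Matrix (Fin l) (Fin l) ℝ} {α β : ℝ} {P : ℕ}
    [Nonempty (Idx m n l)] (h : SpectralGap A B C α β μ P) {k : ℕ} (hk : k < P)
    (a : Idx m n l → (Idx m n l →₀ ℕ) → Coeff m n l) (ha : ∀ κ s, IsFast μ (a κ s)) :
    ∃ ξ ξ' q : Idx m n l → MvPolynomial (Idx m n l) (Coeff m n l),
      (∀ κ, (ξ κ).IsHomogeneous k) ∧ (∀ κ, (ξ' κ).IsHomogeneous k) ∧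
      (∀ κ, (q κ).IsHomogeneous k) ∧ FastDerivative μ ξ ξ' ∧
      (∀ κ s, MemoryOnlyQuadratic μ (coeff s (q κ))) ∧
      (∀ κ s, coeff s (q κ) ≠ 0 → Retained (blockWeight κ) (Finsupp.weight blockWeight s)) ∧
      ∀ κ s, Finsupp.degree s = k →
        coeff s (ξ' κ + homOp (constMatrix A B C) ξ κ + q κ) = a κ s := by
  obtain ⟨ξ, ξ', q, hξ, hq, e⟩ := HomologicallySolvable.exists_sum
    (M := homOp (stateMatrix (A.map (algebraMap ℝ ℂ)) (B.map (algebraMap ℝ ℂ))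
      (C.map (algebraMap ℝ ℂ)))) (K := degreeSubmodule k) (R := retainedSubmodule k)
    (Finset.univ ×ˢ (Finset.univ : Finset (Idx m n l)).finsuppAntidiag k)
    (a := fun i b t => (a i.1 i.2 b t : ℂ))
    (v := fun i => directed (monomial i.2 1) (Pi.single i.1 1)) (by
      rintro ⟨κ, s⟩ hs
      obtain rfl : Finsupp.degree s = k := by
        exact mem_finsuppAntidiag_univ.1 (Finset.mem_product.1 hs).2
      exact (homologicallySolvable_monomial h κ s hk _
        (fun hr => typeSubmodule_le_retainedSubmodule hr) (ha κ s)).mono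
          (typeSubmodule_le_degreeSubmodule _ _) le_rfl)
  have c₁ := coeff_realField_of_homogeneous fun b t => mem_degreeSubmodule.1 (hξ.mem b t)
  have c₂ := coeff_realField_of_homogeneous fun b t => mem_degreeSubmodule.1 (hξ.mem' b t)
  have c₃ := coeff_realField_of_homogeneous fun b t => mem_degreeSubmodule.1 (hq.mem b t).1
  refine ⟨realField k ξ, realField k ξ', realField k q, isHomogeneous_realField k ξ,
    isHomogeneous_realField k ξ', isHomogeneous_realField k q, fun κ s => ?_, fun κ s => ?_,
    fun κ s hs => ?_, fun κ s hs => ?_⟩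
  · rw [c₁, c₂]
    refine ⟨(hξ.fast (coeffFunctional κ s)).re, (hξ.fast' (coeffFunctional κ s)).re,
      fun b t => ?_⟩
    exact (Complex.reCLM.hasFDerivAt.comp_hasDerivAt t
      (hξ.hasDeriv (coeffFunctional κ s) b t) :)
  · rw [c₃]
    exact (hq.memory (coeffFunctional κ s)).re
  · rw [c₃] at hs
    by_contra hr
    refine hs ?_
    ext b t
    have : coeff s (q b t κ) = 0 := by
      by_contra h0
      exact hr ((hq.mem b t).2 κ s h0)
    rw [this]; rfl
  · ext b t
    have e' := congrArg Complex.re (congrArg (coeffFunctional κ s) (e b t))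
    have e₂ : coeffFunctional κ s (∑ i ∈ Finset.univ ×ˢ
        (Finset.univ : Finset (Idx m n l)).finsuppAntidiag k,
        ((a i.1 i.2 b t : ℝ) : ℂ) • directed (monomial i.2 (1 : ℂ)) (Pi.single i.1 1)) =
        ((a κ s b t : ℝ) : ℂ) := by
      rw [map_sum, Finset.sum_eq_single (κ, s)]
      · simp [coeffFunctional_apply, directed_apply]
      · rintro ⟨κ', s'⟩ _ hne
        simp only [coeffFunctional_apply, directed_apply, Pi.smul_apply, coeff_smul,
          coeff_monomial, Pi.single_apply]
        split_ifs with h₁ h₂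
        · exact absurd (by rw [h₁, h₂]) hne
        all_goals simp
      · intro hmem
        exact absurd (Finset.mem_product.2
          ⟨Finset.mem_univ κ, mem_finsuppAntidiag_univ.2 hs⟩) hmem
    rw [e₂, Complex.ofReal_re] at e'
    rw [← e', coeff_add, coeff_add, c₂, c₃, Pi.add_apply, Pi.add_apply, Pi.add_apply, Pi.add_apply,
      coeff_homOp_realField A B C fun b t => mem_degreeSubmodule.1 (hξ.mem b t)]
    simp [coeffFunctional_apply]

end HomogeneousSolution

/-! ### Polynomials with coefficients in a subring -/

section CoefficientSubrings

variable {σ R : Type*} [CommRing R]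

/-- The polynomials with coefficients in a subring. -/
def coeffSubring (S : Subring R) : Subring (MvPolynomial σ R) where
  carrier := {f | ∀ s, coeff s f ∈ S}
  mul_mem' {f g} hf hg s := by
    classical
    rw [coeff_mul]
    exact S.sum_mem fun i _ => S.mul_mem (hf _) (hg _)
  one_mem' s := by
    classical
    rw [coeff_one]
    split_ifs
    exacts [S.one_mem, S.zero_mem]
  add_mem' {f g} hf hg s := by
    rw [coeff_add]
    exact S.add_mem (hf s) (hg s)
  zero_mem' s := by simp
  neg_mem' {f} hf s := by
    rw [coeff_neg]
    exact S.neg_mem (hf s)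

theorem C_mem_coeffSubring {S : Subring R} {a : R} (ha : a ∈ S) :
    (C a : MvPolynomial σ R) ∈ coeffSubring S := by
  classical
  intro s
  rw [coeff_C]
  split_ifs
  exacts [ha, S.zero_mem]

theorem X_mem_coeffSubring {S : Subring R} (i : σ) :
    (X i : MvPolynomial σ R) ∈ coeffSubring S := by
  classical
  intro s
  rw [coeff_X]
  split_ifs
  exacts [S.one_mem, S.zero_mem]

theorem pderiv_mem_coeffSubring {S : Subring R} {f : MvPolynomial σ R} (hf : f ∈ coeffSubring S)
    (i : σ) : pderiv i f ∈ coeffSubring S := by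
  intro s
  rw [coeff_pderiv]
  exact S.mul_mem (hf _) (S.add_mem (natCast_mem S _) S.one_mem)

theorem bind₁_mem_coeffSubring {S : Subring R} {f : MvPolynomial σ R} {T : σ → MvPolynomial σ R}
    (hf : f ∈ coeffSubring S) (hT : ∀ i, T i ∈ coeffSubring S) : bind₁ T f ∈ coeffSubring S := by
  rw [bind₁, aeval_def]
  exact eval₂_mem (fun s _ => C_mem_coeffSubring (hf s)) hT

end CoefficientSubrings

/-! ### Orders of vanishing as powers of the ideal of the variables -/

section Orders

variable {σ R : Type*} [CommRing R]

theorem pderiv_mem_pow_idealOfVars {f : MvPolynomial σ R} {k : ℕ}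
    (hf : f ∈ idealOfVars σ R ^ (k + 1)) (i : σ) : pderiv i f ∈ idealOfVars σ R ^ k := by
  rw [mem_pow_idealOfVars_iff'] at hf ⊢
  intro s hs
  rw [coeff_pderiv, hf _ (by rw [map_add, Finsupp.degree_single]; omega), zero_mul]

theorem isHomogeneous_mem_pow_idealOfVars {f : MvPolynomial σ R} {k : ℕ}
    (hf : f.IsHomogeneous k) : f ∈ idealOfVars σ R ^ k := by
  rw [mem_pow_idealOfVars_iff']
  intro s hs
  exact hf.coeff_eq_zero hs.ne

theorem monomial_prod_mem_pow {T : σ → MvPolynomial σ R}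
    (hT : ∀ i, T i ∈ idealOfVars σ R) (s : σ →₀ ℕ) :
    (s.prod fun i e => T i ^ e) ∈ idealOfVars σ R ^ Finsupp.degree s := by
  classical
  induction s using Finsupp.induction_linear with
  | zero => simp
  | add f g hf hg =>
    rw [Finsupp.prod_add_index' (by simp) (by simp [pow_add]), map_add, pow_add]
    exact Ideal.mul_mem_mul hf hg
  | single i k =>
    rw [Finsupp.prod_single_index (by simp), Finsupp.degree_single]
    exact Ideal.pow_mem_pow (hT i) k

/-- Telescoping: in every term of the difference at least one factor of order one is replaced by a
factor of order `k`, which raises the order by `k - 1`. -/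
theorem monomial_prod_sub_mem_pow {T ξ : σ → MvPolynomial σ R} {k : ℕ} (hk : 1 ≤ k)
    (hT : ∀ i, T i ∈ idealOfVars σ R) (hξ : ∀ i, ξ i ∈ idealOfVars σ R ^ k) (s : σ →₀ ℕ) :
    (s.prod fun i e => (T i + ξ i) ^ e) - (s.prod fun i e => T i ^ e) ∈
      idealOfVars σ R ^ (k + Finsupp.degree s - 1) := by
  classical
  have hT' : ∀ i, T i + ξ i ∈ idealOfVars σ R := fun i =>
    Ideal.add_mem _ (hT i) (Ideal.pow_le_self (by omega) (hξ i))
  have hadd : ∀ f g : σ →₀ ℕ,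
      (f.prod fun i e => (T i + ξ i) ^ e) - (f.prod fun i e => T i ^ e) ∈
        idealOfVars σ R ^ (k + Finsupp.degree f - 1) →
      (g.prod fun i e => (T i + ξ i) ^ e) - (g.prod fun i e => T i ^ e) ∈
        idealOfVars σ R ^ (k + Finsupp.degree g - 1) →
      ((f + g).prod fun i e => (T i + ξ i) ^ e) - ((f + g).prod fun i e => T i ^ e) ∈
        idealOfVars σ R ^ (k + Finsupp.degree (f + g) - 1) := by
    intro f g hf hg
    rw [Finsupp.prod_add_index' (by simp) (by simp [pow_add]),
      Finsupp.prod_add_index' (by simp) (by simp [pow_add]), map_add]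
    have h₁ := Ideal.mul_mem_mul hf (monomial_prod_mem_pow hT' g)
    have h₂ := Ideal.mul_mem_mul (monomial_prod_mem_pow hT f) hg
    rw [← pow_add] at h₁ h₂
    have e₁ : k + Finsupp.degree f - 1 + Finsupp.degree g =
      k + (Finsupp.degree f + Finsupp.degree g) - 1 := by omega
    have e₂ : Finsupp.degree f + (k + Finsupp.degree g - 1) =
      k + (Finsupp.degree f + Finsupp.degree g) - 1 := by omega
    rw [e₁] at h₁
    rw [e₂] at h₂
    convert Ideal.add_mem _ h₁ h₂ using 1
    ring
  induction s using Finsupp.induction_linear with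
  | zero => simp
  | add f g hf hg => exact hadd f g hf hg
  | single i e =>
    induction e with
    | zero => simp
    | succ e ih =>
      rw [Finsupp.single_add]
      refine hadd _ _ ih ?_
      simpa [Finsupp.prod_single_index] using hξ i

/-- The monomials of `f` have degree at least two, and `k + 2 - 1 = k + 1`: a correction of degree
`k` in the transform is not felt by the nonlinearity at degree `k`. -/
theorem bind₁_add_sub_mem_pow {T ξ : σ → MvPolynomial σ R} {k : ℕ} (hk : 1 ≤ k)
    (hT : ∀ i, T i ∈ idealOfVars σ R) (hξ : ∀ i, ξ i ∈ idealOfVars σ R ^ k)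
    {f : MvPolynomial σ R} (hf : f ∈ idealOfVars σ R ^ 2) :
    bind₁ (T + ξ) f - bind₁ T f ∈ idealOfVars σ R ^ (k + 1) := by
  rw [bind₁, bind₁, aeval_def, aeval_def, eval₂_eq, eval₂_eq, ← Finset.sum_sub_distrib]
  refine Ideal.sum_mem _ fun s hs => ?_
  rw [← mul_sub]
  refine Ideal.mul_mem_left _ _ (Ideal.pow_le_pow_right ?_ (monomial_prod_sub_mem_pow hk hT hξ s))
  have := (mem_pow_idealOfVars_iff _ _).1 hf s hs
  omega

end Orders

/-! ### Construction of the formal normal form, degree by degree -/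

section FormalNormalForm

variable {m n l : ℕ} {μ : ℝ}

/-- The subring of the coefficients built by fast-time convolutions. -/
def fastSubring (m n l : ℕ) (μ : ℝ) : Subring (Coeff m n l) where
  carrier := {a | IsFast μ a}
  mul_mem' {a a'} h h' := by
    have := h.mul h'
    simpa [IsFast] using this
  one_mem' := by simpa [IsFast] using .const 1
  add_mem' {a a'} h h' := by
    have := h.add h'
    simpa [IsFast] using this
  zero_mem' := by simpa [IsFast] using .const 0
  neg_mem' {a} h := by
    have := h.const_mul (-1)
    simpa [IsFast] using this

theorem algebraMap_mem_fastSubring (x : ℝ) :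
    algebraMap ℝ (Coeff m n l) x ∈ fastSubring m n l μ := FastExpr.const (x : ℂ)

/-- The nonlinear part of the Taylor polynomial with given coefficients. -/
noncomputable def taylorPoly (p : ℕ) (c : Label m n l → ℝ) (κ : Idx m n l) :
    MvPolynomial (Idx m n l) (Coeff m n l) :=
  ∑ k ∈ Finset.Ico 2 p, ∑ s ∈ (Finset.univ : Finset (Idx m n l)).finsuppAntidiag k,
    monomial s fun b t => c (κ, s) + b (κ, s) t

theorem taylorPoly_mem_coeffSubring (p : ℕ) (c : Label m n l → ℝ) (κ : Idx m n l) :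
    taylorPoly p c κ ∈ coeffSubring (fastSubring m n l μ) := by
  refine Subring.sum_mem _ fun k _ => Subring.sum_mem _ fun s _ => fun s' => ?_
  rw [coeff_monomial]
  split_ifs
  · have := (FastExpr.const (m := m) (n := n) (l := l) (μ := μ) (c (κ, s))).add
      ((FastExpr.forcing (κ, s)).of_le zero_le_one)
    simpa [fastSubring, IsFast] using this
  · exact Subring.zero_mem _

theorem taylorPoly_mem_pow (p : ℕ) (c : Label m n l → ℝ) (κ : Idx m n l) :
    taylorPoly p c κ ∈ idealOfVars (Idx m n l) (Coeff m n l) ^ 2 := by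
  refine Ideal.sum_mem _ fun k hk => Ideal.sum_mem _ fun s hs => ?_
  refine Ideal.pow_le_pow_right (Finset.mem_Ico.1 hk).1 (isHomogeneous_mem_pow_idealOfVars ?_)
  exact isHomogeneous_monomial _ (mem_finsuppAntidiag_univ.1 hs)

/-- The residual of `u' = L u + f(u)` upon substituting `u = T(t, U)` and `U' = L U + q(t, U)`, where
`T'` is the time derivative of `T`. -/
noncomputable def residual {σ R : Type*} [Fintype σ] [CommRing R] (L : Matrix σ σ R)
    (f T T' q : σ → MvPolynomial σ R) (κ : σ) : MvPolynomial σ R :=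
  T' κ + homOp L T κ + ∑ i, pderiv i (T κ) * q i - bind₁ T (f κ)

theorem homOp_mem_coeffSubring {σ R : Type*} [Fintype σ] [CommRing R] {S : Subring R}
    {L : Matrix σ σ R} (hL : ∀ i j, L i j ∈ S) {ξ : σ → MvPolynomial σ R}
    (hξ : ∀ κ, ξ κ ∈ coeffSubring S) (κ : σ) : homOp L ξ κ ∈ coeffSubring S := by
  rw [homOp_apply, linDerivation_apply]
  refine Subring.sub_mem _ (Subring.sum_mem _ fun i _ => Subring.mul_mem _ ?_ ?_)
    (Subring.sum_mem _ fun κ' _ => Subring.mul_mem _ (C_mem_coeffSubring (hL _ _)) (hξ κ'))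
  · exact Subring.sum_mem _ fun j _ =>
      Subring.mul_mem _ (C_mem_coeffSubring (hL _ _)) (X_mem_coeffSubring j)
  · exact pderiv_mem_coeffSubring (hξ κ) i

/-- Differentiation lowers the order by one and the linear form restores it. -/
theorem homOp_mem_pow {σ R : Type*} [Fintype σ] [CommRing R]
    (L : Matrix σ σ R) {ξ : σ → MvPolynomial σ R} {k : ℕ}
    (hξ : ∀ κ, ξ κ ∈ idealOfVars σ R ^ (k + 1)) (κ : σ) :
    homOp L ξ κ ∈ idealOfVars σ R ^ (k + 1) := by
  rw [homOp_apply, linDerivation_apply]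
  refine Ideal.sub_mem _ (Ideal.sum_mem _ fun i _ => ?_)
    (Ideal.sum_mem _ fun κ' _ => Ideal.mul_mem_left _ _ (hξ κ'))
  rw [pow_succ, mul_comm (linForm L i)]
  refine Ideal.mul_mem_mul (pderiv_mem_pow_idealOfVars (hξ κ) i) (Ideal.sum_mem _ fun j _ =>
    Ideal.mul_mem_left _ _ ?_)
  exact Ideal.subset_span ⟨j, rfl⟩

/-- A near identity transform `T` to a formal normal form `U' = L U + q`, accurate up to
order `k`. -/
structure FormalNormalForm (μ : ℝ) (A : Matrix (Fin m) (Fin m) ℝ) (B : Matrix (Fin n) (Fin n) ℝ)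
    (C : Matrix (Fin l) (Fin l) ℝ) (p : ℕ) (c : Label m n l → ℝ) (k : ℕ)
    (T T' q : Idx m n l → MvPolynomial (Idx m n l) (Coeff m n l)) : Prop where
  nearIdentity : ∀ κ, T κ - X κ ∈ idealOfVars (Idx m n l) (Coeff m n l) ^ 2
  fast : FastDerivative μ T T'
  nonlinear : ∀ κ, q κ ∈ idealOfVars (Idx m n l) (Coeff m n l) ^ 2
  memory : ∀ κ s, MemoryOnlyQuadratic μ (coeff s (q κ))
  retained : ∀ κ s, coeff s (q κ) ≠ 0 →
    Retained (blockWeight κ) (Finsupp.weight blockWeight s)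
  residual_mem : ∀ κ, residual (constMatrix A B C) (taylorPoly p c) T T' q κ ∈
    idealOfVars (Idx m n l) (Coeff m n l) ^ k

variable {A : Matrix (Fin m) (Fin m) ℝ} {B : Matrix (Fin n) (Fin n) ℝ}
  {C : Matrix (Fin l) (Fin l) ℝ} {p : ℕ} {c : Label m n l → ℝ}

/-- The identity commutes with the linear flow, so its residual is minus the Taylor polynomial,
which has order two. -/
theorem FormalNormalForm.init [Nonempty (Idx m n l)] :
    FormalNormalForm μ A B C p c 2 X 0 0 where
  nearIdentity κ := by simp
  fast κ s := by
    classical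
    refine ⟨X_mem_coeffSubring (S := fastSubring m n l μ) κ s,
      Subring.zero_mem (coeffSubring (fastSubring m n l μ)) s, fun b t => ?_⟩
    rw [coeff_X]
    split_ifs
    · exact (hasDerivAt_const t (1 : ℝ)).congr_deriv (by simp)
    · exact (hasDerivAt_const t (0 : ℝ)).congr_deriv (by simp)
  nonlinear κ := by simp
  memory κ s := by simpa using MemoryOnlyQuadratic.zero
  retained κ s := by simp
  residual_mem κ := by
    have h : homOp (constMatrix A B C) X κ = 0 := by
      classical
      rw [homOp_apply, linDerivation_apply, Finset.sum_eq_single κ]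
      · simp [linForm]
      · intro i _ hi
        rw [pderiv_X_of_ne hi.symm, mul_zero]
      · simp
    rw [residual, h]
    simpa using taylorPoly_mem_pow p c κ

theorem FormalNormalForm.mem_idealOfVars {k : ℕ}
    {T T' q : Idx m n l → MvPolynomial (Idx m n l) (Coeff m n l)}
    (h : FormalNormalForm μ A B C p c k T T' q) (κ : Idx m n l) :
    T κ ∈ idealOfVars (Idx m n l) (Coeff m n l) := by
  have h₁ := Ideal.pow_le_self two_ne_zero (h.nearIdentity κ)
  have h₂ : (X κ : MvPolynomial (Idx m n l) (Coeff m n l)) ∈ idealOfVars _ _ :=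
    Ideal.subset_span ⟨κ, rfl⟩
  simpa using Ideal.add_mem _ h₁ h₂

theorem FormalNormalForm.isFast_residual {k : ℕ}
    {T T' q : Idx m n l → MvPolynomial (Idx m n l) (Coeff m n l)}
    (h : FormalNormalForm μ A B C p c k T T' q) (κ : Idx m n l) (s : Idx m n l →₀ ℕ) :
    IsFast μ (coeff s (residual (constMatrix A B C) (taylorPoly p c) T T' q κ)) := by
  have hT : ∀ κ, T κ ∈ coeffSubring (fastSubring m n l μ) := fun κ s => (h.fast κ s).1
  have hT' : T' κ ∈ coeffSubring (fastSubring m n l μ) := fun s => (h.fast κ s).2.1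
  have hq : ∀ κ, q κ ∈ coeffSubring (fastSubring m n l μ) := fun κ s => (h.memory κ s).isFast
  refine (?_ : residual _ _ T T' q κ ∈ coeffSubring (fastSubring m n l μ)) s
  refine Subring.sub_mem _ (Subring.add_mem _ (Subring.add_mem _ hT' ?_) ?_)
    (bind₁_mem_coeffSubring (taylorPoly_mem_coeffSubring p c κ) hT)
  · exact homOp_mem_coeffSubring (fun i j => algebraMap_mem_fastSubring _) hT κ
  · exact Subring.sum_mem _ fun i _ =>
      Subring.mul_mem _ (pderiv_mem_coeffSubring (hT κ) i) (hq i)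

/-- The correction solves the homological equation against the degree-`k` part of the residual. All
interactions of the correction with nonlinear terms have order at least `k + 1`. -/
theorem FormalNormalForm.step [Nonempty (Idx m n l)] {α β : ℝ} {P : ℕ}
    (hgap : SpectralGap A B C α β μ P) {k : ℕ} (hk : 2 ≤ k) (hkP : k < P)
    {T T' q : Idx m n l → MvPolynomial (Idx m n l) (Coeff m n l)}
    (h : FormalNormalForm μ A B C p c k T T' q) :
    ∃ S S' r, FormalNormalForm μ A B C p c (k + 1) S S' r := by
  obtain ⟨ξ, ξ', r, hξ, hξ', hr, hd, hm, hret, e⟩ := exists_homogeneous_solution hgap hkP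
    (fun κ s => -coeff s (residual (constMatrix A B C) (taylorPoly p c) T T' q κ))
    (fun κ s => Subring.neg_mem (fastSubring m n l μ) (h.isFast_residual κ s))
  have hξk := fun κ => isHomogeneous_mem_pow_idealOfVars (hξ κ)
  have hξk' := fun κ => isHomogeneous_mem_pow_idealOfVars (hξ' κ)
  have hrk := fun κ => isHomogeneous_mem_pow_idealOfVars (hr κ)
  obtain ⟨j, rfl⟩ : ∃ j, k = j + 1 := ⟨k - 1, by omega⟩
  refine ⟨T + ξ, T' + ξ', q + r, fun κ => ?_, fun κ s => ?_, fun κ => ?_, fun κ s => ?_,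
    fun κ s hs => ?_, fun κ => ?_⟩
  · have := Ideal.add_mem _ (h.nearIdentity κ) (Ideal.pow_le_pow_right hk (hξk κ))
    convert this using 1
    simp only [Pi.add_apply]; ring
  · obtain ⟨h₁, h₂, h₃⟩ := h.fast κ s
    obtain ⟨h₁', h₂', h₃'⟩ := hd κ s
    simp only [Pi.add_apply, coeff_add]
    exact ⟨Subring.add_mem (fastSubring m n l μ) h₁ h₁',
      Subring.add_mem (fastSubring m n l μ) h₂ h₂', fun b t => (h₃ b t).add (h₃' b t)⟩
  · exact Ideal.add_mem _ (h.nonlinear κ) (Ideal.pow_le_pow_right hk (hrk κ))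
  · rw [Pi.add_apply, coeff_add]
    exact (h.memory κ s).add (hm κ s)
  · by_cases h0 : coeff s (q κ) = 0
    · refine hret κ s ?_
      simpa [h0] using hs
    · exact h.retained κ s h0
  · have hmain : residual (constMatrix A B C) (taylorPoly p c) T T' q κ +
        (ξ' κ + homOp (constMatrix A B C) ξ κ + r κ) ∈
        idealOfVars (Idx m n l) (Coeff m n l) ^ (j + 1 + 1) := by
      rw [mem_pow_idealOfVars_iff']
      intro s hs
      rcases (Nat.lt_succ_iff.1 hs).lt_or_eq with hlt | heq
      · have := Ideal.add_mem _ (h.residual_mem κ) (Ideal.add_mem _ (Ideal.add_mem _ (hξk' κ)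
          (homOp_mem_pow (constMatrix A B C) hξk κ)) (hrk κ))
        exact (mem_pow_idealOfVars_iff' _ _).1 this s hlt
      · rw [coeff_add, e κ s heq, add_neg_cancel]
    -- With `k = j + 1` the orders are `(k - 1) + 2` here and `1 + k` in `h₂`; both suffice since `k
    -- ≥ 2`.
    have h₁ : ∑ i, pderiv i (ξ κ) * (q i + r i) ∈
        idealOfVars (Idx m n l) (Coeff m n l) ^ (j + 1 + 1) := by
      refine Ideal.sum_mem _ fun i _ => ?_
      have := Ideal.mul_mem_mul (pderiv_mem_pow_idealOfVars (hξk κ) i)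
        (Ideal.add_mem _ (h.nonlinear i) (Ideal.pow_le_pow_right hk (hrk i)))
      rwa [← pow_add] at this
    have h₂ : ∑ i, pderiv i (T κ - X κ) * r i ∈
        idealOfVars (Idx m n l) (Coeff m n l) ^ (j + 1 + 1) := by
      refine Ideal.sum_mem _ fun i _ => ?_
      have := Ideal.mul_mem_mul (pderiv_mem_pow_idealOfVars (k := 1) (h.nearIdentity κ) i)
        (hrk i)
      rw [← pow_add] at this
      exact Ideal.pow_le_pow_right (by omega) this
    have h₃ := bind₁_add_sub_mem_pow (by omega) h.mem_idealOfVars hξk (taylorPoly_mem_pow p c κ)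
    have h₄ : ∑ i, pderiv i (X κ : MvPolynomial (Idx m n l) (Coeff m n l)) * r i = r κ := by
      rw [Finset.sum_eq_single κ]
      · simp
      · intro i _ hi
        rw [pderiv_X_of_ne hi.symm, zero_mul]
      · simp
    convert Ideal.sub_mem _ (Ideal.add_mem _ (Ideal.add_mem _ hmain h₁) h₂) h₃ using 1
    simp only [residual, map_add, map_sub, Pi.add_apply, sub_mul, mul_add, add_mul,
      Finset.sum_add_distrib, Finset.sum_sub_distrib, h₄]
    ring

theorem exists_formalNormalForm {α β : ℝ} {P : ℕ}
    (hgap : SpectralGap A B C α β μ P) (c : Label m n l → ℝ) (hp : 2 ≤ p) (hpP : p ≤ P) :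
    ∃ T T' q, FormalNormalForm μ A B C p c p T T' q := by
  rcases isEmpty_or_nonempty (Idx m n l) with hE | hE
  -- Without state variables there are no labels, hence no zero of degree two, but all conditions
  -- are vacuous.
  · exact ⟨X, 0, 0, isEmptyElim, isEmptyElim, isEmptyElim, isEmptyElim, isEmptyElim, isEmptyElim⟩
  have h : ∀ k, 2 ≤ k → k ≤ P → ∃ T T' q, FormalNormalForm μ A B C p c k T T' q := by
    intro k hk
    induction k, hk using Nat.le_induction with
    | base => exact fun _ => ⟨_, _, _, .init⟩
    | succ k hk ih =>
      intro hkP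
      obtain ⟨T, T', q, h⟩ := ih (by omega)
      exact h.step hgap hk (by omega)
  exact h p hp hpP

end FormalNormalForm

/-! ### Splitting polynomials by support and factoring out variables -/

section Factoring

variable {σ R : Type*} [CommRing R]

theorem exists_restrict_support (p : MvPolynomial σ R) (S : (σ →₀ ℕ) → Prop) :
    ∃ q q' : MvPolynomial σ R, p = q + q' ∧ (∀ s, S s → coeff s q = coeff s p ∧ coeff s q' = 0) ∧
      ∀ s, ¬ S s → coeff s q = 0 ∧ coeff s q' = coeff s p := by
  classical
  have h : ∀ s, coeff s (∑ s ∈ p.support with S s, monomial s (coeff s p)) =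
      if S s then coeff s p else 0 := by
    intro s
    simp only [coeff_sum, coeff_monomial, Finset.sum_ite_eq', Finset.mem_filter, mem_support_iff]
    split_ifs <;> grind
  refine ⟨_, p - ∑ s ∈ p.support with S s, monomial s (coeff s p), (add_sub_cancel _ _).symm,
    fun s hs => ?_, fun s hs => ?_⟩
  · rw [coeff_sub, h, if_pos hs]
    simp
  · rw [coeff_sub, h, if_neg hs]
    simp

/-- A polynomial each of whose monomials contains one of the variables `X (ι j)` is a combination
of these variables, with coefficient polynomials whose coefficients are those of `p` or zero. -/
theorem exists_factor {J : Type*} [Fintype J] (ι : J → σ) (p : MvPolynomial σ R)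
    (hp : ∀ s, coeff s p ≠ 0 → ∃ j, s (ι j) ≠ 0) :
    ∃ g : J → MvPolynomial σ R, p = ∑ j, g j * X (ι j) ∧
      ∀ j s, coeff s (g j) = coeff (s + Finsupp.single (ι j) 1) p ∨ coeff s (g j) = 0 := by
  classical
  have hp' : ∀ s : p.support, ∃ j, (s : σ →₀ ℕ) (ι j) ≠ 0 := fun s =>
    hp s (mem_support_iff.1 s.2)
  -- Each monomial is charged to a single variable that it contains. No two monomials are then
  -- merged, so the coefficients of the factors are coefficients of `p`, unchanged, or zero.
  choose ch hch using hp'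
  refine ⟨fun j => ∑ s : p.support, if ch s = j then
    monomial ((s : σ →₀ ℕ) - Finsupp.single (ι j) 1) (coeff (s : σ →₀ ℕ) p) else 0, ?_, ?_⟩
  · have e : ∀ s : p.support, ∑ j, (if ch s = j then
        monomial ((s : σ →₀ ℕ) - Finsupp.single (ι j) 1) (coeff (s : σ →₀ ℕ) p) else 0) * X (ι j) =
        monomial (s : σ →₀ ℕ) (coeff (s : σ →₀ ℕ) p) := by
      intro s
      rw [Finset.sum_eq_single (ch s)]
      · rw [if_pos rfl, X, monomial_mul, mul_one, tsub_add_cancel_of_le]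
        rw [Finsupp.single_le_iff]
        exact Nat.one_le_iff_ne_zero.2 (hch s)
      · intro j _ hj
        rw [if_neg hj.symm, zero_mul]
      · simp
    simp only [Finset.sum_mul]
    rw [Finset.sum_comm]
    simp only [e]
    rw [Finset.sum_coe_sort p.support fun s => monomial s (coeff s p)]
    exact p.as_sum
  · intro j s
    have hs : ∀ s' : p.support, coeff s (if ch s' = j then
        monomial ((s' : σ →₀ ℕ) - Finsupp.single (ι j) 1) (coeff (s' : σ →₀ ℕ) p) else 0) =
        if ch s' = j ∧ (s' : σ →₀ ℕ) = s + Finsupp.single (ι j) 1 then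
          coeff (s + Finsupp.single (ι j) 1) p else 0 := by
      intro s'
      by_cases h : ch s' = j
      · have hle : Finsupp.single (ι j) 1 ≤ (s' : σ →₀ ℕ) := by
          rw [Finsupp.single_le_iff]
          exact Nat.one_le_iff_ne_zero.2 (h ▸ hch s')
        rw [if_pos h, coeff_monomial]
        by_cases h' : (s' : σ →₀ ℕ) = s + Finsupp.single (ι j) 1
        · rw [if_pos (by rw [h', add_tsub_cancel_right]), if_pos ⟨h, h'⟩, h']
        · rw [if_neg fun h0 => h' (by rw [← h0, tsub_add_cancel_of_le hle]), if_neg fun h0 => h' h0.2]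
      · rw [if_neg h, if_neg fun h0 => h h0.1, coeff_zero]
    rw [coeff_sum]
    simp only [hs]
    by_cases h : ∃ s' : p.support, ch s' = j ∧ (s' : σ →₀ ℕ) = s + Finsupp.single (ι j) 1
    · obtain ⟨s', hs'⟩ := h
      left
      rw [Finset.sum_eq_single s', if_pos hs']
      · intro s'' _ hne
        rw [if_neg]
        exact fun h0 => hne (Subtype.ext (h0.2.trans hs'.2.symm))
      · simp
    · right
      refine Finset.sum_eq_zero fun s' _ => if_neg fun h0 => h ⟨s', h0⟩

end Factoring

/-! ### Evaluation at a given forcing, time and state -/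

section Evaluation

variable {m n l : ℕ}

/-- The value of a coefficient. -/
def evalCoeff (b : Forcing m n l) (t : ℝ) : Coeff m n l →+* ℝ :=
  (Pi.evalRingHom (fun _ : ℝ => ℝ) t).comp (Pi.evalRingHom (fun _ : Forcing m n l => ℝ → ℝ) b)

theorem evalCoeff_apply (b : Forcing m n l) (t : ℝ) (a : Coeff m n l) :
    evalCoeff b t a = a b t := rfl

variable {σ : Type}

theorem evalAt_eq (b : Forcing m n l) (t : ℝ) (u : σ → ℝ) (q : MvPolynomial σ (Coeff m n l)) :
    evalAt b t u q = eval₂Hom (evalCoeff b t) u q := rfl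

theorem evalAt_linForm (A : Matrix (Fin m) (Fin m) ℝ) (B : Matrix (Fin n) (Fin n) ℝ)
    (C : Matrix (Fin l) (Fin l) ℝ) (b : Forcing m n l) (t : ℝ) (U : State m n l)
    (κ : Idx m n l) :
    evalAt b t U (linForm (constMatrix A B C) κ) = linearPart A B C U κ := by
  simp only [evalAt_eq, linForm, map_sum, map_mul, eval₂Hom_C, eval₂Hom_X', constMatrix,
    Matrix.map_apply, evalCoeff_apply, Pi.algebraMap_apply, Algebra.algebraMap_self_apply]
  rcases κ with i | i | i <;>
    simp [linearPart, glue, stateMatrix, Fintype.sum_sum_type, Matrix.mulVec, dotProduct, xPart,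
      yPart, zPart]

end Evaluation

/-! ### From retained terms to the block structure of the normal form -/

section NormalForms

variable {m n l : ℕ} {μ : ℝ}

theorem weight_blockWeight_stable (s : Idx m n l →₀ ℕ) :
    (Finsupp.weight blockWeight s).2.1 ≠ 0 ↔ ∃ j, s (Sum.inr (Sum.inl j)) ≠ 0 := by
  have h : (Finsupp.weight blockWeight s).2.1 = ∑ j, (s (Sum.inr (Sum.inl j)) : ℤ) := by
    rw [Finsupp.weight_apply, Finsupp.sum_fintype _ _ (by simp), Prod.snd_sum, Prod.fst_sum]
    simp [Fintype.sum_sum_type, blockWeight]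
  rw [h, ne_eq, Finset.sum_eq_zero_iff_of_nonneg (by intros; positivity)]
  simp

theorem weight_blockWeight_unstable (s : Idx m n l →₀ ℕ) :
    (Finsupp.weight blockWeight s).2.2 ≠ 0 ↔ ∃ j, s (Sum.inr (Sum.inr j)) ≠ 0 := by
  have h : (Finsupp.weight blockWeight s).2.2 = ∑ j, (s (Sum.inr (Sum.inr j)) : ℤ) := by
    rw [Finsupp.weight_apply, Finsupp.sum_fintype _ _ (by simp), Prod.snd_sum, Prod.snd_sum]
    simp [Fintype.sum_sum_type, blockWeight]
  rw [h, ne_eq, Finset.sum_eq_zero_iff_of_nonneg (by intros; positivity)]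
  simp

/-- A retained centre term contains stable variables exactly when it contains unstable ones. The
terms without stable variables are thus polynomials in the centre variables alone, and from each of
the others both a stable and an unstable variable can be factored out. -/
theorem exists_centre_normalForm {q : MvPolynomial (Idx m n l) (Coeff m n l)}
    (hnl : q ∈ idealOfVars (Idx m n l) (Coeff m n l) ^ 2)
    (hm : ∀ s, MemoryOnlyQuadratic μ (coeff s q))
    (hret : ∀ s, coeff s q ≠ 0 → Retained (1, 0, 0) (Finsupp.weight blockWeight s))
    (hz : MemoryOnlyQuadratic μ (0 : Coeff m n l)) :
    ∃ (Fc : MvPolynomial (Fin m) (Coeff m n l))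
      (F : Fin n → Fin l → MvPolynomial (Idx m n l) (Coeff m n l)),
      (∀ s, Finsupp.degree s < 2 → coeff s Fc = 0) ∧
      (∀ s, MemoryOnlyQuadratic μ (coeff s Fc)) ∧
      (∀ j k s, MemoryOnlyQuadratic μ (coeff s (F j k))) ∧
      q = rename Sum.inl Fc +
        ∑ j, (∑ k, F j k * X (Sum.inr (Sum.inr k))) * X (Sum.inr (Sum.inl j)) := by
  classical
  obtain ⟨q₁, q₂, hq, h₁, h₂⟩ := exists_restrict_support q
    fun s => (Finsupp.weight blockWeight s).2.1 = 0
  have hvars : (q₁.vars : Set (Idx m n l)) ⊆ Set.range Sum.inl := by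
    intro κ hκ
    obtain ⟨s, hs, hsκ⟩ := (mem_vars_iff_mem_support κ).1 (Finset.mem_coe.1 hκ)
    rw [mem_support_iff] at hs
    have hw : (Finsupp.weight blockWeight s).2.1 = 0 := by
      by_contra h
      exact hs (h₂ s h).1
    have hw' := ((hret s (by rwa [← (h₁ s hw).1])).1 rfl).1 hw
    have e₁ := (weight_blockWeight_stable s).not.1 (not_not.2 hw)
    have e₂ := (weight_blockWeight_unstable s).not.1 (not_not.2 hw')
    rw [Finsupp.mem_support_iff] at hsκ
    rcases κ with i | j | k
    · exact ⟨i, rfl⟩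
    · exact absurd ⟨j, hsκ⟩ e₁
    · exact absurd ⟨k, hsκ⟩ e₂
  obtain ⟨Fc, hFc⟩ := exists_rename_eq_of_vars_subset_range q₁ (Sum.inl : Fin m → Idx m n l)
    Sum.inl_injective hvars
  have hc : ∀ s, coeff s Fc = coeff (s.mapDomain Sum.inl) q₁ := fun s => by
    rw [← hFc, coeff_rename_mapDomain _ Sum.inl_injective]
  have hor : ∀ s, (coeff s q₁ = coeff s q ∨ coeff s q₁ = 0) ∧
      (coeff s q₂ = coeff s q ∨ coeff s q₂ = 0) := by
    intro s
    by_cases h : (Finsupp.weight blockWeight s).2.1 = 0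
    · exact ⟨Or.inl (h₁ s h).1, Or.inr (h₁ s h).2⟩
    · exact ⟨Or.inr (h₂ s h).1, Or.inl (h₂ s h).2⟩
  have hs₂ : ∀ s, coeff s q₂ ≠ 0 → (Finsupp.weight blockWeight s).2.1 ≠ 0 ∧
      (Finsupp.weight blockWeight s).2.2 ≠ 0 := by
    intro s hs
    have hw : (Finsupp.weight blockWeight s).2.1 ≠ 0 := fun h => hs (h₁ s h).2
    refine ⟨hw, fun h => hw (((hret s ?_).1 rfl).2 h)⟩
    rwa [← (h₂ s hw).2]
  obtain ⟨g, hg, hgc⟩ := exists_factor (fun j : Fin n => (Sum.inr (Sum.inl j) : Idx m n l)) q₂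
    fun s hs => (weight_blockWeight_stable s).1 (hs₂ s hs).1
  have hF : ∀ j, ∃ f : Fin l → MvPolynomial (Idx m n l) (Coeff m n l),
      g j = ∑ k, f k * X (Sum.inr (Sum.inr k)) ∧ ∀ k s,
        coeff s (f k) = coeff (s + Finsupp.single (Sum.inr (Sum.inr k)) 1) (g j) ∨
          coeff s (f k) = 0 := by
    intro j
    refine exists_factor (fun k : Fin l => (Sum.inr (Sum.inr k) : Idx m n l)) (g j) fun s hs => ?_
    rw [(hgc j s).resolve_right hs] at hs
    obtain ⟨k, hk⟩ := (weight_blockWeight_unstable _).1 (hs₂ _ hs).2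
    exact ⟨k, by simpa using hk⟩
  choose F hF hFs using hF
  refine ⟨Fc, F, fun s hs => ?_, fun s => ?_, fun j k s => ?_, ?_⟩
  · rw [hc]
    rcases (hor (s.mapDomain Sum.inl)).1 with h | h
    · rw [h]
      refine (mem_pow_idealOfVars_iff' _ _).1 hnl _ ?_
      rwa [Finsupp.degree_mapDomain]
    · exact h
  · rw [hc]
    rcases (hor (s.mapDomain Sum.inl)).1 with h | h <;> rw [h]
    exacts [hm _, hz]
  · rcases hFs j k s with h | h <;> rw [h]
    · rcases hgc j (s + Finsupp.single (Sum.inr (Sum.inr k)) 1) with h | h <;> rw [h]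
      · rcases (hor (s + Finsupp.single (Sum.inr (Sum.inr k)) 1 +
          Finsupp.single (Sum.inr (Sum.inl j)) 1)).2 with h | h <;> rw [h]
        exacts [hm _, hz]
      · exact hz
    · exact hz
  · rw [hq, hFc, hg]
    simp only [← hF]

/-- The constant term of `G j` is either zero or a degree-one coefficient of `q`, and the latter
vanishes too. -/
theorem exists_hyperbolic_normalForm {J : Type*} [Fintype J] (ι : J → Idx m n l)
    {q : MvPolynomial (Idx m n l) (Coeff m n l)}
    (hnl : q ∈ idealOfVars (Idx m n l) (Coeff m n l) ^ 2)
    (hm : ∀ s, MemoryOnlyQuadratic μ (coeff s q))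
    (hret : ∀ s, coeff s q ≠ 0 → ∃ j, s (ι j) ≠ 0)
    (hz : MemoryOnlyQuadratic μ (0 : Coeff m n l)) :
    ∃ G : J → MvPolynomial (Idx m n l) (Coeff m n l), (∀ j, constantCoeff (G j) = 0) ∧
      (∀ j s, MemoryOnlyQuadratic μ (coeff s (G j))) ∧ q = ∑ j, G j * X (ι j) := by
  obtain ⟨g, hg, hgc⟩ := exists_factor ι q hret
  refine ⟨g, fun j => ?_, fun j s => ?_, hg⟩
  · rw [constantCoeff_eq]
    rcases hgc j 0 with h | h
    · rw [h]
      exact (mem_pow_idealOfVars_iff' _ _).1 hnl _ (by simp)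
    · exact h
  · rcases hgc j s with h | h <;> rw [h]
    exacts [hm _, hz]

theorem exists_normalForm (A : Matrix (Fin m) (Fin m) ℝ) (B : Matrix (Fin n) (Fin n) ℝ)
    (C : Matrix (Fin l) (Fin l) ℝ) {q : Idx m n l → MvPolynomial (Idx m n l) (Coeff m n l)}
    (hnl : ∀ κ, q κ ∈ idealOfVars (Idx m n l) (Coeff m n l) ^ 2)
    (hm : ∀ κ s, MemoryOnlyQuadratic μ (coeff s (q κ)))
    (hret : ∀ κ s, coeff s (q κ) ≠ 0 → Retained (blockWeight κ) (Finsupp.weight blockWeight s)) :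
    ∃ Q : NormalForm m n l, Q.StrictlyNonlinear ∧ Q.MemoryOnlyQuadratic μ ∧
      ∀ b t U κ, Q.field A B C b t U κ =
        evalAt b t U (linForm (constMatrix A B C) κ + q κ) := by
  -- Zero counts as a memory coefficient only when a label exists; any component provides one.
  have hz : ∀ κ : Idx m n l, MemoryOnlyQuadratic μ (0 : Coeff m n l) := fun κ =>
    haveI : Nonempty (Idx m n l) := ⟨κ⟩
    .zero
  choose Fc F h₁ h₂ h₃ h₄ using fun i : Fin m => exists_centre_normalForm (hnl (Sum.inl i))
    (hm (Sum.inl i)) (hret (Sum.inl i)) (hz (Sum.inl i))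
  choose G hG hG' hG'' using fun i : Fin n => exists_hyperbolic_normalForm
    (fun j : Fin n => (Sum.inr (Sum.inl j) : Idx m n l)) (hnl (Sum.inr (Sum.inl i)))
    (hm (Sum.inr (Sum.inl i)))
    (fun s hs => (weight_blockWeight_stable s).1 ((hret _ s hs).2.1 rfl)) (hz (Sum.inr (Sum.inl i)))
  choose H hH hH' hH'' using fun i : Fin l => exists_hyperbolic_normalForm
    (fun j : Fin l => (Sum.inr (Sum.inr j) : Idx m n l)) (hnl (Sum.inr (Sum.inr i)))
    (hm (Sum.inr (Sum.inr i)))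
    (fun s hs => (weight_blockWeight_unstable s).1 ((hret _ s hs).2.2 rfl))
    (hz (Sum.inr (Sum.inr i)))
  refine ⟨⟨Fc, F, G, H⟩, ⟨h₁, hG, hH⟩, ⟨h₂, h₃, hG', hH'⟩, fun b t U κ => ?_⟩
  have hadd : evalAt b t U (linForm (constMatrix A B C) κ + q κ) =
      linearPart A B C U κ + evalAt b t U (q κ) := by
    rw [← evalAt_linForm A B C b t U κ]
    simp only [evalAt_eq, map_add]
  rw [hadd]
  rcases κ with i | i | i
  · rw [h₄ i]
    simp only [evalAt_eq, map_add, map_sum, map_mul, eval₂Hom_X', eval₂Hom_rename, NormalForm.field,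
      linearPart, glue, Sum.elim_inl, Finset.sum_mul, add_assoc]
    congr 2
    refine Finset.sum_congr rfl fun j _ => Finset.sum_congr rfl fun k _ => ?_
    simp only [yPart, zPart]
    ring
  · rw [hG'' i]
    simp only [evalAt_eq, map_sum, map_mul, eval₂Hom_X', NormalForm.field,
      linearPart, glue, Sum.elim_inl, Sum.elim_inr, Matrix.add_mulVec, Pi.add_apply]
    rfl
  · rw [hH'' i]
    simp only [evalAt_eq, map_sum, map_mul, eval₂Hom_X', NormalForm.field,
      linearPart, glue, Sum.elim_inr, Matrix.add_mulVec, Pi.add_apply]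
    rfl

end NormalForms

/-! ### Taylor's formula along rays -/

section Taylor

variable {E : Type*} [NormedAddCommGroup E] [NormedSpace ℝ E]

theorem iteratedDerivWithin_comp_smul {f : E → ℝ} {d : Set E} (hd : IsOpen d) {P k : ℕ}
    (hf : ContDiffOn ℝ P f d) (hk : k ≤ P) {u : E} (hu : ∀ x ∈ Set.Icc (0 : ℝ) 1, x • u ∈ d)
    {x : ℝ} (hx : x ∈ Set.Icc (0 : ℝ) 1) :
    iteratedDerivWithin k (fun s : ℝ => f (s • u)) (Set.Icc 0 1) x =
      iteratedFDeriv ℝ k f (x • u) fun _ => u := by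
  have hg : (fun s : ℝ => f (s • u)) = f ∘ (ContinuousLinearMap.toSpanSingleton ℝ u) := by
    ext s; simp
  have hopen : IsOpen ((ContinuousLinearMap.toSpanSingleton ℝ u) ⁻¹' d) :=
    hd.preimage (ContinuousLinearMap.continuous _)
  have hxd : (ContinuousLinearMap.toSpanSingleton ℝ u) x ∈ d := by simpa using hu x hx
  have hat : ContDiffAt ℝ k (f ∘ (ContinuousLinearMap.toSpanSingleton ℝ u)) x := by
    refine ContDiffAt.comp x ?_ (ContinuousLinearMap.contDiff _).contDiffAt
    exact (hf.contDiffAt (hd.mem_nhds hxd)).of_le (by exact_mod_cast hk)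
  rw [hg, iteratedDerivWithin_eq_iteratedDeriv (uniqueDiffOn_Icc zero_lt_one) hat hx,
    iteratedDeriv_eq_iteratedFDeriv, ← iteratedFDerivWithin_of_isOpen k hopen hxd,
    ContinuousLinearMap.iteratedFDerivWithin_comp_right _ hf hd.uniqueDiffOn hopen.uniqueDiffOn hxd
      (by exact_mod_cast hk), iteratedFDerivWithin_of_isOpen k hd hxd]
  simp

/-- Taylor's formula in one variable for `s ↦ f (s • u)` on `[0, 1]`, whose derivatives are the
iterated derivatives of `f` evaluated on the diagonal `u`. The factor `1 / n!` is estimated by one.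
-/
theorem norm_sub_taylor_le {f : E → ℝ} {δ K : ℝ} {P n : ℕ}
    (hf : ContDiffOn ℝ P f (Metric.ball 0 δ)) (hn : n + 1 ≤ P)
    (hK : ∀ v ∈ Metric.ball (0 : E) δ, ‖iteratedFDeriv ℝ (n + 1) f v‖ ≤ K) {u : E}
    (hu : u ∈ Metric.ball (0 : E) δ) :
    |f u - ∑ k ∈ Finset.range (n + 1),
      ((k.factorial : ℝ))⁻¹ * iteratedFDeriv ℝ k f 0 fun _ => u| ≤ K * ‖u‖ ^ (n + 1) := by
  have hmem : ∀ x ∈ Set.Icc (0 : ℝ) 1, x • u ∈ Metric.ball (0 : E) δ := by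
    intro x hx
    rw [mem_ball_zero_iff] at hu ⊢
    rw [norm_smul, Real.norm_of_nonneg hx.1]
    exact lt_of_le_of_lt (mul_le_of_le_one_left (norm_nonneg u) hx.2) hu
  have hK0 : 0 ≤ K := (norm_nonneg _).trans (hK u hu)
  have hcont : ContDiffOn ℝ (n + 1) (fun s : ℝ => f (s • u)) (Set.Icc 0 1) := by
    refine ContDiffOn.comp (hf.of_le (by exact_mod_cast hn)) ?_ hmem
    exact (contDiff_id.smul contDiff_const).contDiffOn
  have h := taylor_mean_remainder_bound zero_le_one hcont (Set.right_mem_Icc.2 zero_le_one)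
    (C := K * ‖u‖ ^ (n + 1)) (fun y hy => by
      rw [iteratedDerivWithin_comp_smul Metric.isOpen_ball hf hn hmem hy]
      refine (ContinuousMultilinearMap.le_opNorm _ _).trans ?_
      rw [Finset.prod_const, Finset.card_univ, Fintype.card_fin]
      gcongr
      exact hK _ (hmem y hy))
  have e : taylorWithinEval (fun s : ℝ => f (s • u)) n (Set.Icc 0 1) 0 1 =
      ∑ k ∈ Finset.range (n + 1),
        ((k.factorial : ℝ))⁻¹ * iteratedFDeriv ℝ k f 0 fun _ => u := by
    rw [taylor_within_apply]
    refine Finset.sum_congr rfl fun k hk => ?_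
    rw [iteratedDerivWithin_comp_smul Metric.isOpen_ball hf
      ((Finset.mem_range.1 hk).le.trans hn) hmem (Set.left_mem_Icc.2 zero_le_one)]
    simp
  rw [e, one_smul, Real.norm_eq_abs] at h
  refine h.trans ?_
  rw [sub_zero, one_pow, mul_one]
  refine div_le_self (by positivity) ?_
  exact_mod_cast Nat.one_le_iff_ne_zero.2 (Nat.factorial_ne_zero n)

end Taylor

/-! ### The order gauge, the norm and uniform order symbols -/

section Gauge

variable {m n l : ℕ}

theorem norm_eq_max_parts (u : State m n l) : ‖u‖ = max ‖xPart u‖ (max ‖yPart u‖ ‖zPart u‖) := by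
  apply le_antisymm
  · rw [pi_norm_le_iff_of_nonneg (by positivity)]
    rintro (i | i | i)
    · exact le_max_of_le_left (norm_le_pi_norm (xPart u) i)
    · exact le_max_of_le_right (le_max_of_le_left (norm_le_pi_norm (yPart u) i))
    · exact le_max_of_le_right (le_max_of_le_right (norm_le_pi_norm (zPart u) i))
  · refine max_le ?_ (max_le ?_ ?_) <;>
    · rw [pi_norm_le_iff_of_nonneg (norm_nonneg u)]
      exact fun i => norm_le_pi_norm u _

theorem norm_pow_le_orderGauge (p : ℕ) (u : State m n l) : ‖u‖ ^ p ≤ orderGauge p u := by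
  have hx : 0 ≤ ‖xPart u‖ ^ p := by positivity
  have hy : 0 ≤ ‖yPart u‖ ^ p := by positivity
  have hz : 0 ≤ ‖zPart u‖ ^ p := by positivity
  rw [norm_eq_max_parts, orderGauge]
  rcases max_choice ‖xPart u‖ (max ‖yPart u‖ ‖zPart u‖) with h | h
  · rw [h]; linarith
  · rcases max_choice ‖yPart u‖ ‖zPart u‖ with h' | h' <;> rw [h, h'] <;> linarith

theorem orderGauge_nonneg (p : ℕ) (u : State m n l) : 0 ≤ orderGauge p u :=
  le_trans (by positivity) (norm_pow_le_orderGauge p u)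

theorem orderGauge_le (p : ℕ) (u : State m n l) : orderGauge p u ≤ 3 * ‖u‖ ^ p := by
  have hx : ‖xPart u‖ ^ p ≤ ‖u‖ ^ p := by
    gcongr; rw [norm_eq_max_parts u]; exact le_max_left _ _
  have hy : ‖yPart u‖ ^ p ≤ ‖u‖ ^ p := by
    gcongr; rw [norm_eq_max_parts u]; exact le_max_of_le_right (le_max_left _ _)
  have hz : ‖zPart u‖ ^ p ≤ ‖u‖ ^ p := by
    gcongr; rw [norm_eq_max_parts u]; exact le_max_of_le_right (le_max_right _ _)
  rw [orderGauge]; linarith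

/-- Uniformity over `S` is spelled out as a single constant and a single radius for all times in
`S`. -/
theorem isBigO_principal_prod_nhds_iff {E F G : Type*} [NormedAddCommGroup E] [Norm F] [Norm G]
    {S : Set ℝ} {f : ℝ × E → F} {g : ℝ × E → G} :
    f =O[𝓟 S ×ˢ 𝓝 0] g ↔ ∃ K δ : ℝ, 0 < δ ∧ ∀ t ∈ S, ∀ u, ‖u‖ < δ →
      ‖f (t, u)‖ ≤ K * ‖g (t, u)‖ := by
  rw [isBigO_iff]
  refine exists_congr fun K => ?_
  rw [((hasBasis_principal S).prod Metric.nhds_basis_ball).eventually_iff]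
  constructor
  · rintro ⟨⟨_, δ⟩, ⟨_, hδ⟩, h⟩
    exact ⟨δ, hδ, fun t ht u hu => h ⟨ht, mem_ball_zero_iff.2 hu⟩⟩
  · rintro ⟨δ, hδ, h⟩
    exact ⟨⟨(), δ⟩, ⟨trivial, hδ⟩, fun q hq => h q.1 hq.1 q.2 (mem_ball_zero_iff.1 hq.2)⟩

end Gauge

/-! ### Taylor expansion of the nonlinearity -/

section NonlinearityExpansion

variable {m n l : ℕ}

theorem evalAt_taylorPoly (p : ℕ) (c : Label m n l → ℝ) (κ : Idx m n l) (b : Forcing m n l) (t : ℝ)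
    (u : State m n l) : evalAt b t u (taylorPoly p c κ) = ∑ k ∈ Finset.Ico 2 p,
      ∑ s ∈ (Finset.univ : Finset (Idx m n l)).finsuppAntidiag k,
        (c (κ, s) + b (κ, s) t) * ∏ i, u i ^ s i := by
  simp only [evalAt_eq, taylorPoly, map_sum]
  refine Finset.sum_congr rfl fun k _ => Finset.sum_congr rfl fun s _ => ?_
  rw [eval₂Hom_monomial, evalCoeff_apply, Finsupp.prod_pow]

/-- Strict nonlinearity removes the Taylor terms of degree zero and one, `taylorPoly` collects those
of degree `2` to `p - 1`, and the derivatives of order `p` bound the remainder. -/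
theorem IsNonlinearity.exists_remainder_bound {P p : ℕ} (hp : 2 ≤ p) (hpP : p ≤ P)
    {c : Label m n l → ℝ} {b : Forcing m n l} {d : Set (State m n l)}
    {N : ℝ → State m n l → State m n l} (h : IsNonlinearity P p c b d N) {S : Set ℝ}
    (hS : (fun q : ℝ × State m n l => iteratedFDeriv ℝ p (N q.1) q.2)
      =O[𝓟 S ×ˢ 𝓝 0] fun _ => (1 : ℝ)) :
    ∃ K δ : ℝ, 0 ≤ K ∧ 0 < δ ∧ ∀ t ∈ S, ∀ u, ‖u‖ < δ → ∀ κ,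
      |N t u κ - evalAt b t u (taylorPoly p c κ)| ≤ K * ‖u‖ ^ p := by
  obtain ⟨K, δ₁, hδ₁, hK⟩ := isBigO_principal_prod_nhds_iff.1 hS
  obtain ⟨δ₂, hδ₂, hball⟩ := Metric.isOpen_iff.1 h.isOpen 0 h.zero_mem
  refine ⟨max K 0, min δ₁ δ₂, le_max_right _ _, lt_min hδ₁ hδ₂, fun t ht u hu κ => ?_⟩
  have hsub : Metric.ball (0 : State m n l) (min δ₁ δ₂) ⊆ d :=
    (Metric.ball_subset_ball (min_le_right _ _)).trans hball
  have hsm : ContDiffOn ℝ P (N t) (Metric.ball 0 (min δ₁ δ₂)) := (h.smooth t).mono hsub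
  have hcomp : ContDiffOn ℝ P (fun v => N t v κ) (Metric.ball 0 (min δ₁ δ₂)) :=
    contDiffOn_pi.1 hsm κ
  obtain ⟨j, rfl⟩ : ∃ j, p = j + 1 := ⟨p - 1, by omega⟩
  have hbound : ∀ v ∈ Metric.ball (0 : State m n l) (min δ₁ δ₂),
      ‖iteratedFDeriv ℝ (j + 1) (fun v => N t v κ) v‖ ≤ max K 0 := by
    intro v hv
    have hat : ContDiffAt ℝ (j + 1 : ℕ) (N t) v :=
      (hsm.contDiffAt (Metric.isOpen_ball.mem_nhds hv)).of_le (by exact_mod_cast hpP)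
    have h₁ := (ContinuousLinearMap.proj (R := ℝ) (φ := fun _ : Idx m n l => ℝ)
      κ).norm_iteratedFDeriv_comp_left hat le_rfl
    have h₂ : ‖(ContinuousLinearMap.proj (R := ℝ) (φ := fun _ : Idx m n l => ℝ) κ)‖ ≤ 1 :=
      ContinuousLinearMap.opNorm_le_bound _ zero_le_one fun x => by
        simpa using norm_le_pi_norm x κ
    have h₃ := hK t ht v (lt_of_lt_of_le (mem_ball_zero_iff.1 hv) (min_le_left _ _))
    rw [norm_one, mul_one] at h₃
    refine (le_trans h₁ ?_).trans (le_max_left K 0)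
    exact (mul_le_of_le_one_left (norm_nonneg _) h₂).trans h₃
  have hT := norm_sub_taylor_le hcomp hpP hbound (mem_ball_zero_iff.2 hu)
  have hO : N t =O[𝓝 0] fun v : State m n l => ‖v - 0‖ ^ 2 := by
    refine (h.strictly_nonlinear t).trans (IsBigO.of_bound 3 (Eventually.of_forall fun v => ?_))
    rw [Real.norm_of_nonneg (orderGauge_nonneg 2 v), sub_zero, Real.norm_of_nonneg (by positivity)]
    exact orderGauge_le 2 v
  have hder : HasFDerivAt (N t) (0 : State m n l →L[ℝ] State m n l) 0 := hO.hasFDerivAt one_lt_two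
  have hzero : N t 0 = 0 := by
    have := hO.eq_zero_of_norm_pow (by norm_num)
    simpa using this
  have h0 : iteratedFDeriv ℝ 0 (fun v => N t v κ) 0 (fun _ => u) = 0 := by
    simp [hzero]
  have h1 : iteratedFDeriv ℝ 1 (fun v => N t v κ) 0 (fun _ => u) = 0 := by
    rw [iteratedFDeriv_one_apply, (hasFDerivAt_pi'.1 hder κ).fderiv]
    simp
  rw [Finset.range_eq_Ico, ← Finset.sum_Ico_consecutive _ (Nat.zero_le 2) hp] at hT
  have e : ∑ k ∈ Finset.Ico 2 (j + 1), ((k.factorial : ℝ))⁻¹ *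
      iteratedFDeriv ℝ k (fun v => N t v κ) 0 (fun _ => u) =
      evalAt b t u (taylorPoly (j + 1) c κ) := by
    rw [evalAt_taylorPoly]
    exact Finset.sum_congr rfl fun k hk =>
      h.taylor t κ k (Finset.mem_Ico.1 hk).1 (Finset.mem_Ico.1 hk).2 u
  have e₀ : ∑ k ∈ Finset.Ico 0 2, ((k.factorial : ℝ))⁻¹ *
      iteratedFDeriv ℝ k (fun v => N t v κ) 0 (fun _ => u) = 0 := by
    simp [Finset.sum_range_succ, h0, h1]
  rwa [e, e₀, zero_add] at hT

/-- For a single time, continuity of the derivative of order `p ≤ P` at the origin gives the bound.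
-/
theorem IsNonlinearity.iteratedFDeriv_isBigO {P p : ℕ} (hpP : p ≤ P)
    {c : Label m n l → ℝ} {b : Forcing m n l} {d : Set (State m n l)}
    {N : ℝ → State m n l → State m n l} (h : IsNonlinearity P p c b d N) (t : ℝ) :
    (fun q : ℝ × State m n l => iteratedFDeriv ℝ p (N q.1) q.2)
      =O[𝓟 {t} ×ˢ 𝓝 0] fun _ => (1 : ℝ) := by
  have hc : ContinuousAt (iteratedFDeriv ℝ p (N t)) 0 := by
    have hcont : ContinuousOn (iteratedFDeriv ℝ p (N t)) d := by
      refine ((h.smooth t).continuousOn_iteratedFDerivWithin (by exact_mod_cast hpP)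
        h.isOpen.uniqueDiffOn).congr fun v hv => (iteratedFDerivWithin_of_isOpen p h.isOpen hv).symm
    exact hcont.continuousAt (h.isOpen.mem_nhds h.zero_mem)
  have hO : iteratedFDeriv ℝ p (N t) =O[𝓝 0] fun _ => (1 : ℝ) := hc.isBigO_one ℝ
  obtain ⟨K, hK⟩ := hO.bound
  obtain ⟨δ, hδ, hball⟩ := Metric.eventually_nhds_iff_ball.1 hK
  refine isBigO_principal_prod_nhds_iff.2 ⟨K, δ, hδ, ?_⟩
  rintro _ rfl u hu
  exact hball u (mem_ball_zero_iff.2 hu)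

end NonlinearityExpansion

/-! ### Estimates and derivatives of multinomials with fast coefficients -/

section PolynomialEstimates

variable {m n l : ℕ} {μ : ℝ}

theorem IsFast.exists_bound (hμ : 0 ≤ μ) {a : Coeff m n l} (h : IsFast μ a)
    (b : Forcing m n l) : ∃ K, ∀ t, |a b t| ≤ K := by
  obtain ⟨K, hK⟩ := (h.bddCts hμ b).2
  exact ⟨K, fun t => by simpa using hK t⟩

theorem evalAt_eq_sum (b : Forcing m n l) (t : ℝ) (u : State m n l)
    (q : MvPolynomial (Idx m n l) (Coeff m n l)) {S : Finset (Idx m n l →₀ ℕ)}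
    (hS : q.support ⊆ S) : evalAt b t u q = ∑ s ∈ S, coeff s q b t * ∏ i, u i ^ s i := by
  rw [evalAt, eval₂_eq']
  refine Finset.sum_subset hS fun s _ hs => ?_
  rw [notMem_support_iff.1 hs, map_zero, zero_mul]

/-- Fast coefficients are bounded in time, so membership in the `k`-th power of the ideal becomes an
estimate of order `k` with one constant for all `t`. -/
theorem exists_evalAt_bound (hμ : 0 ≤ μ) {k : ℕ} {q : MvPolynomial (Idx m n l) (Coeff m n l)}
    (hq : q ∈ idealOfVars (Idx m n l) (Coeff m n l) ^ k) (hf : ∀ s, IsFast μ (coeff s q))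
    (b : Forcing m n l) :
    ∃ K, 0 ≤ K ∧ ∀ t, ∀ u : State m n l, ‖u‖ ≤ 1 → |evalAt b t u q| ≤ K * ‖u‖ ^ k := by
  choose K hK using fun s => (hf s).exists_bound hμ b
  have hK0 : ∀ s, 0 ≤ K s := fun s => (abs_nonneg _).trans (hK s 0)
  refine ⟨∑ s ∈ q.support, K s, Finset.sum_nonneg fun s _ => hK0 s, fun t u hu => ?_⟩
  rw [evalAt_eq_sum b t u q subset_rfl, Finset.sum_mul]
  refine (Finset.abs_sum_le_sum_abs _ _).trans (Finset.sum_le_sum fun s hs => ?_)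
  rw [abs_mul]
  refine mul_le_mul (hK s t) ?_ (abs_nonneg _) (hK0 s)
  rw [Finset.abs_prod]
  calc ∏ i, |u i ^ s i| ≤ ∏ i, ‖u‖ ^ s i := by
        refine Finset.prod_le_prod (fun i _ => abs_nonneg _) fun i _ => ?_
        rw [abs_pow]
        gcongr
        exact norm_le_pi_norm u i
    _ = ‖u‖ ^ Finsupp.degree s := by rw [Finset.prod_pow_eq_pow_sum, Finsupp.degree_eq_sum]
    _ ≤ ‖u‖ ^ k :=
        pow_le_pow_of_le_one (norm_nonneg u) hu ((mem_pow_idealOfVars_iff _ _).1 hq s hs)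

theorem hasFDerivAt_evalAt (b : Forcing m n l) (t : ℝ) (U : State m n l)
    (q : MvPolynomial (Idx m n l) (Coeff m n l)) :
    HasFDerivAt (fun U : State m n l => evalAt b t U q)
      (∑ i, evalAt b t U (pderiv i q) •
        (ContinuousLinearMap.proj i : State m n l →L[ℝ] ℝ)) U := by
  simp only [evalAt_eq]
  induction q using MvPolynomial.induction_on with
  | C a => simpa using hasFDerivAt_const (𝕜 := ℝ) (evalCoeff b t a) U
  | add p q hp hq =>
    simp only [map_add, add_smul, Finset.sum_add_distrib]
    exact hp.add hq
  | mul_X p i hp =>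
    have h := hp.mul (ContinuousLinearMap.proj (R := ℝ) (φ := fun _ : Idx m n l => ℝ) i).hasFDerivAt
    simp only [map_mul, eval₂Hom_X']
    refine h.congr_fderiv ?_
    ext v
    simp only [pderiv_mul, map_add, map_mul, eval₂Hom_X', pderiv_X, add_smul, Finset.sum_add_distrib]
    simp [Finset.mul_sum, Pi.single_apply, apply_ite, -Fintype.sum_sum_type]
    rw [add_comm]
    congr 1
    exact Finset.sum_congr rfl fun j _ => by ring

theorem contDiff_evalAt (b : Forcing m n l) (t : ℝ) (q : MvPolynomial (Idx m n l) (Coeff m n l)) :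
    ContDiff ℝ ∞ fun U : State m n l => evalAt b t U q := by
  simp only [fun U => evalAt_eq_sum b t U q subset_rfl]
  fun_prop

theorem FastDerivative.hasDerivAt_evalAt
    {T T' : Idx m n l → MvPolynomial (Idx m n l) (Coeff m n l)}
    (h : FastDerivative μ T T') (b : Forcing m n l) (t : ℝ) (U : State m n l) (κ : Idx m n l) :
    HasDerivAt (fun t => evalAt b t U (T κ)) (evalAt b t U (T' κ)) t := by
  classical
  -- The union of supports gives `T κ` and `T' κ` a common, time-independent index set.
  have e : (fun t => evalAt b t U (T κ)) = fun t =>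
      ∑ s ∈ (T κ).support ∪ (T' κ).support, coeff s (T κ) b t * ∏ i, U i ^ s i := by
    ext t
    exact evalAt_eq_sum b t U (T κ) Finset.subset_union_left
  rw [e, evalAt_eq_sum b t U (T' κ) Finset.subset_union_right]
  exact HasDerivAt.fun_sum fun s _ => ((h κ s).2.2 b t).mul_const _

end PolynomialEstimates

/-! ### Inverting the transform on balls independent of time -/

section UniformInverse

variable {m n l : ℕ} {μ : ℝ}

theorem Transform.hasFDerivAt_map (T : Transform m n l) (b : Forcing m n l) (t : ℝ)
    (U : State m n l) : HasFDerivAt (T.map b t) (ContinuousLinearMap.pi fun κ =>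
      ∑ i, evalAt b t U (pderiv i (T κ)) •
        (ContinuousLinearMap.proj i : State m n l →L[ℝ] ℝ)) U :=
  hasFDerivAt_pi.2 fun κ => hasFDerivAt_evalAt b t U (T κ)

theorem Transform.contDiff_map (T : Transform m n l) (b : Forcing m n l) (t : ℝ) :
    ContDiff ℝ ∞ (T.map b t) :=
  contDiff_pi.2 fun κ => contDiff_evalAt b t (T κ)

theorem Transform.map_sub_apply (T : Transform m n l) (b : Forcing m n l) (t : ℝ)
    (U : State m n l) (κ : Idx m n l) : T.map b t U κ - U κ = evalAt b t U (T κ - X κ) := by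
  simp [Transform.map, evalAt_eq]

/-- The partial derivatives of `T - id` have order one with constants uniform in time, so `T - id`
is `1/2`-Lipschitz on a ball independent of `t`, by the mean value inequality. -/
theorem Transform.exists_approximatesLinearOn (hμ : 0 ≤ μ) {T : Transform m n l}
    (hT : ∀ κ, T κ - X κ ∈ idealOfVars (Idx m n l) (Coeff m n l) ^ 2)
    (hf : ∀ κ s, IsFast μ (coeff s (T κ))) (b : Forcing m n l) :
    ∃ r : ℝ, 0 < r ∧ r ≤ 1 ∧ ∀ t, ApproximatesLinearOn (T.map b t)
      (ContinuousLinearEquiv.refl ℝ (State m n l) : State m n l →L[ℝ] State m n l)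
      (Metric.ball 0 r) (1 / 2) := by
  have hf' : ∀ κ, T κ - X κ ∈ coeffSubring (fastSubring m n l μ) := fun κ =>
    Subring.sub_mem _ (fun s => hf κ s) (X_mem_coeffSubring κ)
  choose K hK0 hK using fun κ i => exists_evalAt_bound hμ
    (pderiv_mem_pow_idealOfVars (k := 1) (hT κ) i) (pderiv_mem_coeffSubring (hf' κ) i) b
  set M : ℝ := ∑ κ, ∑ i, K κ i with hM
  have hM0 : 0 ≤ M := Finset.sum_nonneg fun κ _ => Finset.sum_nonneg fun i _ => hK0 κ i
  have hMκ : ∀ κ, ∑ i, K κ i ≤ M := fun κ =>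
    Finset.single_le_sum (f := fun κ => ∑ i, K κ i)
      (fun κ _ => Finset.sum_nonneg fun i _ => hK0 κ i) (Finset.mem_univ κ)
  -- The radius makes `M * r ≤ 1 / 2` and `r ≤ 1`; the latter is needed because the multinomial
  -- bounds hold in the unit ball only.
  refine ⟨1 / (2 * (M + 1)), by positivity, ?_, fun t U hU V hV => ?_⟩
  · rw [div_le_one (by positivity)]
    linarith
  have hr1 : (1 : ℝ) / (2 * (M + 1)) ≤ 1 := by
    rw [div_le_one (by positivity)]
    linarith
  rw [pi_norm_le_iff_of_nonneg (by positivity)]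
  intro κ
  have hder : ∀ W ∈ Metric.ball (0 : State m n l) (1 / (2 * (M + 1))),
      ‖∑ i, evalAt b t W (pderiv i (T κ - X κ)) •
        (ContinuousLinearMap.proj i : State m n l →L[ℝ] ℝ)‖ ≤ 1 / 2 := by
    intro W hW
    rw [mem_ball_zero_iff] at hW
    calc _ ≤ ∑ i, K κ i * ‖W‖ := by
          refine norm_sum_le_of_le _ fun i _ => ?_
          rw [norm_smul]
          have h₁ := hK κ i t W (hW.le.trans hr1)
          rw [pow_one] at h₁
          have h₂ : ‖(ContinuousLinearMap.proj i : State m n l →L[ℝ] ℝ)‖ ≤ 1 :=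
            ContinuousLinearMap.opNorm_le_bound _ zero_le_one fun x => by
              simpa using norm_le_pi_norm x i
          calc _ ≤ (K κ i * ‖W‖) * 1 := mul_le_mul h₁ h₂ (norm_nonneg _)
                (mul_nonneg (hK0 κ i) (norm_nonneg _))
            _ = _ := mul_one _
      _ ≤ M * (1 / (2 * (M + 1))) := by
          rw [← Finset.sum_mul]
          exact mul_le_mul (hMκ κ) hW.le (norm_nonneg _) hM0
      _ ≤ 1 / 2 := by
          rw [mul_one_div, div_le_div_iff₀ (by positivity) (by norm_num)]
          linarith
  have h := (convex_ball (0 : State m n l) _).norm_image_sub_le_of_norm_hasFDerivWithin_le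
    (fun W _ => (hasFDerivAt_evalAt b t W (T κ - X κ)).hasFDerivWithinAt) hder hV hU
  convert h using 1
  rw [← T.map_sub_apply, ← T.map_sub_apply]
  · simp only [Pi.sub_apply, ContinuousLinearEquiv.coe_refl, ContinuousLinearMap.id_apply]
    congr 1
    ring
  · norm_num

variable {E : Type*} [NormedAddCommGroup E] [NormedSpace ℝ E] [CompleteSpace E]

theorem exists_openPartialHomeomorph_of_approximatesLinearOn_id {f : E → E} {r : ℝ} (hr : 0 < r)
    (hf0 : f 0 = 0) (hf : ContDiff ℝ ∞ f)
    (h : ApproximatesLinearOn f (ContinuousLinearEquiv.refl ℝ E : E →L[ℝ] E)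
      (Metric.ball 0 r) (1 / 2)) :
    ∃ Ψ : OpenPartialHomeomorph E E, Ψ.source = Metric.ball 0 r ∧
      Metric.ball 0 (r / 4) ⊆ Ψ.target ∧ (Ψ : E → E) = f ∧ ContDiffOn ℝ ∞ Ψ.symm Ψ.target ∧
      ∀ u ∈ Ψ.target, ‖Ψ.symm u‖ ≤ 2 * ‖u‖ := by
  have hN : Subsingleton E ∨
      (1 / 2 : NNReal) < ‖((ContinuousLinearEquiv.refl ℝ E).symm : E →L[ℝ] E)‖₊⁻¹ := by
    rcases subsingleton_or_nontrivial E with hE | hE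
    · exact Or.inl hE
    · right
      have : ‖((ContinuousLinearEquiv.refl ℝ E).symm : E →L[ℝ] E)‖₊ = 1 := by
        ext; simp
      rw [this, inv_one]
      exact NNReal.half_lt_self one_ne_zero
  have h0 : (0 : E) ∈ Metric.ball (0 : E) r := Metric.mem_ball_self hr
  refine ⟨h.toOpenPartialHomeomorph f _ hN Metric.isOpen_ball, rfl, ?_, rfl, ?_, ?_⟩
  · rcases subsingleton_or_nontrivial E with hE | hE
    · intro u _
      exact ⟨0, h0, Subsingleton.elim _ _⟩
    -- A closed ball of radius `r / 2` in the source is covered with the factor `1 - 1/2`; this is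
    -- the origin of `r / 4`.
    · have h₁ := h.closedBall_subset_target hN Metric.isOpen_ball (b := 0) (ε := r / 2)
        (by positivity) (Metric.closedBall_subset_ball (by linarith))
      refine subset_trans ?_ h₁
      have : ‖((ContinuousLinearEquiv.refl ℝ E).symm : E →L[ℝ] E)‖₊ = 1 := by
        ext; simp
      rw [hf0, this]
      refine Metric.ball_subset_closedBall.trans (Metric.closedBall_subset_closedBall ?_)
      norm_num
      linarith
  · intro u hu
    set Ψ := h.toOpenPartialHomeomorph f _ hN Metric.isOpen_ball with hΨ
    have hmem : Ψ.symm u ∈ Metric.ball (0 : E) r := Ψ.map_target hu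
    have hfd : HasFDerivAt f (fderiv ℝ f (Ψ.symm u)) (Ψ.symm u) :=
      (hf.differentiable (by simp)).differentiableAt.hasFDerivAt
    -- The Lipschitz bound on `f - id` bounds its derivative by `1/2`, so the derivative of `f` is
    -- invertible by a Neumann series and the inverse is smooth.
    have hle : ‖fderiv ℝ f (Ψ.symm u) - ContinuousLinearMap.id ℝ E‖ ≤ 1 / 2 := by
      have hlip := ApproximatesLinearOn.approximatesLinearOn_iff_lipschitzOnWith.1 h
      exact (hfd.sub (ContinuousLinearMap.id ℝ E).hasFDerivAt).le_of_lipschitzOn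
        (Metric.isOpen_ball.mem_nhds hmem) hlip
    have hunit : IsUnit (fderiv ℝ f (Ψ.symm u)) := by
      have := isUnit_one_sub_of_norm_lt_one (x := 1 - fderiv ℝ f (Ψ.symm u))
        (by
          rw [norm_sub_rev]
          exact lt_of_le_of_lt hle (by norm_num))
      simpa using this
    obtain ⟨A, hA⟩ := hunit
    refine (Ψ.contDiffAt_symm (f₀' := ContinuousLinearEquiv.unitsEquiv ℝ E A) hu ?_
      hf.contDiffAt).contDiffWithinAt
    have : ((ContinuousLinearEquiv.unitsEquiv ℝ E A : E ≃L[ℝ] E) : E →L[ℝ] E) = A := by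
      ext v; rfl
    rw [this, hA]
    exact hfd
  · intro u hu
    set Ψ := h.toOpenPartialHomeomorph f _ hN Metric.isOpen_ball with hΨ
    have hmem : Ψ.symm u ∈ Metric.ball (0 : E) r := Ψ.map_target hu
    -- Compared with the origin, the point `Ψ.symm u` differs from its image `u` by at most half its
    -- own norm; this gives the factor `2`.
    have h₁ := h _ hmem _ h0
    have h₂ : f (Ψ.symm u) = u := Ψ.right_inv hu
    rw [h₂, hf0] at h₁
    simp only [sub_zero, ContinuousLinearEquiv.coe_refl, ContinuousLinearMap.id_apply] at h₁
    have h₃ := norm_sub_norm_le (Ψ.symm u) u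
    rw [norm_sub_rev] at h₃
    norm_num at h₁
    linarith

end UniformInverse

/-! ### The error between the transformed normal form and the given system -/

section Closeness

variable {m n l : ℕ} {μ : ℝ} {A : Matrix (Fin m) (Fin m) ℝ} {B : Matrix (Fin n) (Fin n) ℝ}
  {C : Matrix (Fin l) (Fin l) ℝ} {p : ℕ} {c : Label m n l → ℝ}
  {T T' q : Idx m n l → MvPolynomial (Idx m n l) (Coeff m n l)}

theorem velocity_map (hd : FastDerivative μ T T') (b : Forcing m n l)
    (W : ℝ → State m n l → State m n l) (t : ℝ) (U : State m n l) (κ : Idx m n l) :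
    velocity (fun t => Transform.map T b t) W t U κ =
      evalAt b t U (T' κ) + ∑ i, evalAt b t U (pderiv i (T κ)) * W t U i := by
  have h₁ : HasDerivAt (fun τ => Transform.map T b τ U) (fun κ => evalAt b t U (T' κ)) t :=
    hasDerivAt_pi.2 fun κ => hd.hasDerivAt_evalAt b t U κ
  rw [velocity, h₁.deriv, (Transform.hasFDerivAt_map T b t U).fderiv]
  simp [-Fintype.sum_sum_type]

/-- Links algebra and analysis: substitution `bind₁ T` becomes composition with the transform, so
the formal residual evaluates to the true residual of the system truncated to its Taylor polynomial.
-/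
theorem evalAt_residual (b : Forcing m n l) (t : ℝ) (U : State m n l) (κ : Idx m n l) :
    evalAt b t U (residual (constMatrix A B C) (taylorPoly p c) T T' q κ) =
      evalAt b t U (T' κ) + ∑ i, evalAt b t U (pderiv i (T κ)) *
        evalAt b t U (linForm (constMatrix A B C) i + q i) -
      linearPart A B C (Transform.map T b t U) κ -
      evalAt b t (Transform.map T b t U) (taylorPoly p c κ) := by
  have hbind : eval₂Hom (evalCoeff b t) U (bind₁ T (taylorPoly p c κ)) =
      eval₂Hom (evalCoeff b t) (Transform.map T b t U) (taylorPoly p c κ) :=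
    eval₂Hom_bind₁ _ _ _ _
  have hlin := evalAt_linForm A B C b t (Transform.map T b t U) κ
  rw [← hlin]
  simp only [evalAt_eq, residual, homOp_apply, linDerivation_apply, map_add, map_sub, map_sum,
    map_mul, hbind, mul_add, Finset.sum_add_distrib]
  have hL : ∑ κ', eval₂Hom (evalCoeff b t) U (MvPolynomial.C (constMatrix A B C κ κ')) *
      eval₂Hom (evalCoeff b t) U (T κ') =
      eval₂Hom (evalCoeff b t) (Transform.map T b t U) (linForm (constMatrix A B C) κ) := by
    simp only [linForm, map_sum, map_mul, eval₂Hom_C, eval₂Hom_X']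
    rfl
  have hcomm : ∑ i, eval₂Hom (evalCoeff b t) U (linForm (constMatrix A B C) i) *
      eval₂Hom (evalCoeff b t) U (pderiv i (T κ)) =
      ∑ i, eval₂Hom (evalCoeff b t) U (pderiv i (T κ)) *
      eval₂Hom (evalCoeff b t) U (linForm (constMatrix A B C) i) :=
    Finset.sum_congr rfl fun i _ => mul_comm _ _
  rw [hL, hcomm]
  ring

/-- The vector field of the normal form and the given one agree up to order `p`. -/
theorem FormalNormalForm.closeOn (hμ : 0 ≤ μ) (h : FormalNormalForm μ A B C p c p T T' q)
    {P : ℕ} (hp : 2 ≤ p) (hpP : p ≤ P) {b : Forcing m n l} {d : Set (State m n l)}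
    {N : ℝ → State m n l → State m n l} (hN : IsNonlinearity P p c b d N) {ρ : ℝ} (hρ : 0 < ρ) {Ψ : ℝ → OpenPartialHomeomorph (State m n l) (State m n l)}
    (htarget : ∀ t, Metric.ball 0 ρ ⊆ (Ψ t).target)
    (hΨ : ∀ t, (Ψ t : State m n l → State m n l) = Transform.map T b t)
    (hsymm : ∀ t, ∀ u ∈ (Ψ t).target, ‖(Ψ t).symm u‖ ≤ 2 * ‖u‖)
    {W : ℝ → State m n l → State m n l}
    (hW : ∀ t U κ, W t U κ = evalAt b t U (linForm (constMatrix A B C) κ + q κ)) {S : Set ℝ}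
    (hS : (fun q : ℝ × State m n l => iteratedFDeriv ℝ p (N q.1) q.2)
      =O[𝓟 S ×ˢ 𝓝 0] fun _ => (1 : ℝ)) :
    CloseOn S p Ψ W (fun t u => linearPart A B C u + N t u) := by
  obtain ⟨K, δ, hK0, hδ, hK⟩ := hN.exists_remainder_bound hp hpP hS
  choose R hR0 hR using fun κ => exists_evalAt_bound hμ (h.residual_mem κ) (h.isFast_residual κ) b
  choose M hM0 hM using fun κ => exists_evalAt_bound hμ (k := 1)
    (by simpa using h.mem_idealOfVars κ) (fun s => (h.fast κ s).1) b
  set M' : ℝ := ∑ κ, M κ with hM'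
  have hM'0 : 0 ≤ M' := Finset.sum_nonneg fun κ _ => hM0 κ
  have hMκ : ∀ κ, M κ ≤ M' := fun κ =>
    Finset.single_le_sum (f := M) (fun κ _ => hM0 κ) (Finset.mem_univ κ)
  set R' : ℝ := ∑ κ, R κ with hR'
  have hR'0 : 0 ≤ R' := Finset.sum_nonneg fun κ _ => hR0 κ
  have hRκ : ∀ κ, R κ ≤ R' := fun κ =>
    Finset.single_le_sum (f := R) (fun κ _ => hR0 κ) (Finset.mem_univ κ)
  have hΨ' : (fun t => (Ψ t : State m n l → State m n l)) = fun t => Transform.map T b t :=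
    funext hΨ
  have hmap : ∀ t U, ‖U‖ ≤ 1 → ‖Transform.map T b t U‖ ≤ M' * ‖U‖ := by
    intro t U hU
    rw [pi_norm_le_iff_of_nonneg (by positivity)]
    intro κ
    have := hM κ t U hU
    rw [pow_one] at this
    exact this.trans (mul_le_mul_of_nonneg_right (hMκ κ) (norm_nonneg U))
  -- The radius keeps `U` in the unit ball and its image, of norm at most `M' * ‖U‖`, in the domain
  -- of the Taylor estimate. The error is the formal residual minus the Taylor remainder at the
  -- image.
  have key : ∀ t ∈ S, ∀ U, ‖U‖ < min 1 (δ / (M' + 1)) →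
      ‖velocity (fun t => Ψ t) W t U - (linearPart A B C (Ψ t U) + N t (Ψ t U))‖ ≤
        (R' + K * M' ^ p) * ‖U‖ ^ p := by
    intro t ht U hU
    have hU1 : ‖U‖ ≤ 1 := hU.le.trans (min_le_left _ _)
    have hUδ : ‖Transform.map T b t U‖ < δ := by
      have h₁ := hU.trans_le (min_le_right _ _)
      rw [lt_div_iff₀ (by positivity)] at h₁
      have h₂ := hmap t U hU1
      have h₃ := norm_nonneg U
      linarith
    rw [pi_norm_le_iff_of_nonneg (by positivity)]
    intro κ
    have e : (velocity (fun t => Ψ t) W t U -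
        (linearPart A B C (Ψ t U) + N t (Ψ t U))) κ =
        evalAt b t U (residual (constMatrix A B C) (taylorPoly p c) T T' q κ) -
        (N t (Transform.map T b t U) κ -
          evalAt b t (Transform.map T b t U) (taylorPoly p c κ)) := by
      rw [hΨ', hΨ, Pi.sub_apply, velocity_map h.fast, evalAt_residual]
      simp only [hW, Pi.add_apply]
      ring
    rw [e, Real.norm_eq_abs]
    refine (abs_sub _ _).trans ?_
    rw [add_mul]
    refine add_le_add ((hR κ t U hU1).trans ?_) ((hK t ht _ hUδ κ).trans ?_)
    · exact mul_le_mul_of_nonneg_right (hRκ κ) (by positivity)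
    · rw [mul_assoc, ← mul_pow]
      gcongr
      exact hmap t U hU1
  have hδ' : 0 < min 1 (δ / (M' + 1)) := lt_min one_pos (by positivity)
  have hconst : 0 ≤ R' + K * M' ^ p := by positivity
  constructor
  -- The error at `u` is that at `U = Ψ⁻¹ u`, where `‖U‖ ≤ 2 ‖u‖`; hence the factor `2 ^ p` and the
  -- halved radius.
  · refine isBigO_principal_prod_nhds_iff.2
      ⟨(R' + K * M' ^ p) * 2 ^ p, min ρ (min 1 (δ / (M' + 1)) / 2),
        lt_min hρ (by positivity), fun t ht u hu => ?_⟩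
    have hut : u ∈ (Ψ t).target :=
      htarget t (mem_ball_zero_iff.2 (hu.trans_le (min_le_left _ _)))
    have hsy := hsymm t u hut
    have h₁ := key t ht ((Ψ t).symm u) (by
      have := hu.trans_le (min_le_right _ _)
      linarith)
    rw [(Ψ t).right_inv hut] at h₁
    refine h₁.trans ?_
    rw [Real.norm_of_nonneg (orderGauge_nonneg p u), mul_assoc]
    refine mul_le_mul_of_nonneg_left ?_ hconst
    calc ‖(Ψ t).symm u‖ ^ p ≤ (2 * ‖u‖) ^ p := by gcongr
      _ = 2 ^ p * ‖u‖ ^ p := mul_pow _ _ _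
      _ ≤ 2 ^ p * orderGauge p u := by
          gcongr
          exact norm_pow_le_orderGauge p u
  · refine isBigO_principal_prod_nhds_iff.2
      ⟨R' + K * M' ^ p, _, hδ', fun t ht u hu => (key t ht u hu).trans ?_⟩
    rw [Real.norm_of_nonneg (orderGauge_nonneg p u)]
    exact mul_le_mul_of_nonneg_left (norm_pow_le_orderGauge p u) hconst

end Closeness

end NonautNF

theorem mainTheorem3 (m n l : ℕ) (A : Matrix (Fin m) (Fin m) ℝ) (B : Matrix (Fin n) (Fin n) ℝ)
    (C : Matrix (Fin l) (Fin l) ℝ) (α β μ : ℝ) (P : ℕ)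
    (hgap : NonautNF.SpectralGap A B C α β μ P) (p : ℕ) (hp : 2 ≤ p) (hpP : p ≤ P)
    (c : NonautNF.Label m n l → ℝ) :
    ∃ (T : NonautNF.Transform m n l) (Q : NonautNF.NormalForm m n l),
      T.NearIdentity ∧ T.Regular μ ∧ Q.StrictlyNonlinear ∧ Q.MemoryOnlyQuadratic μ ∧
      ∀ (b : NonautNF.Forcing m n l) (d : Set (NonautNF.State m n l))
        (N : ℝ → NonautNF.State m n l → NonautNF.State m n l),
        NonautNF.IsNonlinearity P p c b d N →
        ∃ (r ρ : ℝ) (Ψ : ℝ → OpenPartialHomeomorph (NonautNF.State m n l) (NonautNF.State m n l)),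
          0 < r ∧ 0 < ρ ∧
          (∀ t, (Ψ t).source = Metric.ball 0 r ∧ Metric.ball 0 ρ ⊆ (Ψ t).target ∧
            (Ψ t : NonautNF.State m n l → NonautNF.State m n l) = T.map b t ∧
            ContDiffOn ℝ ∞ (Ψ t).symm (Ψ t).target) ∧
          (∀ t, NonautNF.CloseOn {t} p Ψ (Q.field A B C b)
            (fun t u => NonautNF.linearPart A B C u + N t u)) ∧
          (∀ S : Set ℝ,
            ((fun q : ℝ × NonautNF.State m n l => iteratedFDeriv ℝ p (N q.1) q.2)
              =O[𝓟 S ×ˢ 𝓝 0] fun _ => (1 : ℝ)) →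
            NonautNF.CloseOn S p Ψ (Q.field A B C b)
              (fun t u => NonautNF.linearPart A B C u + N t u)) := by
  have hμ : 0 ≤ μ := le_trans (by have := hgap.alpha_nonneg; positivity) hgap.threshold_lower
  obtain ⟨T, T', q, h⟩ := NonautNF.exists_formalNormalForm hgap c hp hpP
  obtain ⟨Q, hQ, hQ', hfield⟩ := NonautNF.exists_normalForm A B C h.nonlinear h.memory h.retained
  refine ⟨T, Q, fun κ s hs => (MvPolynomial.mem_pow_idealOfVars_iff' _ _).1 (h.nearIdentity κ) s hs,
    fun κ s => ⟨(h.fast κ s).1, fun b => ?_⟩, hQ, hQ', fun b d N hN => ?_⟩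
  · have hd := (h.fast κ s).2.2 b
    rw [contDiff_one_iff_deriv]
    refine ⟨fun t => (hd t).differentiableAt, ?_⟩
    -- The time derivative is a coefficient of `T'`, again a fast expression and therefore
    -- continuous.
    rw [funext fun t => (hd t).deriv]
    have := ((h.fast κ s).2.1.bddCts hμ b).1
    exact Complex.continuous_re.comp this
  · obtain ⟨r, hr, -, happ⟩ := NonautNF.Transform.exists_approximatesLinearOn hμ h.nearIdentity
      (fun κ s => (h.fast κ s).1) b
    have hzero : ∀ t, NonautNF.Transform.map T b t 0 = 0 := by
      intro t
      ext κ
      obtain ⟨K, -, hK⟩ := NonautNF.exists_evalAt_bound hμ (k := 1)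
        (by simpa using h.mem_idealOfVars κ) (fun s => (h.fast κ s).1) b
      have h0 := hK t 0 (by simp)
      rw [norm_zero, pow_one, mul_zero, abs_nonpos_iff] at h0
      exact h0
    choose Ψ hs ht hΨ hsm hsy using fun t =>
      NonautNF.exists_openPartialHomeomorph_of_approximatesLinearOn_id hr (hzero t)
        (NonautNF.Transform.contDiff_map T b t) (happ t)
    have hclose : ∀ S : Set ℝ,
        ((fun q : ℝ × NonautNF.State m n l => iteratedFDeriv ℝ p (N q.1) q.2)
          =O[𝓟 S ×ˢ 𝓝 0] fun _ => (1 : ℝ)) →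
        NonautNF.CloseOn S p Ψ (Q.field A B C b)
          (fun t u => NonautNF.linearPart A B C u + N t u) := fun S hS =>
      h.closeOn hμ hp hpP hN (by positivity : 0 < r / 4) ht hΨ hsy (hfield b) hS
    exact ⟨r, r / 4, Ψ, hr, by positivity, fun t => ⟨hs t, ht t, hΨ t, hsm t⟩,
      fun t => hclose {t} (hN.iteratedFDeriv_isBigO hpP t), hclose⟩
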